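/- Let $d(n)$ be the number of positive divisors of $n$. For $\ell\in\{1,2,3\}$ put $$s_{7;\ell}(d)=\sum_{\substack{n_1,\dots,n_7\in\mathbb{N}^*\\ \sqrt{n_1}+\cdots+\sqrt{n_\ell}=\sqrt{n_{\ell+1}}+\cdots+\sqrt{n_7}}}\frac{d(n_1)d(n_2)\cdots d(n_7)}{(n_1n_2\cdots n_7)^{3/4}},$$ and for real $T\ge 10$ and $x\in[T,2T]$ put $$R_1(x)=\frac{1}{\sqrt2\,\pi}\sum_{1\le n\le T^{1/4}}\frac{d(n)}{n^{3/4}}\,x^{1/4}\cos\left(4\pi\sqrt{nx}-\frac{\pi}{4}\right).$$ Then the series $s_{7;1}(d)$, $s_{7;2}(d)$, $s_{7;3}(d)$ converge, and for every $\varepsilon>0$, uniformly for all real $T\ge 10$, $$\int_T^{2T}R_1(x)^7\,dx=\frac{7\left(5s_{7;3}(d)-3s_{7;2}(d)-s_{7;1}(d)\right)}{2816\,\pi^7}\left((2T)^{11/4}-T^{11/4}\right)+O_\varepsilon\left(T^{11/4-1/336+\varepsilon}\right).$$ -/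

import Mathlib

/-- The Dirichlet divisor function `d(n)`, as a real number. -/
def divisorFn (n : ℕ) : ℝ := (n.divisors.card : ℝ)

/-- Tuples `(n₁, …, n_k)` of positive integers with
`√n₁ + ⋯ + √n_ℓ = √n_{ℓ+1} + ⋯ + √n_k`. -/
def sqrtSolutions (k ℓ : ℕ) : Set (Fin k → ℕ+) :=
  {n | ∑ i with i.val < ℓ, Real.sqrt (n i : ℝ) = ∑ i with ℓ ≤ i.val, Real.sqrt (n i : ℝ)}

/-- The general term `f(n₁) ⋯ f(n_k) / (n₁ ⋯ n_k)^{3/4}`. -/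
noncomputable def sTerm {k : ℕ} (f : ℕ → ℝ) (n : Fin k → ℕ+) : ℝ :=
  (∏ i, f (n i : ℕ)) / (∏ i, (n i : ℝ)) ^ (3 / 4 : ℝ)

/-- The series `s_{k;ℓ}(f)`. -/
noncomputable def sSeries (k ℓ : ℕ) (f : ℕ → ℝ) : ℝ :=
  ∑' n : sqrtSolutions k ℓ, sTerm f n.1

/-- The Voronoi-type cosine sum truncated at `n ≤ y`. -/
noncomputable def voronoiSum (y x : ℝ) : ℝ :=
  1 / (Real.sqrt 2 * Real.pi) * ∑ n ∈ Finset.Icc 1 ⌊y⌋₊,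
    divisorFn n / (n : ℝ) ^ (3 / 4 : ℝ) * x ^ (1 / 4 : ℝ) *
      Real.cos (4 * Real.pi * Real.sqrt ((n : ℝ) * x) - Real.pi / 4)

/-! Up to the factor x^{1/4}/(√2 π), `voronoiSum` is the real part of a unimodular constant times an
exponential sum with frequencies √n, evaluated at v = 4π√x. Its seventh power has phases 4π√x(±√n₁ ±
⋯ ± √n₇). Tuples whose alternating sum vanishes give the main term; the others must be shown to
cancel.

For n up to y ≈ T^{1/84} this works term by term. The product of the nonzero alternating sums over
all sign choices is a nonzero integer, so each of them is at least (7√y)^{-63} in absolute value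
(`one_le_abs_altSum_mul`), and every off-diagonal integral saves a factor √T up to a power of y
(`abs_integral_cosSum_sub_le`).

The remaining n up to T^{1/4} lie in O(log T) blocks [(5/4)^k, (5/4)^{k+1}). Adding the block B_k
changes the seventh power by at most 7|B_k|(∑_{i≤k}|B_i|)^6, so it suffices that the mean of
|B_k||B_i|^6 decays in the block length N = (5/4)^k. The mean over [T, 2T] is dominated by a
Gaussian mean in v at scale X = 4π√T. Since the Gaussian has a positive, rapidly decaying Fourier
transform, the mean square of an exponential sum is governed by the number of pairs of frequencies
at distance about 1/X.

Two counting problems feed the moments. For the fourth moment one counts |√a + √b − √c − √d| ≤ δ;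
squaring out turns this into 16h²m − k² = e with e small, and the congruence k² ≡ −e mod 16h² has
few solutions on average over e ≠ 0 (`exists_card_close_quad_le`). For the sixth moment, van der
Corput differencing replaces |S|^6 by |S|^4 and the products |S|²|S_h|², where S_h is the sum
differenced by a shift h < H. The frequencies of S S_h are √n + √(m+h) − √m, and counting close
pairs of them amounts to counting integer points near a convex curve (`card_near_sqrtMix_le`). This
gives R^{4.23} instead of the R^{4.5} that follows from interpolating the fourth moment with the
trivial bound.

Inserting the weights d(n)n^{-3/4} and using Hölder, the mean of |B_k||B_i|^6 is at most N^{-1/4}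
when N^{5/2} ≤ X, and N^{-1/50} whenever N² ≤ X, up to X^ε (`exists_mixed_moments`). The same mean
values majorise the nonnegative diagonal sum at any X, which gives convergence of the series with
tail N^{-1/4+ε} (`exists_diagSum_rate`). At the cut-off N ≈ T^{1/84} both the diagonal tail and the
first added blocks contribute T^{-1/336}, and this decides the error term. -/

open MeasureTheory ProbabilityTheory

/-! ### The divisor bound -/

lemma succ_le_mul_rpow {ε : ℝ} (hε : 0 < ε) {p : ℕ} (hp : 2 ≤ p) (e : ℕ) :
    (e + 1 : ℝ) ≤ (min 1 (ε * Real.log 2))⁻¹ * ((p : ℝ) ^ e) ^ ε := by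
  have hl : 0 < Real.log 2 := Real.log_pos (by norm_num)
  have hc : 0 < min 1 (ε * Real.log 2) := lt_min one_pos (by positivity)
  rw [inv_mul_eq_div, le_div_iff₀ hc]
  have h1 : ((2 : ℝ) ^ e) ^ ε ≤ ((p : ℝ) ^ e) ^ ε := by
    have : (2 : ℝ) ≤ p := by exact_mod_cast hp
    gcongr
  have h2 : ((2 : ℝ) ^ e) ^ ε = Real.exp (e * (ε * Real.log 2)) := by
    rw [← Real.rpow_natCast, ← Real.rpow_mul (by norm_num), Real.rpow_def_of_pos (by norm_num)]
    congr 1; ring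
  have h3 := Real.add_one_le_exp (e * (ε * Real.log 2))
  have h4 : (e : ℝ) * min 1 (ε * Real.log 2) ≤ e * (ε * Real.log 2) := by
    gcongr; exact min_le_right _ _
  have h5 := min_le_left 1 (ε * Real.log 2)
  nlinarith

lemma succ_le_rpow_of_large {ε : ℝ} (hε : 0 < ε) {p : ℕ} (hp : (2 : ℝ) ^ (1 / ε) ≤ p) (e : ℕ) :
    (e + 1 : ℝ) ≤ ((p : ℝ) ^ e) ^ ε := by
  have h1 : (2 : ℝ) ≤ (p : ℝ) ^ ε := by
    calc (2 : ℝ) = ((2 : ℝ) ^ (1 / ε)) ^ ε := by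
          rw [← Real.rpow_mul (by norm_num)]; simp [hε.ne']
      _ ≤ _ := by gcongr
  have h2 : ((p : ℝ) ^ e) ^ ε = ((p : ℝ) ^ ε) ^ e := by
    rw [← Real.rpow_natCast, ← Real.rpow_mul (by positivity), ← Real.rpow_natCast,
      ← Real.rpow_mul (by positivity), mul_comm]
  rw [h2]
  calc (e + 1 : ℝ) ≤ 2 ^ e := by exact_mod_cast Nat.lt_two_pow_self
    _ ≤ _ := by gcongr

/-- By multiplicativity d(n)/n^ε is a product of factors (e+1)/p^{eε}. Such a factor is at most 1
once p ≥ 2^{1/ε}, because e + 1 ≤ 2^e; each of the at most P smaller primes costs at most the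
constant c. -/
theorem exists_card_divisors_le {ε : ℝ} (hε : 0 < ε) :
    ∃ C : ℝ, 1 ≤ C ∧ ∀ n : ℕ, n ≠ 0 → (n.divisors.card : ℝ) ≤ C * (n : ℝ) ^ ε := by
  set c : ℝ := (min 1 (ε * Real.log 2))⁻¹ with hc
  set P : ℕ := ⌈(2 : ℝ) ^ (1 / ε)⌉₊ with hP
  have hl : 0 < Real.log 2 := Real.log_pos (by norm_num)
  have hc1 : 1 ≤ c := by
    rw [hc, one_le_inv₀ (lt_min one_pos (by positivity))]; exact min_le_left _ _
  refine ⟨c ^ P, one_le_pow₀ hc1, fun n hn => ?_⟩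
  rw [Nat.card_divisors hn]
  push_cast
  have hn' : (n : ℝ) ^ ε = ∏ p ∈ n.primeFactors, ((p : ℝ) ^ n.factorization p) ^ ε := by
    rw [Real.finsetProd_rpow _ _ (fun i _ => by positivity)]
    congr 1
    conv_lhs => rw [← Nat.prod_factorization_pow_eq_self hn]
    rw [Nat.prod_factorization_eq_prod_primeFactors]
    push_cast; rfl
  have key : ∀ p ∈ n.primeFactors, ((n.factorization p : ℝ) + 1) ≤
      (if p < P then c else 1) * ((p : ℝ) ^ n.factorization p) ^ ε := by
    intro p hp
    have hp2 := (Nat.prime_of_mem_primeFactors hp).two_le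
    split_ifs with h
    · exact succ_le_mul_rpow hε hp2 _
    · rw [one_mul]
      exact succ_le_rpow_of_large hε (Nat.ceil_le.1 (not_lt.1 h)) _
  calc ∏ p ∈ n.primeFactors, ((n.factorization p : ℝ) + 1)
      ≤ ∏ p ∈ n.primeFactors, (if p < P then c else 1) * ((p : ℝ) ^ n.factorization p) ^ ε :=
        Finset.prod_le_prod (fun _ _ => by positivity) key
    _ = (∏ p ∈ n.primeFactors, (if p < P then c else 1)) * (n : ℝ) ^ ε := by
        rw [Finset.prod_mul_distrib, hn']
    _ ≤ c ^ P * (n : ℝ) ^ ε := by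
        gcongr
        rw [Finset.prod_ite, Finset.prod_const, Finset.prod_const_one, mul_one]
        apply pow_le_pow_right₀ hc1
        calc _ ≤ (Finset.range P).card := Finset.card_le_card (fun x hx => by
                simp at hx ⊢; exact hx.2)
          _ = P := by simp

/-! ### Bounded continuous functions and the Gaussian mean -/

/-- Continuous and bounded functions on the line. -/
def BddCont {E : Type*} [NormedAddCommGroup E] (f : ℝ → E) : Prop :=
  Continuous f ∧ ∃ C, ∀ x, ‖f x‖ ≤ C

namespace BddCont

variable {E : Type*} [NormedAddCommGroup E]

lemma integrable {f : ℝ → E} (hf : BddCont f) (μ : Measure ℝ) [IsFiniteMeasure μ] :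
    Integrable f μ := by
  obtain ⟨hc, C, hC⟩ := hf
  exact Integrable.of_bound hc.aestronglyMeasurable C (Filter.Eventually.of_forall hC)

lemma const (c : E) : BddCont (fun _ => c) := ⟨continuous_const, ‖c‖, fun _ => le_rfl⟩

lemma add {f g : ℝ → E} (hf : BddCont f) (hg : BddCont g) : BddCont (fun x => f x + g x) := by
  obtain ⟨hc, C, hC⟩ := hf
  obtain ⟨hc', C', hC'⟩ := hg
  exact ⟨hc.add hc', C + C', fun x => (norm_add_le _ _).trans (add_le_add (hC x) (hC' x))⟩

lemma mul {A : Type*} [NormedRing A] {f g : ℝ → A} (hf : BddCont f) (hg : BddCont g) :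
    BddCont (fun x => f x * g x) := by
  obtain ⟨hc, C, hC⟩ := hf
  obtain ⟨hc', C', hC'⟩ := hg
  exact ⟨hc.mul hc', C * C', fun x => (norm_mul_le _ _).trans
    (mul_le_mul (hC x) (hC' x) (norm_nonneg _) ((norm_nonneg _).trans (hC x)))⟩

lemma sum {ι : Type*} (s : Finset ι) {f : ι → ℝ → E} (hf : ∀ i ∈ s, BddCont (f i)) :
    BddCont (fun x => ∑ i ∈ s, f i x) := by
  classical
  induction s using Finset.induction_on with
  | empty => simpa using const (0 : E)
  | insert a s ha ih =>
    simp only [Finset.sum_insert ha]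
    exact (hf a (by simp)).add (ih fun i hi => hf i (by simp [hi]))

lemma pow {A : Type*} [NormedRing A] {f : ℝ → A} (hf : BddCont f) (n : ℕ) :
    BddCont (fun x => f x ^ n) := by
  induction n with
  | zero => simpa using const (1 : A)
  | succ n ih => simpa only [pow_succ] using ih.mul hf

lemma norm {f : ℝ → E} (hf : BddCont f) : BddCont (fun x => ‖f x‖) := by
  obtain ⟨hc, C, hC⟩ := hf
  exact ⟨hc.norm, C, fun x => by simpa using hC x⟩

lemma prod {ι : Type*} (s : Finset ι) {A : Type*} [NormedCommRing A] {f : ι → ℝ → A}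
    (hf : ∀ i ∈ s, BddCont (f i)) : BddCont (fun x => ∏ i ∈ s, f i x) := by
  classical
  induction s using Finset.induction_on with
  | empty => simpa using const (1 : A)
  | insert a s ha ih =>
    simp only [Finset.prod_insert ha]
    exact (hf a (by simp)).mul (ih fun i hi => hf i (by simp [hi]))

end BddCont

/-- The Gaussian probability measure at scale `X`. -/
noncomputable def gmean (X : ℝ) : Measure ℝ := gaussianReal 0 (X ^ 2 / 2).toNNReal

instance (X : ℝ) : IsProbabilityMeasure (gmean X) := by unfold gmean; infer_instance

/-- The oscillation `v ↦ e^{iωv}`. -/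
noncomputable def osc (ω v : ℝ) : ℂ := Complex.exp (ω * v * Complex.I)

lemma norm_osc (ω v : ℝ) : ‖osc ω v‖ = 1 := by
  rw [osc, ← Complex.ofReal_mul, Complex.norm_exp_ofReal_mul_I]

lemma osc_add (a b v : ℝ) : osc (a + b) v = osc a v * osc b v := by
  rw [osc, osc, osc, ← Complex.exp_add]; congr 1; push_cast; ring

lemma conj_osc (a v : ℝ) : (starRingEnd ℂ) (osc a v) = osc (-a) v := by
  rw [osc, osc, ← Complex.exp_conj]; congr 1; simp

lemma osc_sum {ι : Type*} (s : Finset ι) (a : ι → ℝ) (v : ℝ) :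
    osc (∑ i ∈ s, a i) v = ∏ i ∈ s, osc (a i) v := by
  simp only [osc]
  rw [← Complex.exp_sum]; congr 1; push_cast; rw [Finset.sum_mul, Finset.sum_mul]

lemma bddCont_osc (ω : ℝ) : BddCont (osc ω) :=
  ⟨by unfold osc; fun_prop, 1, fun x => (norm_osc ω x).le⟩

/-- The transform is positive and negligible for |ω| much larger than 1/X. Positivity allows
coefficients to be replaced by majorants and off-diagonal terms to be dropped; the decay restricts
attention to close frequencies. -/
lemma integral_osc (X ω : ℝ) :
    ∫ v, osc ω v ∂(gmean X) = (Real.exp (-(X * ω) ^ 2 / 4) : ℝ) := by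
  have h := charFun_gaussianReal (μ := 0) (v := (X ^ 2 / 2).toNNReal) ω
  rw [charFun_apply_real] at h
  unfold osc gmean
  rw [h, Real.coe_toNNReal _ (by positivity)]
  push_cast
  congr 1
  ring

/-- Finite exponential sums. -/
noncomputable def expSum {ι : Type*} (s : Finset ι) (c : ι → ℂ) (ω : ι → ℝ) (v : ℝ) : ℂ :=
  ∑ i ∈ s, c i * osc (ω i) v

lemma bddCont_expSum {ι : Type*} (s : Finset ι) (c : ι → ℂ) (ω : ι → ℝ) :
    BddCont (expSum s c ω) :=
  BddCont.sum s fun i _ => (BddCont.const (c i)).mul (bddCont_osc (ω i))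

lemma norm_expSum_le {ι : Type*} (s : Finset ι) (c : ι → ℂ) (ω : ι → ℝ) (v : ℝ)
    (hc : ∀ i ∈ s, ‖c i‖ ≤ 1) : ‖expSum s c ω v‖ ≤ s.card := by
  refine (norm_sum_le _ _).trans ?_
  calc ∑ i ∈ s, ‖c i * osc (ω i) v‖ ≤ ∑ i ∈ s, (1 : ℝ) := by
        gcongr with i hi; rw [norm_mul, norm_osc, mul_one]; exact hc i hi
    _ = s.card := by simp

lemma expSum_mul {ι κ : Type*} (s : Finset ι) (t : Finset κ) (c : ι → ℂ) (d : κ → ℂ)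
    (ω : ι → ℝ) (η : κ → ℝ) (v : ℝ) :
    expSum s c ω v * expSum t d η v =
      expSum (s ×ˢ t) (fun p => c p.1 * d p.2) (fun p => ω p.1 + η p.2) v := by
  unfold expSum
  rw [Finset.sum_mul_sum, Finset.sum_product]
  refine Finset.sum_congr rfl fun i _ => Finset.sum_congr rfl fun j _ => ?_
  rw [osc_add]; ring

lemma integral_normSq_expSum_le {ι : Type*} (s : Finset ι) (c : ι → ℂ) (ω : ι → ℝ)
    (hc : ∀ i ∈ s, ‖c i‖ ≤ 1) (X : ℝ) :
    ∫ v, ‖expSum s c ω v‖ ^ 2 ∂(gmean X) ≤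
      ∑ i ∈ s, ∑ j ∈ s, Real.exp (-(X * (ω i - ω j)) ^ 2 / 4) := by
  have h1 : ∀ v, ((‖expSum s c ω v‖ ^ 2 : ℝ) : ℂ) =
      ∑ i ∈ s, ∑ j ∈ s, c i * (starRingEnd ℂ) (c j) * osc (ω i - ω j) v := by
    intro v
    push_cast
    rw [← Complex.mul_conj', expSum, map_sum, Finset.sum_mul_sum]
    refine Finset.sum_congr rfl fun i _ => Finset.sum_congr rfl fun j _ => ?_
    rw [map_mul, conj_osc, sub_eq_add_neg, osc_add]; ring
  have h2 : ((∫ v, ‖expSum s c ω v‖ ^ 2 ∂(gmean X) : ℝ) : ℂ) =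
      ∑ i ∈ s, ∑ j ∈ s, c i * (starRingEnd ℂ) (c j) *
        (Real.exp (-(X * (ω i - ω j)) ^ 2 / 4) : ℝ) := by
    rw [← integral_complex_ofReal]
    have : ∀ i j, BddCont fun v => c i * (starRingEnd ℂ) (c j) * osc (ω i - ω j) v :=
      fun i j => (BddCont.const _).mul (bddCont_osc _)
    calc _ = ∫ v, ∑ i ∈ s, ∑ j ∈ s, c i * (starRingEnd ℂ) (c j) * osc (ω i - ω j) v
          ∂(gmean X) := integral_congr_ae (Filter.Eventually.of_forall h1)
      _ = _ := by
        rw [integral_finsetSum _ fun i _ => (BddCont.sum s fun j _ => this i j).integrable _]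
        refine Finset.sum_congr rfl fun i _ => ?_
        rw [integral_finsetSum _ fun j _ => (this i j).integrable _]
        refine Finset.sum_congr rfl fun j _ => ?_
        rw [integral_const_mul, integral_osc]
  have h3 : 0 ≤ ∫ v, ‖expSum s c ω v‖ ^ 2 ∂(gmean X) := integral_nonneg fun v => by positivity
  calc _ = ‖((∫ v, ‖expSum s c ω v‖ ^ 2 ∂(gmean X) : ℝ) : ℂ)‖ := by
        rw [Complex.norm_real, Real.norm_of_nonneg h3]
    _ ≤ _ := by
        rw [h2]
        refine (norm_sum_le _ _).trans (Finset.sum_le_sum fun i hi => ?_)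
        refine (norm_sum_le _ _).trans (Finset.sum_le_sum fun j hj => ?_)
        rw [norm_mul, norm_mul, RCLike.norm_conj, Complex.norm_real,
          Real.norm_of_nonneg (Real.exp_pos _).le]
        have := mul_le_one₀ (hc i hi) (norm_nonneg _) (hc j hj)
        exact mul_le_of_le_one_left (Real.exp_pos _).le this

open Classical in
/-- The mean square of an exponential sum is controlled by the number of close pairs of
frequencies. -/
lemma integral_normSq_expSum_le_card {ι : Type*} (s : Finset ι) (c : ι → ℂ) (ω : ι → ℝ)
    (hc : ∀ i ∈ s, ‖c i‖ ≤ 1) (X : ℝ) {δ : ℝ} (hδ : 0 ≤ δ) :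
    ∫ v, ‖expSum s c ω v‖ ^ 2 ∂(gmean X) ≤
      (((s ×ˢ s).filter fun p => |ω p.1 - ω p.2| ≤ δ).card : ℝ) +
        (s.card : ℝ) ^ 2 * Real.exp (-(X * δ) ^ 2 / 4) := by
  refine (integral_normSq_expSum_le s c ω hc X).trans ?_
  rw [← Finset.sum_product', ← Finset.sum_filter_add_sum_filter_not _
    (fun p : ι × ι => |ω p.1 - ω p.2| ≤ δ)]
  gcongr
  · rw [← nsmul_one, ← Finset.sum_const]
    refine Finset.sum_le_sum fun p _ => ?_
    rw [Real.exp_le_one_iff]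
    nlinarith [sq_nonneg (X * (ω p.1 - ω p.2))]
  · calc _ ≤ ∑ p ∈ (s ×ˢ s).filter (fun p : ι × ι => ¬ |ω p.1 - ω p.2| ≤ δ),
          Real.exp (-(X * δ) ^ 2 / 4) := by
          refine Finset.sum_le_sum fun p hp => ?_
          rw [Finset.mem_filter, not_le] at hp
          rw [Real.exp_le_exp]
          have : δ ^ 2 ≤ (ω p.1 - ω p.2) ^ 2 := by
            rw [← sq_abs (ω p.1 - ω p.2)]; gcongr; exact hp.2.le
          have := mul_le_mul_of_nonneg_left this (sq_nonneg X)
          rw [mul_pow, mul_pow]; linarith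
      _ ≤ _ := by
          rw [Finset.sum_const, nsmul_eq_mul]
          gcongr
          calc _ ≤ (((s ×ˢ s).card : ℕ) : ℝ) := by
                exact_mod_cast Finset.card_le_card (Finset.filter_subset _ _)
            _ = _ := by rw [Finset.card_product]; push_cast; ring

/-! ### Square roots modulo `q` of small residues -/

lemma card_le_of_modEq {A : Finset ℤ} {K m : ℕ} (hm : 0 < m)
    (hK : ∀ a ∈ A, |a| ≤ K) (hA : ∀ a ∈ A, ∀ b ∈ A, (m : ℤ) ∣ a - b) :
    (A.card : ℝ) ≤ 2 * K / m + 1 := by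
  rcases A.eq_empty_or_nonempty with rfl | hne
  · simp; positivity
  set a₀ := A.min' hne
  have h0 : a₀ ∈ A := A.min'_mem hne
  have hcard : A.card ≤ (Finset.range (2 * K / m + 1)).card := by
    refine Finset.card_le_card_of_injOn (fun a => ((a - a₀) / m).toNat) ?_ ?_
    · intro a ha
      have h1 : a₀ ≤ a := A.min'_le _ ha
      have h2 := abs_le.1 (hK a ha)
      have h3 := abs_le.1 (hK _ h0)
      have h4 : (a - a₀) / m ≤ (2 * K : ℤ) / m :=
        Int.ediv_le_ediv (by exact_mod_cast hm) (by linarith)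
      simp only [Finset.coe_range, Set.mem_Iio]
      have h5 : 0 ≤ (a - a₀) / m := Int.ediv_nonneg (by linarith) (by positivity)
      zify
      rw [Int.toNat_of_nonneg h5]
      linarith
    · intro a ha b hb hab
      have h1 : a₀ ≤ a := A.min'_le _ ha
      have h1' : a₀ ≤ b := A.min'_le _ hb
      have h5 : 0 ≤ (a - a₀) / m := Int.ediv_nonneg (by linarith) (by positivity)
      have h5' : 0 ≤ (b - a₀) / m := Int.ediv_nonneg (by linarith) (by positivity)
      simp only at hab
      have h6 : (a - a₀) / m = (b - a₀) / m := by
        rw [← Int.toNat_of_nonneg h5, ← Int.toNat_of_nonneg h5', hab]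
      have h7 := Int.ediv_mul_cancel (hA a ha _ h0)
      have h8 := Int.ediv_mul_cancel (hA b hb _ h0)
      rw [h6, h8] at h7
      linarith
  rw [Finset.card_range] at hcard
  have h9 : ((2 * K / m : ℕ) : ℝ) ≤ ((2 * K : ℕ) : ℝ) / m := Nat.cast_div_le
  calc (A.card : ℝ) ≤ ((2 * K / m + 1 : ℕ) : ℝ) := by exact_mod_cast hcard
    _ ≤ _ := by push_cast at h9 ⊢; linarith

/-- The integers `k` with `|k| ≤ K` and `q ∣ k ^ 2 + e`. -/
noncomputable def sqRoots (q K : ℕ) (e : ℤ) : Finset ℤ :=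
  (Finset.Icc (-(K : ℤ)) K).filter fun k => (q : ℤ) ∣ k ^ 2 + e

/-- Fix one root k₀. For any root k, q divides (k − k₀)(k + k₀), so some d ∣ q has d ∣ k − k₀ and
q/d ∣ k + k₀, which fixes k modulo lcm(d, q/d) = q/g with g = gcd(d, q/d). Since g ∣ 2k₀ and g² ∣ q,
also g² ∣ 4e; this restriction pays for the lost factor g after averaging over e. -/
lemma card_sqRoots_le {q : ℕ} (hq : 0 < q) (K : ℕ) (e : ℤ) :
    ((sqRoots q K e).card : ℝ) ≤
      ∑ d ∈ q.divisors.filter (fun d => ((Nat.gcd d (q / d) : ℤ) ^ 2 ∣ 4 * e)),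
        (2 * K * (Nat.gcd d (q / d) : ℝ) / q + 1) := by
  classical
  rcases (sqRoots q K e).eq_empty_or_nonempty with h | ⟨k₀, hk₀⟩
  · rw [h]; simp only [Finset.card_empty, Nat.cast_zero]
    exact Finset.sum_nonneg fun d _ => by positivity
  have hk₀' := (Finset.mem_filter.1 hk₀).2
  set B : ℕ → Finset ℤ := fun d => (Finset.Icc (-(K : ℤ)) K).filter
    fun k => (d : ℤ) ∣ k - k₀ ∧ ((q / d : ℕ) : ℤ) ∣ k + k₀
  have hsub : sqRoots q K e ⊆
      (q.divisors.filter (fun d => ((Nat.gcd d (q / d) : ℤ) ^ 2 ∣ 4 * e))).biUnion B := by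
    intro k hk
    obtain ⟨hkI, hk'⟩ := Finset.mem_filter.1 hk
    have hdiv : (q : ℤ) ∣ (k - k₀) * (k + k₀) := by
      exact (dvd_sub hk' hk₀').trans (dvd_of_eq (by ring))
    set d : ℕ := Nat.gcd q (k - k₀).natAbs with hd
    have hdq : d ∣ q := Nat.gcd_dvd_left _ _
    have hdpos : 0 < d := Nat.gcd_pos_of_pos_left _ hq
    have hd1 : (d : ℤ) ∣ k - k₀ := by
      rw [Int.natCast_dvd]; exact Nat.gcd_dvd_right _ _
    have hd2 : ((q / d : ℕ) : ℤ) ∣ k + k₀ := by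
      rw [Int.natCast_dvd]
      have h1 : q ∣ (k - k₀).natAbs * (k + k₀).natAbs := by
        rw [← Int.natAbs_mul, ← Int.natCast_dvd]; exact hdiv
      have h2 : q / d ∣ ((k - k₀).natAbs / d) * (k + k₀).natAbs := by
        obtain ⟨u, hu⟩ := h1
        refine ⟨u, ?_⟩
        have hd3 : d ∣ (k - k₀).natAbs := Nat.gcd_dvd_right _ _
        apply Nat.eq_of_mul_eq_mul_left hdpos
        rw [← mul_assoc, Nat.mul_div_cancel' hd3, hu, ← mul_assoc, Nat.mul_div_cancel' hdq]
      exact (Nat.coprime_div_gcd_div_gcd (hd ▸ hdpos)).dvd_of_dvd_mul_left h2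
    rw [Finset.mem_biUnion]
    refine ⟨d, ?_, Finset.mem_filter.2 ⟨hkI, hd1, hd2⟩⟩
    rw [Finset.mem_filter, Nat.mem_divisors]
    refine ⟨⟨hdq, hq.ne'⟩, ?_⟩
    set g := Nat.gcd d (q / d)
    have hg1 : (g : ℤ) ∣ d := by exact_mod_cast Nat.gcd_dvd_left _ _
    have hg2 : (g : ℤ) ∣ (q / d : ℕ) := by exact_mod_cast Nat.gcd_dvd_right _ _
    have hgq : (g : ℤ) ^ 2 ∣ q := by
      rw [sq]
      have : (q : ℤ) = d * (q / d : ℕ) := by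
        exact_mod_cast (Nat.mul_div_cancel' hdq).symm
      rw [this]
      exact mul_dvd_mul hg1 hg2
    have hg3 : (g : ℤ) ∣ 2 * k₀ := by
      exact (dvd_sub (hg2.trans hd2) (hg1.trans hd1)).trans (dvd_of_eq (by ring))
    have hg4 : (g : ℤ) ^ 2 ∣ 4 * k₀ ^ 2 := by
      exact (pow_dvd_pow_of_dvd hg3 2).trans (dvd_of_eq (by ring))
    exact (dvd_sub ((hgq.trans hk₀').mul_left 4) hg4).trans (dvd_of_eq (by ring))
  have hB : ∀ d ∈ q.divisors.filter (fun d => ((Nat.gcd d (q / d) : ℤ) ^ 2 ∣ 4 * e)),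
      ((B d).card : ℝ) ≤ 2 * K * (Nat.gcd d (q / d) : ℝ) / q + 1 := by
    intro d hd
    have hdq : d ∣ q := Nat.dvd_of_mem_divisors (Finset.mem_filter.1 hd).1
    have hdpos : 0 < d := Nat.pos_of_dvd_of_pos hdq hq
    set g := Nat.gcd d (q / d)
    set l := Nat.lcm d (q / d)
    have hgl : g * l = q := by
      rw [Nat.gcd_mul_lcm, Nat.mul_div_cancel' hdq]
    have hl : 0 < l := Nat.pos_of_ne_zero (by rintro h; rw [h] at hgl; omega)
    have hg : 0 < g := Nat.pos_of_ne_zero (by rintro h; rw [h] at hgl; omega)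
    have h1 := card_le_of_modEq (A := B d) (K := K) hl
      (fun a ha => abs_le.2 (by simpa using Finset.mem_Icc.1 (Finset.mem_filter.1 ha).1))
      (fun a ha b hb => by
        obtain ⟨-, ha1, ha2⟩ := Finset.mem_filter.1 ha
        obtain ⟨-, hb1, hb2⟩ := Finset.mem_filter.1 hb
        rw [Int.natCast_dvd]
        apply Nat.lcm_dvd
        · rw [← Int.natCast_dvd]
          exact (dvd_sub ha1 hb1).trans (dvd_of_eq (by ring))
        · rw [← Int.natCast_dvd]
          exact (dvd_sub ha2 hb2).trans (dvd_of_eq (by ring)))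
    refine h1.trans (le_of_eq ?_)
    have : (q : ℝ) = g * l := by exact_mod_cast hgl.symm
    rw [this]
    field_simp
  calc ((sqRoots q K e).card : ℝ) ≤ (∑ d ∈ q.divisors.filter
        (fun d => ((Nat.gcd d (q / d) : ℤ) ^ 2 ∣ 4 * e)), (B d).card : ℕ) := by
        exact_mod_cast (Finset.card_le_card hsub).trans Finset.card_biUnion_le
    _ ≤ _ := by push_cast; exact Finset.sum_le_sum hB

/-- The quotient 4e/g² is a nonzero integer of size at most 4E/g². Excluding e = 0 removes the
additive 1 that such a count would otherwise carry. -/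
lemma card_dvd_four_mul_le {g : ℕ} (hg : 0 < g) (E : ℕ) :
    ((((Finset.Icc (-(E : ℤ)) E).filter (fun e => e ≠ 0)).filter
      (fun e => (g : ℤ) ^ 2 ∣ 4 * e)).card : ℝ) ≤ 8 * E / (g : ℝ) ^ 2 := by
  set A := ((Finset.Icc (-(E : ℤ)) E).filter (fun e => e ≠ 0)).filter
      (fun e => (g : ℤ) ^ 2 ∣ 4 * e)
  set N : ℕ := 4 * E / g ^ 2
  have hg2 : (0 : ℤ) < (g : ℤ) ^ 2 := by positivity
  have hcard : A.card ≤ ((Finset.Icc (-(N : ℤ)) N).erase 0).card := by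
    refine Finset.card_le_card_of_injOn (fun e => 4 * e / (g : ℤ) ^ 2) ?_ ?_
    · intro e he
      simp only [A, Finset.coe_filter, Finset.mem_filter, Finset.mem_Icc, Set.mem_ofPred_eq] at he
      obtain ⟨⟨⟨h1, h2⟩, h3⟩, u, hu⟩ := he
      have hu' : 4 * e / (g : ℤ) ^ 2 = u := by rw [hu, Int.mul_ediv_cancel_left _ hg2.ne']
      simp only [Finset.coe_erase, Finset.coe_Icc, Set.mem_sdiff, Set.mem_Icc,
        Set.mem_singleton_iff, hu']
      refine ⟨?_, ?_⟩
      · have hN : (N : ℤ) = 4 * E / (g : ℤ) ^ 2 := by simp [N]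
        rw [hN]
        have : |u| ≤ 4 * E / (g : ℤ) ^ 2 := by
          rw [Int.le_ediv_iff_mul_le hg2]
          have : |u| * (g : ℤ) ^ 2 = |4 * e| := by
            rw [hu, abs_mul, abs_of_pos hg2]; ring
          rw [this, abs_mul]
          have := abs_le.2 ⟨h1, h2⟩
          norm_num; linarith
        exact abs_le.1 this
      · rintro rfl
        rw [mul_zero] at hu
        omega
    · intro e he f hf hef
      have h1 := (Finset.mem_filter.1 he).2
      have h2 := (Finset.mem_filter.1 hf).2
      have h3 := Int.ediv_mul_cancel h1
      have h4 := Int.ediv_mul_cancel h2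
      simp only at hef
      rw [hef, h4] at h3
      linarith
  have hcard2 : ((Finset.Icc (-(N : ℤ)) N).erase 0).card = 2 * N := by
    rw [Finset.card_erase_of_mem (by simp), Int.card_Icc]; omega
  rw [hcard2] at hcard
  have h9 : ((4 * E / g ^ 2 : ℕ) : ℝ) ≤ ((4 * E : ℕ) : ℝ) / (g ^ 2 : ℕ) := Nat.cast_div_le
  calc (A.card : ℝ) ≤ ((2 * N : ℕ) : ℝ) := by exact_mod_cast hcard
    _ ≤ _ := by
      push_cast at h9 ⊢
      have : 8 * (E : ℝ) / (g : ℝ) ^ 2 = 2 * (4 * E / (g : ℝ) ^ 2) := by ring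
      rw [this]
      gcongr

/-- On average over `0 < |e| ≤ E`, the congruence `k ^ 2 ≡ -e` modulo `q` has few solutions. -/
lemma sum_card_sqRoots_le {q : ℕ} (hq : 0 < q) (K E : ℕ) :
    ∑ e ∈ (Finset.Icc (-(E : ℤ)) E).filter (fun e => e ≠ 0), ((sqRoots q K e).card : ℝ) ≤
      q.divisors.card * (8 * E * (2 * K / q + 1)) := by
  calc _ ≤ ∑ e ∈ (Finset.Icc (-(E : ℤ)) E).filter (fun e => e ≠ 0),
        ∑ d ∈ q.divisors.filter (fun d => ((Nat.gcd d (q / d) : ℤ) ^ 2 ∣ 4 * e)),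
        (2 * K * (Nat.gcd d (q / d) : ℝ) / q + 1) :=
        Finset.sum_le_sum fun e _ => card_sqRoots_le hq K e
    _ = ∑ d ∈ q.divisors, ∑ e ∈ ((Finset.Icc (-(E : ℤ)) E).filter (fun e => e ≠ 0)).filter
          (fun e => (Nat.gcd d (q / d) : ℤ) ^ 2 ∣ 4 * e),
          (2 * K * (Nat.gcd d (q / d) : ℝ) / q + 1) := by
        refine Finset.sum_comm' fun e d => ?_
        simp only [Finset.mem_filter]
        tauto
    _ ≤ ∑ d ∈ q.divisors, (8 * E * (2 * K / q + 1) : ℝ) := by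
        refine Finset.sum_le_sum fun d hd => ?_
        have hdpos : 0 < d := Nat.pos_of_mem_divisors hd
        have hg : 0 < Nat.gcd d (q / d) := Nat.gcd_pos_of_pos_left _ hdpos
        set g := Nat.gcd d (q / d)
        rw [Finset.sum_const, nsmul_eq_mul]
        have hg1 : (1 : ℝ) ≤ g := by exact_mod_cast hg
        have hq0 : (0 : ℝ) < q := by exact_mod_cast hq
        -- The density 1/g² of admissible e more than compensates the factor g in the number of k.
        calc _ ≤ (8 * E / (g : ℝ) ^ 2) * (2 * K * (g : ℝ) / q + 1) := by
              gcongr; exact card_dvd_four_mul_le hg E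
          _ = 8 * E * (2 * K / q * (1 / g) + 1 / (g : ℝ) ^ 2) := by field_simp
          _ ≤ _ := by
              have h1 : 1 / (g : ℝ) ≤ 1 := by rw [div_le_one (by positivity)]; exact hg1
              have h2 : 1 / (g : ℝ) ^ 2 ≤ 1 := by
                rw [div_le_one (by positivity)]; exact one_le_pow₀ hg1
              have h3 : 2 * K / q * (1 / (g : ℝ)) ≤ 2 * K / q * 1 := by gcongr
              gcongr
              linarith
    _ = _ := by rw [Finset.sum_const, nsmul_eq_mul]

/-! ### Close pairs among sums of two square roots -/

/-- If `√a + √b` and `√c + √d` are close, then `4ab - 4cd - h ^ 2` is close to `4h√(cd)`, where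
`h = c + d - a - b`. -/
lemma quad_near {R δ : ℝ} {a b c d : ℝ} (ha : R ≤ a ∧ a ≤ 5 / 4 * R)
    (hb : R ≤ b ∧ b ≤ 5 / 4 * R) (hc : R ≤ c ∧ c ≤ 5 / 4 * R) (hd : R ≤ d ∧ d ≤ 5 / 4 * R)
    (hR : 1 ≤ R)
    (h : |√a + √b - (√c + √d)| ≤ δ) :
    |4 * a * b - 4 * c * d - (c + d - a - b) ^ 2 - 4 * (c + d - a - b) * √(c * d)| ≤
      28 * (δ * R * √R) := by
  have hr : 0 < √R := Real.sqrt_pos.2 (by linarith)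
  have hr2 : √R ^ 2 = R := Real.sq_sqrt (by linarith)
  have key : ∀ x, R ≤ x ∧ x ≤ 5 / 4 * R → 0 ≤ √x ∧ √x ≤ 9 / 8 * √R ∧ √x ^ 2 = x := by
    intro x hx
    refine ⟨Real.sqrt_nonneg _, ?_, Real.sq_sqrt (by linarith)⟩
    apply Real.sqrt_le_iff.2 ⟨by positivity, ?_⟩
    rw [mul_pow, hr2]; linarith
  obtain ⟨hA0, hA1, hA2⟩ := key a ha
  obtain ⟨hB0, hB1, hB2⟩ := key b hb
  obtain ⟨hC0, hC1, hC2⟩ := key c hc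
  obtain ⟨hD0, hD1, hD2⟩ := key d hd
  rw [Real.sqrt_mul (by linarith)]
  set A := √a
  set B := √b
  set C := √c
  set D := √d
  set r := √R
  -- A difference of squares (2AB)² − (2CD + h)², where h = c + d − a − b. The factor 2AB − 2CD − h
  -- equals (A+B)² − (C+D)², which contains the small quantity A + B − C − D.
  have e1 : 4 * a * b - 4 * c * d - (c + d - a - b) ^ 2 - 4 * (c + d - a - b) * (C * D) =
      ((A + B - (C + D)) * (A + B + C + D)) * (2 * A * B + 2 * C * D + (c + d - a - b)) := by
    rw [← hA2, ← hB2, ← hC2, ← hD2]; ring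
  have hδ : 0 ≤ δ := (abs_nonneg _).trans h
  have h1 : |A + B + C + D| ≤ 9 / 2 * r := by
    rw [abs_of_nonneg (by positivity)]; linarith
  have hAB : A * B ≤ 81 / 64 * R := by
    calc A * B ≤ (9 / 8 * r) * (9 / 8 * r) := by gcongr
      _ = 81 / 64 * r ^ 2 := by ring
      _ = _ := by rw [hr2]
  have hCD : C * D ≤ 81 / 64 * R := by
    calc C * D ≤ (9 / 8 * r) * (9 / 8 * r) := by gcongr
      _ = 81 / 64 * r ^ 2 := by ring
      _ = _ := by rw [hr2]
  have h2 : |2 * A * B + 2 * C * D + (c + d - a - b)| ≤ 56 / 10 * R := by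
    have : 0 ≤ A * B := by positivity
    have : 0 ≤ C * D := by positivity
    rw [abs_le]; constructor <;> linarith
  rw [e1, abs_mul, abs_mul]
  calc _ ≤ (δ * (9 / 2 * r)) * (56 / 10 * R) := by gcongr
    _ = 252 / 10 * (δ * R * r) := by ring
    _ ≤ _ := by
      have : 0 ≤ δ * R * r := by positivity
      linarith

/-- The invariant `(h, k, m)` of a quadruple `((a, b), (c, d))`. -/
def quadInv (x : (ℕ × ℕ) × ℕ × ℕ) : ℤ × ℤ × ℕ :=
  let h : ℤ := x.2.1 + x.2.2 - x.1.1 - x.1.2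
  (h, 4 * x.1.1 * x.1.2 - 4 * x.2.1 * x.2.2 - h ^ 2, x.2.1 * x.2.2)

lemma pair_eq_of_sum_prod {a b a' b' : ℤ} (h1 : a + b = a' + b') (h2 : a * b = a' * b') :
    (a = a' ∧ b = b') ∨ (a = b' ∧ b = a') := by
  have : (a - a') * (a - b') = 0 := by
    have : b = a' + b' - a := by linarith
    subst this; linear_combination -h2
  rcases mul_eq_zero.1 this with h | h
  · left; constructor <;> linarith
  · right; constructor <;> linarith

lemma pair_eq_of_sum_prod_nat {a b a' b' : ℕ} (h1 : (a : ℤ) + b = a' + b')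
    (h2 : (a : ℤ) * b = a' * b') : (a = a' ∧ b = b') ∨ (a = b' ∧ b = a') := by
  have := pair_eq_of_sum_prod h1 h2
  exact_mod_cast this

/-- The third invariant is cd, so c is one of its divisors and then d is determined. The first two
then give a + b and ab, hence {a, b} up to order. -/
lemma card_quad_fiber_le (Q : Finset ((ℕ × ℕ) × ℕ × ℕ)) {D : ℕ}
    (hD : ∀ x ∈ Q, (x.2.1 * x.2.2).divisors.card ≤ D) (hpos : ∀ x ∈ Q, x.2.1 * x.2.2 ≠ 0) :
    Q.card ≤ 2 * D * (Q.image quadInv).card := by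
  classical
  refine Finset.card_le_mul_card_image _ _ fun t ht => ?_
  obtain ⟨x₀, hx₀, rfl⟩ := Finset.mem_image.1 ht
  set F := Q.filter fun x => quadInv x = quadInv x₀
  have h2 : F.card ≤ 2 * (F.image Prod.snd).card := by
    refine Finset.card_le_mul_card_image _ _ fun p hp => ?_
    obtain ⟨y, hy, rfl⟩ := Finset.mem_image.1 hp
    have : F.filter (fun x => x.2 = y.2) ⊆ {y, ((y.1.2, y.1.1), y.2)} := by
      intro x hx
      obtain ⟨hxF, hx2⟩ := Finset.mem_filter.1 hx
      have h1 := (Finset.mem_filter.1 hxF).2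
      rw [← (Finset.mem_filter.1 hy).2] at h1
      obtain ⟨⟨a, b⟩, c, d⟩ := x
      obtain ⟨⟨a', b'⟩, c', d'⟩ := y
      simp only [quadInv, Prod.mk.injEq] at h1 hx2 ⊢
      obtain ⟨rfl, rfl⟩ := hx2
      obtain ⟨h3, h4, -⟩ := h1
      have h5 : (a : ℤ) + b = a' + b' := by linarith
      have h6 : (a : ℤ) * b = a' * b' := by
        have h7 : ((c : ℤ) + d - a - b) ^ 2 = (c + d - a' - b') ^ 2 := by rw [h3]
        linarith
      rcases pair_eq_of_sum_prod_nat h5 h6 with ⟨rfl, rfl⟩ | ⟨rfl, rfl⟩ <;> simp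
    exact (Finset.card_le_card this).trans (Finset.card_le_two)
  have h3 : (F.image Prod.snd).card ≤ D := by
    refine le_trans ?_ (hD x₀ hx₀)
    refine Finset.card_le_card_of_injOn Prod.fst ?_ ?_
    · intro p hp
      obtain ⟨y, hy, rfl⟩ := Finset.mem_image.1 (Finset.mem_coe.1 hp)
      have h1 := (Finset.mem_filter.1 hy).2
      simp only [quadInv, Prod.mk.injEq] at h1
      rw [Finset.mem_coe, Nat.mem_divisors]
      exact ⟨⟨y.2.2, h1.2.2.symm⟩, hpos _ hx₀⟩
    · intro p hp q hq hpq
      obtain ⟨y, hy, rfl⟩ := Finset.mem_image.1 (Finset.mem_coe.1 hp)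
      obtain ⟨z, hz, rfl⟩ := Finset.mem_image.1 (Finset.mem_coe.1 hq)
      have h1 := (Finset.mem_filter.1 hy).2
      have h2 := (Finset.mem_filter.1 hz).2
      have h4 := hpos _ (Finset.mem_filter.1 hy).1
      simp only [quadInv, Prod.mk.injEq] at h1 h2
      have h5 : y.2.1 * y.2.2 = z.2.1 * z.2.2 := h1.2.2.trans h2.2.2.symm
      have h6 : y.2.1 = z.2.1 := hpq
      rw [← h6] at h5
      have h7 : 0 < y.2.1 := Nat.pos_of_ne_zero (left_ne_zero_of_mul h4)
      exact Prod.ext h6 (Nat.eq_of_mul_eq_mul_left h7 h5)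
  calc F.card ≤ 2 * (F.image Prod.snd).card := h2
    _ ≤ 2 * D := by gcongr

lemma abs_le_floor {z : ℤ} {x : ℝ} (hz : |(z : ℝ)| ≤ x) : |z| ≤ (⌊x⌋₊ : ℤ) := by
  have : ((z.natAbs : ℕ) : ℝ) ≤ x := by rw [Nat.cast_natAbs]; exact_mod_cast hz
  have := Nat.le_floor this
  rw [Int.abs_eq_natAbs]; exact_mod_cast this

/-- Triples `(h, k, m)` with `16 h ^ 2 m = k ^ 2`. -/
lemma card_square_triples_le (T : Finset (ℤ × ℤ × ℕ)) {R : ℝ} (hR : 1 ≤ R)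
    (h0 : ∀ t ∈ T, t.1 ≠ 0) (h1 : ∀ t ∈ T, |(t.1 : ℝ)| ≤ R)
    (h2 : ∀ t ∈ T, (t.2.2 : ℝ) ≤ (5 / 4 * R) ^ 2)
    (h3 : ∀ t ∈ T, 16 * t.1 ^ 2 * (t.2.2 : ℤ) = t.2.1 ^ 2) :
    (T.card : ℝ) ≤ 11 * R ^ 2 := by
  classical
  set A : ℕ := ⌊R⌋₊
  set B : ℕ := ⌊5 / 4 * R⌋₊
  have hsub : T ⊆ (Finset.Icc (-(A : ℤ)) A ×ˢ Finset.Icc (-(B : ℤ)) B).image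
      fun p => (p.1, 4 * p.1 * p.2, (p.2 ^ 2).toNat) := by
    rintro ⟨h, k, m⟩ ht
    have h0' : h ≠ 0 := h0 _ ht
    have h1' : |(h : ℝ)| ≤ R := h1 _ ht
    have h2' : (m : ℝ) ≤ (5 / 4 * R) ^ 2 := h2 _ ht
    have h3' : 16 * h ^ 2 * (m : ℤ) = k ^ 2 := h3 _ ht
    -- Hence k = 4hw and m = w²: these triples are parametrised by the pair (h, w), with O(R²)
    -- choices.
    have hdvd : (4 * h) ^ 2 ∣ k ^ 2 := ⟨m, by rw [← h3']; ring⟩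
    obtain ⟨w, hw⟩ := (Int.pow_dvd_pow_iff two_ne_zero).1 hdvd
    subst hw
    have hm : (m : ℤ) = w ^ 2 := by
      have : (16 * h ^ 2) * (m : ℤ) = (16 * h ^ 2) * w ^ 2 := by rw [h3']; ring
      exact mul_left_cancel₀ (by positivity) this
    have hw' : |(w : ℝ)| ≤ 5 / 4 * R := by
      apply abs_le_of_sq_le_sq _ (by positivity)
      calc (w : ℝ) ^ 2 = m := by exact_mod_cast hm.symm
        _ ≤ _ := h2'
    rw [Finset.mem_image]
    refine ⟨(h, w), ?_, ?_⟩
    · rw [Finset.mem_product, Finset.mem_Icc, Finset.mem_Icc]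
      exact ⟨abs_le.1 (abs_le_floor h1'), abs_le.1 (abs_le_floor hw')⟩
    · simp only [Prod.mk.injEq, true_and]
      rw [← hm]; simp
  have hA : (A : ℝ) ≤ R := Nat.floor_le (by linarith)
  have hB : (B : ℝ) ≤ 5 / 4 * R := Nat.floor_le (by linarith)
  have hcard : T.card ≤ (2 * A + 1) * (2 * B + 1) := by
    refine (Finset.card_le_card hsub).trans (Finset.card_image_le.trans (le_of_eq ?_))
    rw [Finset.card_product, Int.card_Icc, Int.card_Icc]
    congr 1 <;> omega
  calc (T.card : ℝ) ≤ (2 * A + 1) * (2 * B + 1) := by exact_mod_cast hcard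
    _ ≤ (2 * R + 1 * R) * (2 * (5 / 4 * R) + 1 * R) := by gcongr <;> linarith
    _ ≤ _ := by nlinarith

/-- Triples `(h, k, m)` with `16 h ^ 2 m - k ^ 2` small and nonzero. -/
lemma card_nonsquare_triples_le (T : Finset (ℤ × ℤ × ℕ)) {R L D : ℝ} (hR : 1 ≤ R) (hL : 0 ≤ L)
    (hD : 0 ≤ D)
    (h0 : ∀ t ∈ T, t.1 ≠ 0) (h1 : ∀ t ∈ T, |(t.1 : ℝ)| ≤ R)
    (h2 : ∀ t ∈ T, |(t.2.1 : ℝ)| ≤ 6 * R * |(t.1 : ℝ)|)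
    (h3 : ∀ t ∈ T, 16 * t.1 ^ 2 * (t.2.2 : ℤ) - t.2.1 ^ 2 ≠ 0)
    (h4 : ∀ t ∈ T, |((16 * t.1 ^ 2 * (t.2.2 : ℤ) - t.2.1 ^ 2 : ℤ) : ℝ)| ≤ L * |(t.1 : ℝ)|)
    (hdiv : ∀ h : ℤ, h ≠ 0 → |(h : ℝ)| ≤ R → ((16 * h.natAbs ^ 2).divisors.card : ℝ) ≤ D) :
    (T.card : ℝ) ≤ 42 * (D * L * R ^ 2) := by
  classical
  set A : ℕ := ⌊R⌋₊
  have hA : (A : ℝ) ≤ R := Nat.floor_le (by linarith)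
  -- Trade m for e = 16h²m − k². The triple is recovered from (h, e, k), and e imposes the
  -- congruence k² ≡ −e mod 16h². For fixed h the ranges are |e| ≤ L|h| and |k| ≤ 6R|h|, so
  -- averaging over e leaves O(DLR) triples.
  set S : Finset (Σ _ : ℤ, Σ _ : ℤ, ℤ) := ((Finset.Icc (-(A : ℤ)) A).filter (fun h => h ≠ 0)).sigma
    fun h => ((Finset.Icc (-(⌊L * |(h : ℝ)|⌋₊ : ℤ)) ⌊L * |(h : ℝ)|⌋₊).filter (fun e => e ≠ 0)).sigma
      fun e => sqRoots (16 * h.natAbs ^ 2) ⌊6 * R * |(h : ℝ)|⌋₊ e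
  have hinj : T.card ≤ S.card := by
    refine Finset.card_le_card_of_injOn
      (fun t => ⟨t.1, 16 * t.1 ^ 2 * (t.2.2 : ℤ) - t.2.1 ^ 2, t.2.1⟩) ?_ ?_
    · intro t ht
      have ht := Finset.mem_coe.1 ht
      simp only [S, Finset.mem_coe, Finset.mem_sigma, Finset.mem_filter, Finset.mem_Icc]
      refine ⟨⟨abs_le.1 (abs_le_floor (h1 t ht)), h0 t ht⟩,
        ⟨abs_le.1 (abs_le_floor (h4 t ht)), h3 t ht⟩, ?_⟩
      simp only [sqRoots, Finset.mem_filter, Finset.mem_Icc]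
      refine ⟨abs_le.1 (abs_le_floor (h2 t ht)), ?_⟩
      have : ((16 * t.1.natAbs ^ 2 : ℕ) : ℤ) = 16 * t.1 ^ 2 := by push_cast; rw [sq_abs]
      rw [this]
      exact ⟨t.2.2, by ring⟩
    · rintro ⟨h, k, m⟩ ht ⟨h', k', m'⟩ ht' heq
      simp only [Sigma.mk.injEq, heq_eq_eq] at heq
      obtain ⟨rfl, he, rfl⟩ := heq
      have h0' : h ≠ 0 := h0 _ (Finset.mem_coe.1 ht)
      have : (16 * h ^ 2) * (m : ℤ) = (16 * h ^ 2) * m' := by linarith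
      have := mul_left_cancel₀ (by positivity) this
      simpa using this
  have hS : (S.card : ℝ) = ∑ h ∈ (Finset.Icc (-(A : ℤ)) A).filter (fun h => h ≠ 0),
      ∑ e ∈ (Finset.Icc (-(⌊L * |(h : ℝ)|⌋₊ : ℤ)) ⌊L * |(h : ℝ)|⌋₊).filter (fun e => e ≠ 0),
        ((sqRoots (16 * h.natAbs ^ 2) ⌊6 * R * |(h : ℝ)|⌋₊ e).card : ℝ) := by
    simp only [S, Finset.card_sigma]
    push_cast; rfl
  calc (T.card : ℝ) ≤ S.card := by exact_mod_cast hinj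
    _ ≤ ∑ h ∈ (Finset.Icc (-(A : ℤ)) A).filter (fun h => h ≠ 0), (14 * (D * L * R) : ℝ) := by
        rw [hS]
        refine Finset.sum_le_sum fun h hh => ?_
        obtain ⟨hhI, hne⟩ := Finset.mem_filter.1 hh
        have hhA : |(h : ℝ)| ≤ A := by
          have := abs_le.2 (Finset.mem_Icc.1 hhI)
          exact_mod_cast this
        have hhR : |(h : ℝ)| ≤ R := hhA.trans hA
        have habs : (1 : ℝ) ≤ |(h : ℝ)| := by
          exact_mod_cast Int.one_le_abs hne
        have hq : 0 < 16 * h.natAbs ^ 2 := by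
          have := Int.natAbs_pos.2 hne
          positivity
        refine (sum_card_sqRoots_le hq _ _).trans ?_
        have hE : (⌊L * |(h : ℝ)|⌋₊ : ℝ) ≤ L * |(h : ℝ)| := Nat.floor_le (by positivity)
        have hK : (⌊6 * R * |(h : ℝ)|⌋₊ : ℝ) ≤ 6 * R * |(h : ℝ)| := Nat.floor_le (by positivity)
        have hqr : ((16 * h.natAbs ^ 2 : ℕ) : ℝ) = 16 * |(h : ℝ)| ^ 2 := by
          push_cast [Nat.cast_natAbs]; ring
        rw [hqr]
        calc _ ≤ D * (8 * (L * |(h : ℝ)|) * (2 * (6 * R * |(h : ℝ)|) / (16 * |(h : ℝ)| ^ 2) + 1)) := by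
              gcongr
              exact hdiv h hne hhR
          _ = D * L * (6 * R + 8 * |(h : ℝ)|) := by field_simp; ring
          _ ≤ D * L * (6 * R + 8 * R) := by gcongr
          _ = _ := by ring
    _ ≤ _ := by
        rw [Finset.sum_const, nsmul_eq_mul]
        have : ((((Finset.Icc (-(A : ℤ)) A).filter (fun h => h ≠ 0)).card : ℕ) : ℝ) ≤ 3 * R := by
          calc _ ≤ (((Finset.Icc (-(A : ℤ)) A).card : ℕ) : ℝ) := by
                exact_mod_cast Finset.card_le_card (Finset.filter_subset _ _)
            _ = 2 * A + 1 := by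
                rw [Int.card_Icc]
                have : ((A : ℤ) + 1 - -(A : ℤ)).toNat = 2 * A + 1 := by omega
                rw [this]; push_cast; ring
            _ ≤ _ := by linarith
        calc _ ≤ 3 * R * (14 * (D * L * R)) := by gcongr
          _ = _ := by ring

lemma card_le_two_mul {R : ℝ} (hR : 1 ≤ R) {s : Finset ℕ}
    (hs : ∀ n ∈ s, R ≤ n ∧ (n : ℝ) ≤ 5 / 4 * R) : (s.card : ℝ) ≤ 2 * R := by
  have : s ⊆ Finset.Icc ⌈R⌉₊ ⌊5 / 4 * R⌋₊ := fun n hn => by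
    rw [Finset.mem_Icc]
    exact ⟨Nat.ceil_le.2 (hs n hn).1, Nat.le_floor (hs n hn).2⟩
  have h1 := Finset.card_le_card this
  rw [Nat.card_Icc] at h1
  have h2 : (⌊5 / 4 * R⌋₊ : ℝ) ≤ 5 / 4 * R := Nat.floor_le (by linarith)
  have h3 : 1 ≤ ⌈R⌉₊ := Nat.one_le_ceil_iff.2 (by linarith)
  have h4 : s.card ≤ ⌊5 / 4 * R⌋₊ := by omega
  calc (s.card : ℝ) ≤ ⌊5 / 4 * R⌋₊ := by exact_mod_cast h4
    _ ≤ _ := by linarith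

open Classical in
/-- The number of quadruples with `|√a + √b - √c - √d| ≤ δ`. -/
theorem exists_card_close_quad_le {ε : ℝ} (hε : 0 < ε) : ∃ C : ℝ, 0 < C ∧
    ∀ R : ℝ, 1 ≤ R → ∀ s : Finset ℕ, (∀ n ∈ s, R ≤ n ∧ (n : ℝ) ≤ 5 / 4 * R) →
    ∀ δ : ℝ, 0 ≤ δ → 56 * (δ * R * √R) ≤ 1 →
    ((((s ×ˢ s) ×ˢ (s ×ˢ s)).filter fun p =>
      |√(p.1.1 : ℝ) + √(p.1.2 : ℝ) - (√(p.2.1 : ℝ) + √(p.2.2 : ℝ))| ≤ δ).card : ℝ) ≤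
      C * R ^ ε * (R ^ 2 + δ * R ^ 4 * √R) := by
  obtain ⟨C₀, hC₀, hdiv⟩ := exists_card_divisors_le (ε := ε / 4) (by positivity)
  -- At the end 26000 absorbs 25872 = 2·42·308 from the triples with e ≠ 0, and 8 + 22 from the
  -- quadruples with h = 0 and the triples with e = 0.
  refine ⟨26000 * (C₀ * 16 ^ (ε / 4)) ^ 2, by positivity, fun R hR s hs δ hδ0 hδ => ?_⟩
  have hR0 : 0 < R := by linarith
  set Q := ((s ×ˢ s) ×ˢ (s ×ˢ s)).filter fun p =>
      |√(p.1.1 : ℝ) + √(p.1.2 : ℝ) - (√(p.2.1 : ℝ) + √(p.2.2 : ℝ))| ≤ δ with hQ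
  set D : ℝ := C₀ * 16 ^ (ε / 4) * R ^ (ε / 2) with hDdef
  have hD1 : 1 ≤ D := by
    rw [hDdef]
    have h1 : (1 : ℝ) ≤ 16 ^ (ε / 4) := Real.one_le_rpow (by norm_num) (by positivity)
    have h2 : (1 : ℝ) ≤ R ^ (ε / 2) := Real.one_le_rpow hR (by positivity)
    exact one_le_mul_of_one_le_of_one_le (one_le_mul_of_one_le_of_one_le hC₀ h1) h2
  have hDn : ∀ n : ℕ, n ≠ 0 → (n : ℝ) ≤ 16 * R ^ 2 → (n.divisors.card : ℝ) ≤ D := by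
    intro n hn hnR
    refine (hdiv n hn).trans ?_
    have : D = C₀ * (16 * R ^ 2) ^ (ε / 4) := by
      rw [hDdef, Real.mul_rpow (by norm_num) (by positivity), ← Real.rpow_natCast,
        ← Real.rpow_mul hR0.le]
      push_cast
      ring_nf
    rw [this]
    gcongr
  have hmem : ∀ x ∈ Q, (R ≤ x.1.1 ∧ (x.1.1 : ℝ) ≤ 5 / 4 * R) ∧
      (R ≤ x.1.2 ∧ (x.1.2 : ℝ) ≤ 5 / 4 * R) ∧ (R ≤ x.2.1 ∧ (x.2.1 : ℝ) ≤ 5 / 4 * R) ∧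
      (R ≤ x.2.2 ∧ (x.2.2 : ℝ) ≤ 5 / 4 * R) := by
    intro x hx
    simp only [hQ, Finset.mem_filter, Finset.mem_product] at hx
    exact ⟨hs _ hx.1.1.1, hs _ hx.1.1.2, hs _ hx.1.2.1, hs _ hx.1.2.2⟩
  have hnear : ∀ x ∈ Q, |((quadInv x).2.1 : ℝ) - 4 * ((quadInv x).1 : ℝ) *
      √((quadInv x).2.2 : ℝ)| ≤ 28 * (δ * R * √R) := by
    intro x hx
    obtain ⟨h1, h2, h3, h4⟩ := hmem x hx
    have := quad_near h1 h2 h3 h4 hR (Finset.mem_filter.1 hx).2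
    simp only [quadInv]
    push_cast
    exact this
  -- With deviation below 1, h = 0 forces the integer k to vanish. Then a + b = c + d and ab = cd,
  -- so only trivial quadruples occur.
  have hη : 28 * (δ * R * √R) ≤ 1 / 2 := by linarith
  -- quadruples with vanishing first invariant
  have hc0 : ((Q.filter fun x => (quadInv x).1 = 0).card : ℝ) ≤ 8 * R ^ 2 := by
    have h1 : (Q.filter fun x => (quadInv x).1 = 0).card ≤
        2 * ((Q.filter fun x => (quadInv x).1 = 0).image Prod.snd).card := by
      refine Finset.card_le_mul_card_image _ _ fun p hp => ?_
      have : ((Q.filter fun x => (quadInv x).1 = 0).filter fun x => x.2 = p) ⊆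
          {(p, p), ((p.2, p.1), p)} := by
        intro x hx
        obtain ⟨hx1, rfl⟩ := Finset.mem_filter.1 hx
        obtain ⟨hxQ, hx0⟩ := Finset.mem_filter.1 hx1
        have h1 := hnear x hxQ
        rw [hx0] at h1
        simp only [Int.cast_zero, mul_zero, zero_mul, sub_zero] at h1
        have h2 : |(((quadInv x).2.1 : ℤ) : ℝ)| < 1 := by linarith
        have h3 : (quadInv x).2.1 = 0 := by
          rw [← Int.abs_lt_one_iff]; exact_mod_cast h2
        obtain ⟨⟨a, b⟩, c, d⟩ := x
        simp only [quadInv] at hx0 h3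
        rw [hx0] at h3
        have h5 : (a : ℤ) + b = c + d := by linarith
        have h6 : (a : ℤ) * b = c * d := by linarith
        rcases pair_eq_of_sum_prod_nat h5 h6 with ⟨rfl, rfl⟩ | ⟨rfl, rfl⟩ <;> simp
      exact (Finset.card_le_card this).trans Finset.card_le_two
    have h2 : ((Q.filter fun x => (quadInv x).1 = 0).image Prod.snd).card ≤ (s ×ˢ s).card := by
      refine Finset.card_le_card fun p hp => ?_
      obtain ⟨x, hx, rfl⟩ := Finset.mem_image.1 hp
      have := (Finset.mem_filter.1 (Finset.mem_filter.1 hx).1).1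
      exact (Finset.mem_product.1 this).2
    rw [Finset.card_product] at h2
    have h3 := card_le_two_mul hR hs
    have h4 : ((Q.filter fun x => (quadInv x).1 = 0).card : ℝ) ≤ 2 * (s.card * s.card) := by
      exact_mod_cast h1.trans (Nat.mul_le_mul_left 2 h2)
    calc _ ≤ 2 * ((s.card : ℝ) * s.card) := h4
      _ ≤ 2 * ((2 * R) * (2 * R)) := by gcongr
      _ = _ := by ring
  -- the other quadruples
  set Q₁ := Q.filter fun x => ¬ (quadInv x).1 = 0 with hQ₁
  have hm : ∀ x ∈ Q, ((x.2.1 * x.2.2 : ℕ) : ℝ) ≤ (5 / 4 * R) ^ 2 := by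
    intro x hx
    obtain ⟨-, -, h3, h4⟩ := hmem x hx
    push_cast
    rw [sq]
    gcongr
    · exact h3.2
    · exact h4.2
  have hm0 : ∀ x ∈ Q, x.2.1 * x.2.2 ≠ 0 := by
    intro x hx
    obtain ⟨-, -, h3, h4⟩ := hmem x hx
    have h5 : (0 : ℝ) < x.2.1 := by linarith
    have h6 : (0 : ℝ) < x.2.2 := by linarith
    have h5' : 0 < x.2.1 := by exact_mod_cast h5
    have h6' : 0 < x.2.2 := by exact_mod_cast h6
    positivity
  set T := Q₁.image quadInv with hT
  have hTQ : ∀ t ∈ T, ∃ x ∈ Q, (quadInv x).1 ≠ 0 ∧ quadInv x = t := by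
    intro t ht
    obtain ⟨x, hx, rfl⟩ := Finset.mem_image.1 ht
    exact ⟨x, (Finset.mem_filter.1 hx).1, (Finset.mem_filter.1 hx).2, rfl⟩
  have hT0 : ∀ t ∈ T, t.1 ≠ 0 := by
    intro t ht; obtain ⟨x, _, h, rfl⟩ := hTQ t ht; exact h
  have hT1 : ∀ t ∈ T, |(t.1 : ℝ)| ≤ R := by
    intro t ht
    obtain ⟨x, hx, h, rfl⟩ := hTQ t ht
    obtain ⟨h1, h2, h3, h4⟩ := hmem x hx
    simp only [quadInv]
    push_cast
    rw [abs_le]; constructor <;> linarith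
  have hTm : ∀ t ∈ T, (t.2.2 : ℝ) ≤ (5 / 4 * R) ^ 2 := by
    intro t ht; obtain ⟨x, hx, h, rfl⟩ := hTQ t ht; exact hm x hx
  have hTnear : ∀ t ∈ T, |(t.2.1 : ℝ) - 4 * (t.1 : ℝ) * √(t.2.2 : ℝ)| ≤ 28 * (δ * R * √R) := by
    intro t ht; obtain ⟨x, hx, h, rfl⟩ := hTQ t ht; exact hnear x hx
  have hTabs : ∀ t ∈ T, (1 : ℝ) ≤ |(t.1 : ℝ)| := fun t ht => by
    exact_mod_cast Int.one_le_abs (hT0 t ht)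
  have hTw : ∀ t ∈ T, |4 * (t.1 : ℝ) * √(t.2.2 : ℝ)| ≤ 5 * R * |(t.1 : ℝ)| := by
    intro t ht
    have : √(t.2.2 : ℝ) ≤ 5 / 4 * R := by
      rw [Real.sqrt_le_iff]; exact ⟨by positivity, hTm t ht⟩
    rw [abs_mul, abs_mul, abs_of_nonneg (Real.sqrt_nonneg _), abs_of_pos (by norm_num : (0:ℝ) < 4)]
    calc _ ≤ 4 * |(t.1 : ℝ)| * (5 / 4 * R) := by gcongr
      _ = _ := by ring
  have hT2 : ∀ t ∈ T, |(t.2.1 : ℝ)| ≤ 6 * R * |(t.1 : ℝ)| := by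
    intro t ht
    have h1 := hTnear t ht
    have h2 := hTw t ht
    have h3 := hTabs t ht
    have h4 := abs_sub_abs_le_abs_sub (t.2.1 : ℝ) (4 * (t.1 : ℝ) * √(t.2.2 : ℝ))
    nlinarith
  have hT4 : ∀ t ∈ T, |((16 * t.1 ^ 2 * (t.2.2 : ℤ) - t.2.1 ^ 2 : ℤ) : ℝ)| ≤
      308 * (δ * R ^ 2 * √R) * |(t.1 : ℝ)| := by
    intro t ht
    have h1 := hTnear t ht
    have h2 := hTw t ht
    have h3 := hT2 t ht
    have hs : √(t.2.2 : ℝ) ^ 2 = t.2.2 := Real.sq_sqrt (by positivity)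
    have e1 : ((16 * t.1 ^ 2 * (t.2.2 : ℤ) - t.2.1 ^ 2 : ℤ) : ℝ) =
        -(((t.2.1 : ℝ) - 4 * (t.1 : ℝ) * √(t.2.2 : ℝ)) *
          (t.2.1 + 4 * (t.1 : ℝ) * √(t.2.2 : ℝ))) := by
      push_cast
      linear_combination (-16 * (t.1 : ℝ) ^ 2) * hs
    rw [e1, abs_neg, abs_mul]
    have h5 : |(t.2.1 : ℝ) + 4 * (t.1 : ℝ) * √(t.2.2 : ℝ)| ≤ 11 * R * |(t.1 : ℝ)| :=
      (abs_add_le _ _).trans (by linarith)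
    calc _ ≤ (28 * (δ * R * √R)) * (11 * R * |(t.1 : ℝ)|) := by gcongr
      _ = _ := by ring
  have hcT0 := card_square_triples_le
    (T.filter fun t => 16 * t.1 ^ 2 * (t.2.2 : ℤ) - t.2.1 ^ 2 = 0) hR
    (fun t ht => hT0 t (Finset.mem_filter.1 ht).1) (fun t ht => hT1 t (Finset.mem_filter.1 ht).1)
    (fun t ht => hTm t (Finset.mem_filter.1 ht).1)
    (fun t ht => by have := (Finset.mem_filter.1 ht).2; linarith)
  have hcT1 := card_nonsquare_triples_le
    (T.filter fun t => ¬ 16 * t.1 ^ 2 * (t.2.2 : ℤ) - t.2.1 ^ 2 = 0) (D := D)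
    (L := 308 * (δ * R ^ 2 * √R)) hR
    (by positivity) (by positivity) (fun t ht => hT0 t (Finset.mem_filter.1 ht).1)
    (fun t ht => hT1 t (Finset.mem_filter.1 ht).1)
    (fun t ht => hT2 t (Finset.mem_filter.1 ht).1)
    (fun t ht => (Finset.mem_filter.1 ht).2)
    (fun t ht => hT4 t (Finset.mem_filter.1 ht).1)
    (fun h hh hhR => hDn _ (by have := Int.natAbs_pos.2 hh; positivity) (by
      push_cast [Nat.cast_natAbs]
      gcongr))
  have hT' : (T.card : ℝ) ≤ 11 * R ^ 2 + 42 * (D * (308 * (δ * R ^ 2 * √R)) * R ^ 2) := by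
    rw [← Finset.card_filter_add_card_filter_not
      (fun t : ℤ × ℤ × ℕ => 16 * t.1 ^ 2 * (t.2.2 : ℤ) - t.2.1 ^ 2 = 0)]
    push_cast
    exact add_le_add hcT0 hcT1
  have hc1 : (Q₁.card : ℝ) ≤ 2 * D * T.card := by
    have h1 := card_quad_fiber_le Q₁ (D := ⌊D⌋₊)
      (fun x hx => Nat.le_floor (hDn _ (hm0 x (Finset.mem_filter.1 hx).1)
        ((hm x (Finset.mem_filter.1 hx).1).trans (by nlinarith))))
      (fun x hx => hm0 x (Finset.mem_filter.1 hx).1)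
    have h2 : (⌊D⌋₊ : ℝ) ≤ D := Nat.floor_le (by linarith)
    calc (Q₁.card : ℝ) ≤ 2 * ⌊D⌋₊ * T.card := by exact_mod_cast h1
      _ ≤ _ := by gcongr
  have hD2 : (C₀ * 16 ^ (ε / 4)) ^ 2 * R ^ ε = D ^ 2 := by
    rw [hDdef, mul_pow (_ * _) (R ^ (ε / 2)) 2, ← Real.rpow_natCast (R ^ (ε / 2)),
      ← Real.rpow_mul hR0.le]
    push_cast
    ring_nf
  have hgoal : 26000 * (C₀ * 16 ^ (ε / 4)) ^ 2 * R ^ ε * (R ^ 2 + δ * R ^ 4 * √R) =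
      26000 * (D ^ 2 * (R ^ 2 + δ * R ^ 4 * √R)) := by rw [← hD2]; ring
  rw [hgoal, ← Finset.card_filter_add_card_filter_not (s := Q) (fun x => (quadInv x).1 = 0)]
  push_cast
  set W := δ * R ^ 4 * √R with hW
  have hW0 : 0 ≤ W := by positivity
  have hDD : D ≤ D ^ 2 := by nlinarith
  have hDD1 : 1 ≤ D ^ 2 := by nlinarith
  calc _ ≤ 8 * R ^ 2 + 2 * D * (11 * R ^ 2 + 42 * (D * (308 * (δ * R ^ 2 * √R)) * R ^ 2)) := by
        refine add_le_add hc0 (hc1.trans ?_)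
        gcongr
    _ = 8 * (1 * R ^ 2) + 22 * (D * R ^ 2) + 25872 * (D ^ 2 * W) := by rw [hW]; ring
    _ ≤ 8 * (D ^ 2 * R ^ 2) + 22 * (D ^ 2 * R ^ 2) + 25872 * (D ^ 2 * W) := by gcongr
    _ ≤ _ := by nlinarith [mul_nonneg (sq_nonneg D) (sq_nonneg R), mul_nonneg (sq_nonneg D) hW0]

/-! ### The fourth moment -/

lemma exists_rpow_mul_exp_neg_le (a : ℝ) {κ : ℝ} (hκ : 0 < κ) :
    ∃ C : ℝ, 0 < C ∧ ∀ X : ℝ, 1 ≤ X → X ^ a * Real.exp (-(X ^ κ) / 4) ≤ C := by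
  obtain ⟨n, hn⟩ := exists_nat_ge (a / κ)
  refine ⟨n.factorial * 4 ^ n, by positivity, fun X hX => ?_⟩
  have hX0 : 0 < X := by linarith
  have h1 := Real.pow_div_factorial_le_exp (X ^ κ / 4) (by positivity) n
  have h2 : X ^ a ≤ (X ^ κ) ^ n := by
    rw [← Real.rpow_natCast, ← Real.rpow_mul hX0.le]
    apply Real.rpow_le_rpow_of_exponent_le hX
    rw [div_le_iff₀ hκ] at hn; linarith
  rw [neg_div, Real.exp_neg, ← div_eq_mul_inv, div_le_iff₀ (Real.exp_pos _)]
  rw [div_pow, div_div, div_le_iff₀ (by positivity)] at h1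
  calc X ^ a ≤ (X ^ κ) ^ n := h2
    _ ≤ _ := h1
    _ = _ := by ring

/-- Exponential sums with square root frequencies. -/
noncomputable def sqrtSum (s : Finset ℕ) (c : ℕ → ℂ) (v : ℝ) : ℂ :=
  expSum s c (fun n => √(n : ℝ)) v

lemma bddCont_sqrtSum (s : Finset ℕ) (c : ℕ → ℂ) : BddCont (sqrtSum s c) :=
  bddCont_expSum _ _ _

/-- The fourth moment of an exponential sum with square root frequencies. -/
theorem exists_fourth_moment_le {ε : ℝ} (hε : 0 < ε) : ∃ C : ℝ, 0 < C ∧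
    ∀ R : ℝ, 1 ≤ R → ∀ s : Finset ℕ, (∀ n ∈ s, R ≤ n ∧ (n : ℝ) ≤ 5 / 4 * R) →
    ∀ c : ℕ → ℂ, (∀ n ∈ s, ‖c n‖ ≤ 1) → ∀ X : ℝ, R ^ 2 ≤ X →
    ∫ v, ‖sqrtSum s c v‖ ^ 4 ∂(gmean X) ≤ C * X ^ ε * (R ^ 2 + R ^ 4 * √R / X) := by
  classical
  set η := min (ε / 2) (1 / 8) with hη
  have hη0 : 0 < η := lt_min (by positivity) (by norm_num)
  have hη1 : η ≤ 1 / 8 := min_le_right _ _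
  have hη2 : 2 * η ≤ ε := by have := min_le_left (ε / 2) (1 / 8); linarith
  obtain ⟨C₁, hC₁, hcount⟩ := exists_card_close_quad_le hη0
  obtain ⟨C₂, hC₂, htail⟩ := exists_rpow_mul_exp_neg_le 1 (κ := 2 * η) (by positivity)
  refine ⟨C₁ + 16 * C₂ + 16 * 56 ^ 8, by positivity, fun R hR s hs c hc X hX => ?_⟩
  have hR0 : 0 < R := by linarith
  have hX1 : 1 ≤ X := by nlinarith
  have hX0 : 0 < X := by linarith
  have hcard := card_le_two_mul hR hs
  have hXε : 1 ≤ X ^ ε := Real.one_le_rpow hX1 hε.le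
  have hP : 0 ≤ R ^ 4 * √R / X := by positivity
  -- Bounded R is handled by the trivial bound; otherwise R^{1/4} ≥ 56, which is what the smallness
  -- hypothesis of the count needs.
  rcases lt_or_ge R (56 ^ 4) with hsmall | hlarge
  · have h1 : ∫ v, ‖sqrtSum s c v‖ ^ 4 ∂(gmean X) ≤ ∫ v, (2 * R) ^ 4 ∂(gmean X) := by
      refine integral_mono (((bddCont_sqrtSum s c).norm.pow 4).integrable _)
        (integrable_const _) fun v => ?_
      have := (norm_expSum_le s c (fun n => √(n : ℝ)) v hc).trans hcard
      simp only [sqrtSum]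
      gcongr
    rw [integral_const, probReal_univ, one_smul] at h1
    calc _ ≤ (2 * R) ^ 4 := h1
      _ = 16 * R ^ 2 * R ^ 2 := by ring
      _ ≤ 16 * (56 ^ 4) ^ 2 * R ^ 2 := by gcongr
      _ = 16 * 56 ^ 8 * 1 * R ^ 2 := by ring
      _ ≤ (C₁ + 16 * C₂ + 16 * 56 ^ 8) * X ^ ε * (R ^ 2 + R ^ 4 * √R / X) := by
          gcongr <;> linarith [mul_pos (show (0:ℝ) < 16 by norm_num) hC₂]
  -- Slightly larger than 1/X: the tail exp(−X^{2η}/4) beats every power of X, while X ≥ R² and η ≤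
  -- 1/8 give δR^{3/2} ≤ R^{2η − 1/2} ≤ R^{−1/4}.
  · set δ := X ^ (η - 1) with hδ
    have hδ0 : 0 < δ := by positivity
    have hδR : 56 * (δ * R * √R) ≤ 1 := by
      have h1 : δ ≤ R ^ (2 * (η - 1)) := by
        rw [hδ, Real.rpow_mul hR0.le, Real.rpow_two]
        exact Real.rpow_le_rpow_of_nonpos (by positivity) hX (by linarith)
      have h2 : R * √R = R ^ (3 / 2 : ℝ) := by
        rw [Real.sqrt_eq_rpow, ← Real.rpow_one_add' hR0.le (by norm_num)]; norm_num
      have h3 : (56 : ℝ) ≤ R ^ (1 / 4 : ℝ) := by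
        calc (56 : ℝ) = ((56 : ℝ) ^ (4 : ℕ)) ^ (1 / 4 : ℝ) := by
              rw [← Real.rpow_natCast, ← Real.rpow_mul (by norm_num)]; norm_num
          _ ≤ _ := by gcongr
      calc 56 * (δ * R * √R) = 56 * (δ * (R * √R)) := by ring
        _ ≤ R ^ (1 / 4 : ℝ) * (R ^ (2 * (η - 1)) * R ^ (3 / 2 : ℝ)) := by rw [h2]; gcongr
        _ = R ^ (1 / 4 + (2 * (η - 1) + 3 / 2)) := by
            rw [← Real.rpow_add hR0, ← Real.rpow_add hR0]
        _ ≤ 1 := Real.rpow_le_one_of_one_le_of_nonpos hR (by linarith)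
    have h4 : ∀ v, ‖sqrtSum s c v‖ ^ 4 = ‖expSum (s ×ˢ s) (fun p => c p.1 * c p.2)
        (fun p => √(p.1 : ℝ) + √(p.2 : ℝ)) v‖ ^ 2 := by
      intro v
      have := expSum_mul s s c c (fun n => √(n : ℝ)) (fun n => √(n : ℝ)) v
      rw [← this, norm_mul, sqrtSum]; ring
    simp_rw [h4]
    have h5 := integral_normSq_expSum_le_card (s ×ˢ s) (fun p => c p.1 * c p.2)
      (fun p => √(p.1 : ℝ) + √(p.2 : ℝ)) (fun p hp => by
        rw [Finset.mem_product] at hp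
        rw [norm_mul]
        exact mul_le_one₀ (hc _ hp.1) (norm_nonneg _) (hc _ hp.2)) X hδ0.le
    have h6 := hcount R hR s hs δ hδ0.le hδR
    have h7 : (((s ×ˢ s).card : ℕ) : ℝ) ^ 2 ≤ 16 * R ^ 2 * X := by
      rw [Finset.card_product]; push_cast
      calc _ ≤ ((2 * R) * (2 * R)) ^ 2 := by gcongr
        _ = 16 * R ^ 2 * R ^ 2 := by ring
        _ ≤ _ := by gcongr
    have h8 : -(X * δ) ^ 2 / 4 = -(X ^ (2 * η)) / 4 := by
      congr 2
      rw [hδ]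
      nth_rewrite 1 [← Real.rpow_one X]
      rw [← Real.rpow_add hX0, ← Real.rpow_natCast, ← Real.rpow_mul hX0.le]
      congr 1; push_cast; ring
    have h9 : (((s ×ˢ s).card : ℕ) : ℝ) ^ 2 * Real.exp (-(X * δ) ^ 2 / 4) ≤ 16 * C₂ * R ^ 2 := by
      rw [h8]
      have := htail X hX1
      rw [Real.rpow_one] at this
      calc _ ≤ 16 * R ^ 2 * X * Real.exp (-(X ^ (2 * η)) / 4) := by gcongr
        _ = 16 * R ^ 2 * (X * Real.exp (-(X ^ (2 * η)) / 4)) := by ring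
        _ ≤ 16 * R ^ 2 * C₂ := by gcongr
        _ = _ := by ring
    have h10 : R ^ η * (R ^ 2 + δ * R ^ 4 * √R) ≤ X ^ ε * (R ^ 2 + R ^ 4 * √R / X) := by
      have e1 : δ = X ^ η / X := by rw [hδ, Real.rpow_sub hX0, Real.rpow_one]
      have e2 : R ^ η ≤ X ^ η := by
        have : R ≤ X := by nlinarith
        gcongr
      have e3 : (1 : ℝ) ≤ X ^ η := Real.one_le_rpow hX1 hη0.le
      calc R ^ η * (R ^ 2 + δ * R ^ 4 * √R) = R ^ η * (1 * R ^ 2 + X ^ η * (R ^ 4 * √R / X)) := by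
            rw [e1]; ring
        _ ≤ X ^ η * (X ^ η * R ^ 2 + X ^ η * (R ^ 4 * √R / X)) := by gcongr
        _ = X ^ (2 * η) * (R ^ 2 + R ^ 4 * √R / X) := by
            rw [two_mul, Real.rpow_add hX0]; ring
        _ ≤ _ := by gcongr
    calc _ ≤ C₁ * R ^ η * (R ^ 2 + δ * R ^ 4 * √R) + 16 * C₂ * R ^ 2 := by
          refine h5.trans (add_le_add ?_ h9)
          convert h6
      _ = C₁ * (R ^ η * (R ^ 2 + δ * R ^ 4 * √R)) + 16 * C₂ * (1 * R ^ 2) := by ring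
      _ ≤ C₁ * (X ^ ε * (R ^ 2 + R ^ 4 * √R / X)) +
          16 * C₂ * (X ^ ε * (R ^ 2 + R ^ 4 * √R / X)) := by
          gcongr
          linarith
      _ = (C₁ + 16 * C₂ + 0) * X ^ ε * (R ^ 2 + R ^ 4 * √R / X) := by ring
      _ ≤ _ := by gcongr; norm_num

/-! ### The van der Corput inequality -/

/-- Autocorrelations of a finitely supported sequence. -/
noncomputable def autocorr (f : ℤ → ℂ) (h : ℤ) : ℂ := ∑' n, f (n + h) * (starRingEnd ℂ) (f n)

lemma autocorr_neg (f : ℤ → ℂ) (h : ℤ) : autocorr f (-h) = (starRingEnd ℂ) (autocorr f h) := by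
  unfold autocorr
  rw [Complex.conj_tsum, ← (Equiv.addRight h).tsum_eq]
  refine tsum_congr fun n => ?_
  simp [mul_comm]

lemma tsum_mul_conj_shift (f : ℤ → ℂ) (r t : ℤ) :
    ∑' m, f (m + r) * (starRingEnd ℂ) (f (m + t)) = autocorr f (r - t) := by
  unfold autocorr
  rw [← (Equiv.addRight t).tsum_eq (fun n => f (n + (r - t)) * (starRingEnd ℂ) (f n))]
  refine tsum_congr fun n => ?_
  simp

/-- Summing f over all windows of length H counts each value H times, and only N + H windows meet
the support. Cauchy–Schwarz then leaves ∑|W m|², which expands into autocorrelations at r − t. For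
fixed r every shift ±h with 1 ≤ h < H occurs at most once, hence the factor 2. -/
lemma vanDerCorput_aux (f : ℤ → ℂ) {A : ℤ} {N H : ℕ} (hH : 0 < H)
    (hf : ∀ n, n ∉ Finset.Ico A (A + N) → f n = 0) :
    H * ‖∑' n, f n‖ ^ 2 ≤ (N + H) * (‖autocorr f 0‖ + 2 * ∑ h ∈ Finset.Ico 1 H, ‖autocorr f h‖) := by
  set I := Finset.Ico (A - H) (A + N)
  have hsum : ∀ r : ℤ, Summable fun m => f (m + r) := fun r => by
    refine ((Equiv.addRight r).summable_iff (f := f)).2 ?_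
    exact summable_of_ne_finset_zero (s := Finset.Ico A (A + N)) hf
  have hsum2 : ∀ r t : ℤ, Summable fun m => f (m + r) * (starRingEnd ℂ) (f (m + t)) :=
    fun r t => by
    refine summable_of_ne_finset_zero (s := Finset.Ico (A - r) (A + N - r)) fun m hm => ?_
    rw [hf (m + r), zero_mul]
    simp only [Finset.mem_Ico, not_and_or, not_le, not_lt] at hm ⊢
    omega
  set W : ℤ → ℂ := fun m => ∑ r ∈ Finset.range H, f (m + r) with hW
  have hW0 : ∀ m, m ∉ I → W m = 0 := by
    intro m hm
    refine Finset.sum_eq_zero fun r hr => hf _ ?_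
    simp only [I, Finset.mem_Ico, not_and_or, not_le, not_lt, Finset.mem_range] at hm hr ⊢
    omega
  have h1 : (H : ℂ) * ∑' n, f n = ∑ m ∈ I, W m := by
    have hWs : ∑ m ∈ I, W m = ∑' m, W m := (tsum_eq_sum fun m hm => hW0 m hm).symm
    rw [hWs, hW, Summable.tsum_finsetSum (fun (r : ℕ) _ => hsum r)]
    have : ∀ r : ℕ, ∑' m, f (m + r) = ∑' n, f n := fun r =>
      (Equiv.addRight (r : ℤ)).tsum_eq f
    simp [this]
  have h2 : ∑ m ∈ I, ((‖W m‖ ^ 2 : ℝ) : ℂ) =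
      ∑ r ∈ Finset.range H, ∑ t ∈ Finset.range H, autocorr f (r - t) := by
    have hexp : ∀ m, ((‖W m‖ ^ 2 : ℝ) : ℂ) = ∑ r ∈ Finset.range H, ∑ t ∈ Finset.range H,
        f (m + r) * (starRingEnd ℂ) (f (m + t)) := by
      intro m
      push_cast
      rw [← Complex.mul_conj', hW, map_sum, Finset.sum_mul_sum]
    have hWs : ∑ m ∈ I, ((‖W m‖ ^ 2 : ℝ) : ℂ) = ∑' m, ((‖W m‖ ^ 2 : ℝ) : ℂ) :=
      (tsum_eq_sum fun m hm => by rw [hW0 m hm]; simp).symm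
    rw [hWs]
    simp_rw [hexp]
    rw [Summable.tsum_finsetSum (fun (r : ℕ) _ => summable_sum fun (t : ℕ) _ => hsum2 r t)]
    refine Finset.sum_congr rfl fun r _ => ?_
    rw [Summable.tsum_finsetSum (fun (t : ℕ) _ => hsum2 r t)]
    exact Finset.sum_congr rfl fun t _ => tsum_mul_conj_shift f r t
  have h3 : ∑ m ∈ I, ‖W m‖ ^ 2 ≤
      H * (‖autocorr f 0‖ + 2 * ∑ h ∈ Finset.Ico 1 H, ‖autocorr f h‖) := by
    have h30 : ∑ m ∈ I, ‖W m‖ ^ 2 =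
        ‖∑ r ∈ Finset.range H, ∑ t ∈ Finset.range H, autocorr f (r - t)‖ := by
      rw [← h2, ← Complex.ofReal_sum, Complex.norm_real, Real.norm_of_nonneg]
      exact Finset.sum_nonneg fun _ _ => by positivity
    rw [h30]
    calc _ ≤ ∑ r ∈ Finset.range H, ∑ t ∈ Finset.range H, ‖autocorr f (r - t)‖ :=
          (norm_sum_le _ _).trans (Finset.sum_le_sum fun _ _ => norm_sum_le _ _)
      _ ≤ ∑ r ∈ Finset.range H,
          (‖autocorr f 0‖ + 2 * ∑ h ∈ Finset.Ico 1 H, ‖autocorr f h‖) := by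
          refine Finset.sum_le_sum fun r hr => ?_
          have hr := Finset.mem_range.1 hr
          have hsplit : ∑ t ∈ Finset.range H, ‖autocorr f (r - t)‖ =
              (∑ t ∈ Finset.range r, ‖autocorr f (r - t)‖) + ‖autocorr f 0‖ +
                ∑ t ∈ Finset.Ico (r + 1) H, ‖autocorr f (r - t)‖ := by
            rw [← Finset.sum_range_add_sum_Ico _ (show r + 1 ≤ H by omega),
              Finset.sum_range_succ]
            simp
          have hA : ∑ t ∈ Finset.range r, ‖autocorr f (r - t)‖ ≤
              ∑ h ∈ Finset.Ico 1 H, ‖autocorr f h‖ := by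
            rw [← Finset.sum_image (s := Finset.range r) (g := fun t => r - t)
              (f := fun h : ℕ => ‖autocorr f h‖) (by
                intro a ha b hb hab
                simp only [Finset.coe_range, Set.mem_Iio] at ha hb hab
                omega) |>.trans (Finset.sum_congr rfl fun t ht => by
                  have := Finset.mem_range.1 ht
                  rw [Nat.cast_sub this.le])]
            refine Finset.sum_le_sum_of_subset_of_nonneg (fun x hx => ?_)
              fun _ _ _ => norm_nonneg _
            obtain ⟨t, ht, rfl⟩ := Finset.mem_image.1 hx
            have := Finset.mem_range.1 ht
            rw [Finset.mem_Ico]; omega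
          have hB : ∑ t ∈ Finset.Ico (r + 1) H, ‖autocorr f (r - t)‖ ≤
              ∑ h ∈ Finset.Ico 1 H, ‖autocorr f h‖ := by
            rw [← Finset.sum_image (s := Finset.Ico (r + 1) H) (g := fun t => t - r)
              (f := fun h : ℕ => ‖autocorr f h‖) (by
                intro a ha b hb hab
                simp only [Finset.coe_Ico, Set.mem_Ico] at ha hb hab
                omega) |>.trans (Finset.sum_congr rfl fun t ht => by
                  have := Finset.mem_Ico.1 ht
                  rw [Nat.cast_sub (by omega), ← neg_sub, autocorr_neg, RCLike.norm_conj])]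
            refine Finset.sum_le_sum_of_subset_of_nonneg (fun x hx => ?_)
              fun _ _ _ => norm_nonneg _
            obtain ⟨t, ht, rfl⟩ := Finset.mem_image.1 hx
            have := Finset.mem_Ico.1 ht
            rw [Finset.mem_Ico]; omega
          rw [hsplit]; linarith
      _ = _ := by rw [Finset.sum_const, Finset.card_range, nsmul_eq_mul]
  have hcardI : (I.card : ℝ) = N + H := by
    have : I.card = N + H := by simp [I]; omega
    rw [this]; push_cast; ring
  have h4 : ((H : ℝ) * ‖∑' n, f n‖) ^ 2 ≤ (N + H) * ∑ m ∈ I, ‖W m‖ ^ 2 := by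
    have : (H : ℝ) * ‖∑' n, f n‖ = ‖∑ m ∈ I, W m‖ := by
      rw [← h1, norm_mul, Complex.norm_natCast]
    rw [this, ← hcardI]
    calc _ ≤ (∑ m ∈ I, ‖W m‖) ^ 2 := by gcongr; exact norm_sum_le _ _
      _ ≤ _ := sq_sum_le_card_mul_sum_sq
  have hHpos : (0 : ℝ) < H := by exact_mod_cast hH
  have h5 : (H : ℝ) * (H * ‖∑' n, f n‖ ^ 2) ≤ H * ((N + H) *
      (‖autocorr f 0‖ + 2 * ∑ h ∈ Finset.Ico 1 H, ‖autocorr f h‖)) := by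
    calc _ = ((H : ℝ) * ‖∑' n, f n‖) ^ 2 := by ring
      _ ≤ _ := h4
      _ ≤ (N + H) * (H * (‖autocorr f 0‖ + 2 * ∑ h ∈ Finset.Ico 1 H, ‖autocorr f h‖)) := by gcongr
      _ = _ := by ring
  exact le_of_mul_le_mul_left h5 hHpos

/-- The differenced sums in the van der Corput inequality. -/
noncomputable def diffSum (s : Finset ℕ) (c : ℕ → ℂ) (h : ℕ) (v : ℝ) : ℂ :=
  expSum (s.filter fun n => n + h ∈ s) (fun n => c (n + h) * (starRingEnd ℂ) (c n))
    (fun n => √((n + h : ℕ) : ℝ) - √(n : ℝ)) v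

/-- The van der Corput inequality for exponential sums with square root frequencies. -/
lemma vanDerCorput (s : Finset ℕ) (c : ℕ → ℂ) {A N H : ℕ} (hH : 0 < H)
    (hs : s ⊆ Finset.Ico A (A + N)) (hc : ∀ n ∈ s, ‖c n‖ ≤ 1) (v : ℝ) :
    H * ‖sqrtSum s c v‖ ^ 2 ≤ (N + H) * (s.card + 2 * ∑ h ∈ Finset.Ico 1 H, ‖diffSum s c h v‖) := by
  classical
  set g : ℕ → ℂ := fun n => if n ∈ s then c n * osc √(n : ℝ) v else 0 with hg
  set f : ℤ → ℂ := fun n => if 0 ≤ n then g n.toNat else 0 with hf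
  have hfcast : ∀ n : ℕ, f n = g n := fun n => by simp [hf]
  have hg0 : ∀ n, n ∉ s → g n = 0 := fun n hn => by simp [hg, hn]
  have htsum : ∀ F : ℤ → ℂ, (∀ n : ℤ, f n = 0 → F n = 0) → ∑' n, F n = ∑ n ∈ s, F n := by
    intro F hF
    rw [tsum_eq_sum (s := s.map Nat.castEmbedding), Finset.sum_map]
    · simp
    · intro n hn
      apply hF
      rcases le_or_gt 0 n with h | h
      · lift n to ℕ using h
        rw [hfcast]
        apply hg0
        intro hns
        exact hn (Finset.mem_map.2 ⟨n, hns, rfl⟩)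
      · simp [hf, not_le.2 h]
  have hsupp : ∀ n : ℤ, n ∉ Finset.Ico (A : ℤ) (A + N) → f n = 0 := by
    intro n hn
    rcases le_or_gt 0 n with h | h
    · lift n to ℕ using h
      rw [hfcast]
      apply hg0
      intro hns
      have := Finset.mem_Ico.1 (hs hns)
      apply hn
      rw [Finset.mem_Ico]; omega
    · simp [hf, not_le.2 h]
  have h1 : ∑' n, f n = sqrtSum s c v := by
    rw [htsum f fun _ h => h]
    unfold sqrtSum expSum
    exact Finset.sum_congr rfl fun n hn => by rw [hfcast, hg]; simp [hn]
  have hnorm : ∀ n ∈ s, ‖g n‖ ≤ 1 := fun n hn => by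
    simp only [hg, hn, if_true, norm_mul, norm_osc, mul_one]; exact hc n hn
  have h2 : ‖autocorr f 0‖ ≤ s.card := by
    unfold autocorr
    rw [htsum _ fun n h => by simp [h]]
    refine (norm_sum_le _ _).trans ?_
    calc _ ≤ ∑ n ∈ s, (1 : ℝ) := Finset.sum_le_sum fun n hn => by
          rw [add_zero, hfcast, norm_mul, RCLike.norm_conj]
          exact mul_le_one₀ (hnorm n hn) (norm_nonneg _) (hnorm n hn)
      _ = _ := by simp
  have h3 : ∀ h : ℕ, autocorr f h = diffSum s c h v := by
    intro h
    unfold autocorr diffSum expSum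
    rw [htsum _ fun n h => by simp [h], Finset.sum_filter]
    refine Finset.sum_congr rfl fun n hn => ?_
    have : ((n : ℤ) + h) = ((n + h : ℕ) : ℤ) := by push_cast; ring
    rw [this, hfcast, hfcast]
    simp only [hg, hn, if_true]
    split_ifs with hnh
    · rw [map_mul, conj_osc, sub_eq_add_neg, osc_add]; ring
    · simp
  have := vanDerCorput_aux f hH hsupp
  rw [h1] at this
  simp_rw [h3] at this
  refine this.trans ?_
  gcongr

/-! ### Integer points near a convex curve -/

/-- If the integers `y₁, y₂, y₃` are within `τ` of the values at `n₁ < n₂ < n₃` of a function with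
second derivative between `m` and `K`, then the gaps are small. -/
lemma mul_gaps_le_of_near_curve {n₁ n₂ n₃ : ℕ} (h12 : n₁ < n₂) (h23 : n₂ < n₃) {y₁ y₂ y₃ : ℤ}
    {G G₁ G₂ : ℝ → ℝ} {m K τ : ℝ}
    (hG : ∀ x ∈ Set.Icc (n₁ : ℝ) n₃, HasDerivAt G (G₁ x) x)
    (hG₁ : ∀ x ∈ Set.Icc (n₁ : ℝ) n₃, HasDerivAt G₁ (G₂ x) x)
    (hm : ∀ x ∈ Set.Icc (n₁ : ℝ) n₃, m ≤ G₂ x) (hK : ∀ x ∈ Set.Icc (n₁ : ℝ) n₃, G₂ x ≤ K)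
    (hm0 : 0 ≤ m)
    (h1 : |(y₁ : ℝ) - G n₁| ≤ τ) (h2 : |(y₂ : ℝ) - G n₂| ≤ τ) (h3 : |(y₃ : ℝ) - G n₃| ≤ τ)
    (hsmall : K * ((n₃ : ℝ) - n₁) ^ 3 / 8 + 2 * τ * ((n₃ : ℝ) - n₁) < 1) :
    m * (((n₂ : ℝ) - n₁) * ((n₃ : ℝ) - n₂)) ≤ 4 * τ := by
  have hn12 : (n₁ : ℝ) < n₂ := by exact_mod_cast h12
  have hn23 : (n₂ : ℝ) < n₃ := by exact_mod_cast h23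
  set I := Set.Icc (n₁ : ℝ) n₃
  set a : ℝ := (n₁ : ℝ)
  set b : ℝ := (n₂ : ℝ)
  set c : ℝ := (n₃ : ℝ)
  have hI : Convex ℝ I := convex_Icc _ _
  -- convexity of a quadratic perturbation, evaluated at the three points
  have key : ∀ σ t : ℝ, (∀ x ∈ I, 0 ≤ σ * G₂ x - t) →
      0 ≤ σ * ((c - b) * G a - (c - a) * G b + (b - a) * G c) - t / 2 *
        ((b - a) * (c - b) * (c - a)) := by
    intro σ t hσ
    have hc : ConvexOn ℝ I (fun x => σ * G x - t / 2 * x ^ 2) := by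
      refine convexOn_of_hasDerivWithinAt2_nonneg hI (f' := fun x => σ * G₁ x - t * x)
        (f'' := fun x => σ * G₂ x - t) ?_ ?_ ?_ ?_
      · intro x hx
        exact (((hG x hx).const_mul σ).sub (((hasDerivAt_pow 2 x).const_mul (t / 2)))).continuousAt
          |>.continuousWithinAt
      · intro x hx
        have hx := interior_subset hx
        have := ((hG x hx).const_mul σ).sub (((hasDerivAt_pow 2 x).const_mul (t / 2)))
        exact (this.congr_deriv (by push_cast; ring)).hasDerivWithinAt
      · intro x hx
        have hx := interior_subset hx
        have := ((hG₁ x hx).const_mul σ).sub ((hasDerivAt_id x).const_mul t)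
        exact (this.congr_deriv (by ring)).hasDerivWithinAt
      · intro x hx
        exact hσ x (interior_subset hx)
    have ha : a ∈ I := ⟨le_rfl, by linarith⟩
    have hcI : c ∈ I := ⟨by linarith, le_rfl⟩
    have hca : 0 < c - a := by linarith
    have p1 : 0 ≤ (c - b) / (c - a) := by apply div_nonneg <;> linarith
    have p2 : 0 ≤ (b - a) / (c - a) := by apply div_nonneg <;> linarith
    have h := hc.2 ha hcI p1 p2 (by field_simp; ring)
    have hb : ((c - b) / (c - a)) • a + ((b - a) / (c - a)) • c = b := by
      simp only [smul_eq_mul]; field_simp; ring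
    rw [hb] at h
    simp only [smul_eq_mul] at h
    have h' := mul_le_mul_of_nonneg_left h hca.le
    have e : (c - a) * ((c - b) / (c - a) * (σ * G a - t / 2 * a ^ 2) +
        (b - a) / (c - a) * (σ * G c - t / 2 * c ^ 2)) =
        (c - b) * (σ * G a - t / 2 * a ^ 2) + (b - a) * (σ * G c - t / 2 * c ^ 2) := by
      field_simp
    rw [e] at h'
    linarith [h']
  set DG := (c - b) * G a - (c - a) * G b + (b - a) * G c with hDG
  have hlow := key 1 m fun x hx => by linarith [hm x hx]
  have hupp := key (-1) (-K) fun x hx => by linarith [hK x hx]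
  set V := (b - a) * (c - b) * (c - a) with hV
  have hg1 : 0 < b - a := by linarith
  have hg2 : 0 < c - b := by linarith
  have hg : 0 < c - a := by linarith
  have hV0 : 0 ≤ V := by positivity
  -- The same second difference formed from the integers. It lies within 2(c−a)τ of DG, and mV/2 ≤
  -- DG ≤ KV/2, so `hsmall` gives |Δ| < 1 and hence Δ = 0. The lower bound for DG then limits V.
  set Δ : ℤ := (n₃ - n₂) * y₁ - (n₃ - n₁) * y₂ + (n₂ - n₁) * y₃ with hΔ
  have hΔr : (Δ : ℝ) = (c - b) * y₁ - (c - a) * y₂ + (b - a) * y₃ := by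
    rw [hΔ]; push_cast; ring
  have hdiff : |(Δ : ℝ) - DG| ≤ 2 * (c - a) * τ := by
    have e : (Δ : ℝ) - DG = (c - b) * (y₁ - G a) + (-((c - a) * (y₂ - G b))) +
        (b - a) * (y₃ - G c) := by
      rw [hΔr, hDG]; ring
    rw [e]
    refine (abs_add_three _ _ _).trans ?_
    rw [abs_neg, abs_mul, abs_mul, abs_mul, abs_of_pos hg1, abs_of_pos hg2, abs_of_pos hg]
    have k1 := mul_le_mul_of_nonneg_left h1 hg2.le
    have k2 := mul_le_mul_of_nonneg_left h2 hg.le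
    have k3 := mul_le_mul_of_nonneg_left h3 hg1.le
    nlinarith
  have hm' : 0 ≤ m / 2 * V := by positivity
  have hK0 : 0 ≤ K := hm0.trans ((hm a ⟨le_rfl, by linarith⟩).trans (hK a ⟨le_rfl, by linarith⟩))
  have hVle : V ≤ (c - a) ^ 3 / 4 := by
    rw [hV]
    have : (b - a) * (c - b) ≤ (c - a) ^ 2 / 4 := by nlinarith [sq_nonneg (b - a - (c - b))]
    calc _ ≤ (c - a) ^ 2 / 4 * (c - a) := by gcongr
      _ = _ := by ring
  have hKV : K / 2 * V ≤ K * (c - a) ^ 3 / 8 := by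
    calc K / 2 * V ≤ K / 2 * ((c - a) ^ 3 / 4) := by gcongr
      _ = _ := by ring
  have hd := abs_le.1 hdiff
  have hτ : 0 ≤ τ := (abs_nonneg _).trans h1
  have hKc : 0 ≤ K * (c - a) ^ 3 / 8 := by positivity
  have hΔ0 : Δ = 0 := by
    rw [← Int.abs_lt_one_iff]
    have : |(Δ : ℝ)| < 1 := by
      rw [abs_lt]; constructor <;> linarith
    exact_mod_cast this
  rw [hΔ0, Int.cast_zero] at hd
  have hfin : m / 2 * V ≤ 2 * (c - a) * τ := by linarith
  have : (c - a) * (m * ((b - a) * (c - b))) ≤ (c - a) * (4 * τ) := by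
    rw [hV] at hfin; linarith
  exact le_of_mul_le_mul_left this hg

lemma add_le_orderEmbOfFin {F : Finset ℕ} {r : ℕ} (hF : F.card = r) :
    ∀ d i (h : i + d < r), F.orderEmbOfFin hF ⟨i, by omega⟩ + d ≤ F.orderEmbOfFin hF ⟨i + d, h⟩ := by
  intro d
  induction d with
  | zero => intro i h; simp
  | succ d ih =>
    intro i h
    have h1 := ih i (by omega)
    have h2 : F.orderEmbOfFin hF ⟨i + d, by omega⟩ < F.orderEmbOfFin hF ⟨i + (d + 1), h⟩ :=
      (F.orderEmbOfFin hF).strictMono (by simp [Fin.lt_def])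
    omega

/-- Taking an early, a middle and a late element of F in increasing order makes both gaps at least q
− 1, where q is half the cardinality rounded down. Hence q − 1 ≤ √Z. -/
lemma card_le_of_mul_gaps_le {F : Finset ℕ} {Z : ℝ}
    (h : ∀ a ∈ F, ∀ b ∈ F, ∀ c ∈ F, a < b → b < c → ((b : ℝ) - a) * ((c : ℝ) - b) ≤ Z) :
    (F.card : ℝ) ≤ 2 * √Z + 3 := by
  obtain ⟨r, hr⟩ : ∃ r, F.card = r := ⟨_, rfl⟩
  have hsq := Real.sqrt_nonneg Z
  rcases lt_or_ge r 4 with h4 | h4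
  · rw [hr]
    have : (r : ℝ) ≤ 3 := by exact_mod_cast Nat.le_of_lt_succ h4
    linarith
  set f := F.orderEmbOfFin hr
  set q := r / 2
  have hq : 2 ≤ q := by omega
  have h1 := add_le_orderEmbOfFin hr q 0 (by omega)
  have h2 := add_le_orderEmbOfFin hr (q - 1) q (by omega)
  simp only [zero_add] at h1
  have h3 := h _ (F.orderEmbOfFin_mem hr ⟨0, by omega⟩) _ (F.orderEmbOfFin_mem hr ⟨q, by omega⟩) _
    (F.orderEmbOfFin_mem hr ⟨q + (q - 1), by omega⟩) (by omega) (by omega)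
  set x₁ := F.orderEmbOfFin hr ⟨0, by omega⟩
  set x₂ := F.orderEmbOfFin hr ⟨q, by omega⟩
  set x₃ := F.orderEmbOfFin hr ⟨q + (q - 1), by omega⟩
  have k1 : (q : ℝ) - 1 ≤ (x₂ : ℝ) - x₁ := by
    have : (x₁ : ℝ) + q ≤ x₂ := by exact_mod_cast h1
    linarith
  have k2 : (q : ℝ) - 1 ≤ (x₃ : ℝ) - x₂ := by
    have : x₂ + q ≤ x₃ + 1 := by omega
    have : (x₂ : ℝ) + q ≤ x₃ + 1 := by exact_mod_cast this
    linarith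
  have hq' : (2 : ℝ) ≤ q := by exact_mod_cast hq
  have k3 : (q : ℝ) - 1 ≤ √Z := by
    apply Real.le_sqrt_of_sq_le
    calc _ = ((q : ℝ) - 1) * (q - 1) := by ring
      _ ≤ ((x₂ : ℝ) - x₁) * ((x₃ : ℝ) - x₂) := by gcongr <;> linarith
      _ ≤ Z := h3
  have hrq : r ≤ 2 * q + 1 := by omega
  rw [hr]
  calc (r : ℝ) ≤ 2 * q + 1 := by exact_mod_cast hrq
    _ ≤ _ := by linarith

/-- The gap inequality is available only for triples of diameter at most Y, so F is cut into
residue-quotient windows of that length. -/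
lemma card_le_of_mul_gaps_le_window {F : Finset ℕ} {Z : ℝ} {A N Y : ℕ} (hY : 0 < Y)
    (hF : ∀ n ∈ F, A ≤ n ∧ n ≤ A + N)
    (h : ∀ a ∈ F, ∀ b ∈ F, ∀ c ∈ F, a < b → b < c → c - a ≤ Y →
      ((b : ℝ) - a) * ((c : ℝ) - b) ≤ Z) :
    (F.card : ℝ) ≤ ((N : ℝ) / Y + 1) * (2 * √Z + 3) := by
  classical
  have hmap : ∀ n ∈ F, (n - A) / Y ∈ Finset.range (N / Y + 1) := fun n hn => by
    have := hF n hn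
    rw [Finset.mem_range, Nat.lt_succ_iff]
    exact Nat.div_le_div_right (by omega)
  have h1 := Finset.card_eq_sum_card_fiberwise (f := fun n => (n - A) / Y) (s := F)
    (t := Finset.range (N / Y + 1)) (fun n hn => hmap n hn)
  rw [h1]
  push_cast
  calc _ ≤ ∑ _b ∈ Finset.range (N / Y + 1), (2 * √Z + 3) := by
        refine Finset.sum_le_sum fun b _ => card_le_of_mul_gaps_le ?_
        intro u hu v hv w hw huv hvw
        rw [Finset.mem_filter] at hu hv hw
        refine h u hu.1 v hv.1 w hw.1 huv hvw ?_
        have e1 := Nat.div_add_mod (u - A) Y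
        have e2 := Nat.div_add_mod (w - A) Y
        rw [hu.2] at e1
        rw [hw.2] at e2
        have := Nat.mod_lt (w - A) hY
        have := hF u hu.1
        have := hF w hw.1
        omega
    _ ≤ _ := by
        rw [Finset.sum_const, Finset.card_range, nsmul_eq_mul]
        push_cast
        gcongr
        exact Nat.cast_div_le

/-! ### Mixed second differences of the square root -/

/-- The mixed second difference of `ψ`. -/
noncomputable def mixedDiff (ψ : ℝ → ℝ) (h j x : ℝ) : ℝ := ψ (x + h + j) - ψ (x + h) - ψ (x + j) + ψ x

/-- Both x + h and x + j are convex combinations of x and x + h + j, with complementary weights; the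
two convexity inequalities are added. -/
lemma mixedDiff_nonneg {ψ : ℝ → ℝ} {u w : ℝ} (hψ : ConvexOn ℝ (Set.Icc u w) ψ) {x h j : ℝ}
    (hh : 0 ≤ h) (hj : 0 ≤ j) (hx : u ≤ x) (hx' : x + h + j ≤ w) : 0 ≤ mixedDiff ψ h j x := by
  unfold mixedDiff
  rcases (add_nonneg hh hj).eq_or_lt with h0 | h0
  · have : h = 0 := by linarith
    have : j = 0 := by linarith
    subst_vars; simp
  have hx1 : x ∈ Set.Icc u w := ⟨hx, by linarith⟩
  have hx2 : x + h + j ∈ Set.Icc u w := ⟨by linarith, hx'⟩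
  have p1 : 0 ≤ j / (h + j) := by positivity
  have p2 : 0 ≤ h / (h + j) := by positivity
  have p3 : j / (h + j) + h / (h + j) = 1 := by field_simp; ring
  have k1 := hψ.2 hx1 hx2 p1 p2 p3
  have k2 := hψ.2 hx1 hx2 p2 p1 (by rw [add_comm, p3])
  have e1 : (j / (h + j)) • x + (h / (h + j)) • (x + h + j) = x + h := by
    simp only [smul_eq_mul]; field_simp; ring
  have e2 : (h / (h + j)) • x + (j / (h + j)) • (x + h + j) = x + j := by
    simp only [smul_eq_mul]; field_simp; ring
  rw [e1] at k1
  rw [e2] at k2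
  simp only [smul_eq_mul] at k1 k2
  have e3 : j / (h + j) * ψ x + h / (h + j) * ψ (x + h + j) +
      (h / (h + j) * ψ x + j / (h + j) * ψ (x + h + j)) = ψ x + ψ (x + h + j) := by
    field_simp; ring
  linarith

lemma hasDerivAt_mixedDiff {ψ ψ' : ℝ → ℝ} (hψ : ∀ y, 0 < y → HasDerivAt ψ (ψ' y) y) {h j x : ℝ}
    (hh : 0 ≤ h) (hj : 0 ≤ j) (hx : 0 < x) :
    HasDerivAt (mixedDiff ψ h j) (mixedDiff ψ' h j x) x := by
  unfold mixedDiff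
  have k1 := (hψ (x + (h + j)) (by positivity)).comp_add_const x (h + j)
  have k2 := (hψ (x + h) (by positivity)).comp_add_const x h
  have k3 := (hψ (x + j) (by positivity)).comp_add_const x j
  have := ((k1.sub k2).sub k3).add (hψ x hx)
  simp only [← add_assoc] at this
  exact this

/-- The mixed difference is linear in ψ, so convexity of A x^p + B x^q becomes a linear inequality
between the mixed differences of two powers. This is how `sqrtMix`, `sqrtMix₁` and `sqrtMix₂` are
compared without mean value points. -/
lemma convexOn_rpow_comb {u w A B p q : ℝ} (hu : 0 < u)
    (h : ∀ x ∈ Set.Icc u w, 0 ≤ A * (p * ((p - 1) * x ^ (p - 1 - 1))) +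
      B * (q * ((q - 1) * x ^ (q - 1 - 1)))) :
    ConvexOn ℝ (Set.Icc u w) (fun x => A * x ^ p + B * x ^ q) := by
  have key : ∀ (x : ℝ) (r : ℝ), 0 < x → HasDerivAt (fun y : ℝ => y ^ r) (r * x ^ (r - 1)) x :=
    fun x r hx => Real.hasDerivAt_rpow_const (Or.inl hx.ne')
  have hpos : ∀ x ∈ Set.Icc u w, 0 < x := fun x hx => hu.trans_le hx.1
  refine convexOn_of_hasDerivWithinAt2_nonneg (convex_Icc _ _)
    (f' := fun x => A * (p * x ^ (p - 1)) + B * (q * x ^ (q - 1)))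
    (f'' := fun x => A * (p * ((p - 1) * x ^ (p - 1 - 1))) +
      B * (q * ((q - 1) * x ^ (q - 1 - 1)))) ?_ ?_ ?_ ?_
  · intro x hx
    exact (((key x p (hpos x hx)).const_mul A).add ((key x q (hpos x hx)).const_mul B)).continuousAt
      |>.continuousWithinAt
  · intro x hx
    have hx := hpos x (interior_subset hx)
    exact (((key x p hx).const_mul A).add ((key x q hx).const_mul B)).hasDerivWithinAt
  · intro x hx
    have hx := hpos x (interior_subset hx)
    exact ((((key x (p - 1) hx).const_mul p).const_mul A).add
      (((key x (q - 1) hx).const_mul q).const_mul B)).hasDerivWithinAt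
  · intro x hx
    exact h x (interior_subset hx)

/-- The mixed second difference of `√x`, with the sign that makes it nonnegative. -/
noncomputable def sqrtMix : ℝ → ℝ → ℝ → ℝ := mixedDiff fun x => -x ^ (1 / 2 : ℝ)

/-- Minus the derivative of `sqrtMix`. -/
noncomputable def sqrtMix₁ : ℝ → ℝ → ℝ → ℝ := mixedDiff fun x => 1 / 2 * x ^ (-1 / 2 : ℝ)

/-- The second derivative of `sqrtMix`. -/
noncomputable def sqrtMix₂ : ℝ → ℝ → ℝ → ℝ := mixedDiff fun x => 1 / 4 * x ^ (-3 / 2 : ℝ)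

lemma hasDerivAt_sqrtMix {h j x : ℝ} (hh : 0 ≤ h) (hj : 0 ≤ j) (hx : 0 < x) :
    HasDerivAt (sqrtMix h j) (-sqrtMix₁ h j x) x := by
  have := hasDerivAt_mixedDiff (ψ := fun x => -x ^ (1 / 2 : ℝ))
    (ψ' := fun x => -(1 / 2 * x ^ (-1 / 2 : ℝ))) (fun y hy => by
      have := (Real.hasDerivAt_rpow_const (p := 1 / 2) (Or.inl hy.ne')).neg
      exact this.congr_deriv (by norm_num)) hh hj hx
  refine this.congr_deriv ?_
  simp only [sqrtMix₁, mixedDiff]; ring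

lemma hasDerivAt_sqrtMix₁ {h j x : ℝ} (hh : 0 ≤ h) (hj : 0 ≤ j) (hx : 0 < x) :
    HasDerivAt (sqrtMix₁ h j) (-sqrtMix₂ h j x) x := by
  have := hasDerivAt_mixedDiff (ψ := fun x => 1 / 2 * x ^ (-1 / 2 : ℝ))
    (ψ' := fun x => -(1 / 4 * x ^ (-3 / 2 : ℝ))) (fun y hy => by
      have := (Real.hasDerivAt_rpow_const (p := -1 / 2) (Or.inl hy.ne')).const_mul (1 / 2)
      exact this.congr_deriv (by norm_num; ring)) hh hj hx
  refine this.congr_deriv ?_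
  simp only [sqrtMix₂, mixedDiff]; ring

section bounds

variable {R h j x : ℝ}

lemma sqrtMix₂_nonneg (hR : 0 < R) (hh : 0 ≤ h) (hj : 0 ≤ j) (hx : R ≤ x)
    (hx' : x + h + j ≤ 5 / 4 * R) : 0 ≤ sqrtMix₂ h j x := by
  have hc := convexOn_rpow_comb (w := 5 / 4 * R) (A := 1 / 4) (B := 0) (p := -3 / 2) (q := 0) hR
    (fun y hy => by have : 0 < y := hR.trans_le hy.1; norm_num; positivity)
  have := mixedDiff_nonneg hc hh hj hx hx'
  simpa [sqrtMix₂, mixedDiff] using this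

/-- The second derivatives of x^{-1/2}/2 and −x^{1/2} have ratio 3/(2x). Its minimum on [R, 5R/4] is
the constant 6/(5R) here and its maximum is the 3/(2R) of `sqrtMix₁_le`; the ratio 5/(2x) for the
next pair gives `sqrtMix₂_le`. -/
lemma le_sqrtMix₁ (hR : 0 < R) (hh : 0 ≤ h) (hj : 0 ≤ j) (hx : R ≤ x)
    (hx' : x + h + j ≤ 5 / 4 * R) : 6 / (5 * R) * sqrtMix h j x ≤ sqrtMix₁ h j x := by
  have hc := convexOn_rpow_comb (w := 5 / 4 * R) (A := 1 / 2) (B := 6 / (5 * R)) (p := -1 / 2)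
    (q := 1 / 2) hR (fun y hy => by
      have hy0 : 0 < y := hR.trans_le hy.1
      have e : y ^ (1 / 2 - 1 - 1 : ℝ) = y ^ (-1 / 2 - 1 - 1 : ℝ) * y := by
        rw [← Real.rpow_add_one hy0.ne']; norm_num
      rw [e]
      have e2 : 1 / 2 * (-1 / 2 * ((-1 / 2 - 1) * y ^ (-1 / 2 - 1 - 1 : ℝ))) +
          6 / (5 * R) * (1 / 2 * ((1 / 2 - 1) * (y ^ (-1 / 2 - 1 - 1 : ℝ) * y))) =
          y ^ (-1 / 2 - 1 - 1 : ℝ) * (3 / (10 * R) * (5 / 4 * R - y)) := by field_simp; ring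
      rw [e2]
      have : 0 ≤ 5 / 4 * R - y := by linarith [hy.2]
      positivity)
  have := mixedDiff_nonneg hc hh hj hx hx'
  simp only [sqrtMix, sqrtMix₁, mixedDiff] at this ⊢
  linarith

lemma sqrtMix₁_le (hR : 0 < R) (hh : 0 ≤ h) (hj : 0 ≤ j) (hx : R ≤ x)
    (hx' : x + h + j ≤ 5 / 4 * R) : sqrtMix₁ h j x ≤ 3 / (2 * R) * sqrtMix h j x := by
  have hc := convexOn_rpow_comb (w := 5 / 4 * R) (A := -(1 / 2)) (B := -(3 / (2 * R)))
    (p := -1 / 2) (q := 1 / 2) hR (fun y hy => by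
      have hy0 : 0 < y := hR.trans_le hy.1
      have e : y ^ (1 / 2 - 1 - 1 : ℝ) = y ^ (-1 / 2 - 1 - 1 : ℝ) * y := by
        rw [← Real.rpow_add_one hy0.ne']; norm_num
      rw [e]
      have e2 : -(1 / 2) * (-1 / 2 * ((-1 / 2 - 1) * y ^ (-1 / 2 - 1 - 1 : ℝ))) +
          -(3 / (2 * R)) * (1 / 2 * ((1 / 2 - 1) * (y ^ (-1 / 2 - 1 - 1 : ℝ) * y))) =
          y ^ (-1 / 2 - 1 - 1 : ℝ) * (3 / (8 * R) * (y - R)) := by field_simp; ring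
      rw [e2]
      have : 0 ≤ y - R := by linarith [hy.1]
      positivity)
  have := mixedDiff_nonneg hc hh hj hx hx'
  simp only [sqrtMix, sqrtMix₁, mixedDiff] at this ⊢
  linarith

lemma sqrtMix₂_le (hR : 0 < R) (hh : 0 ≤ h) (hj : 0 ≤ j) (hx : R ≤ x)
    (hx' : x + h + j ≤ 5 / 4 * R) : sqrtMix₂ h j x ≤ 5 / (2 * R) * sqrtMix₁ h j x := by
  have hc := convexOn_rpow_comb (w := 5 / 4 * R) (A := 5 / (2 * R) * (1 / 2)) (B := -(1 / 4))
    (p := -1 / 2) (q := -3 / 2) hR (fun y hy => by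
      have hy0 : 0 < y := hR.trans_le hy.1
      have e : y ^ (-1 / 2 - 1 - 1 : ℝ) = y ^ (-3 / 2 - 1 - 1 : ℝ) * y := by
        rw [← Real.rpow_add_one hy0.ne']; norm_num
      rw [e]
      have e2 : 5 / (2 * R) * (1 / 2) * (-1 / 2 * ((-1 / 2 - 1) * (y ^ (-3 / 2 - 1 - 1 : ℝ) * y))) +
          -(1 / 4) * (-3 / 2 * ((-3 / 2 - 1) * y ^ (-3 / 2 - 1 - 1 : ℝ))) =
          y ^ (-3 / 2 - 1 - 1 : ℝ) * (15 / (16 * R) * (y - R)) := by field_simp; ring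
      rw [e2]
      have : 0 ≤ y - R := by linarith [hy.1]
      positivity)
  have := mixedDiff_nonneg hc hh hj hx hx'
  simp only [sqrtMix₂, sqrtMix₁, mixedDiff] at this ⊢
  linarith

lemma sqrtMix_nonneg (hR : 0 < R) (hh : 0 ≤ h) (hj : 0 ≤ j) (hx : R ≤ x)
    (hx' : x + h + j ≤ 5 / 4 * R) : 0 ≤ sqrtMix h j x := by
  have hc := convexOn_rpow_comb (w := 5 / 4 * R) (A := -1) (B := 0) (p := 1 / 2) (q := 0) hR
    (fun y hy => by have : 0 < y := hR.trans_le hy.1; norm_num; positivity)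
  have := mixedDiff_nonneg hc hh hj hx hx'
  simpa [sqrtMix, mixedDiff] using this

lemma sqrtMix_eq (h j x : ℝ) :
    sqrtMix h j x = √(x + h) - √x - (√(x + j + h) - √(x + j)) := by
  simp only [sqrtMix, mixedDiff, Real.sqrt_eq_rpow]
  rw [show x + j + h = x + h + j by ring]; ring

end bounds

/-! ### Close values of differences of square roots -/

lemma sqrt_bounds {R x : ℝ} (hR : 0 < R) (hx : R ≤ x) (hx' : x ≤ 5 / 4 * R) :
    √R ≤ √x ∧ √x ≤ 9 / 8 * √R := by
  refine ⟨Real.sqrt_le_sqrt hx, ?_⟩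
  apply Real.sqrt_le_iff.2 ⟨by positivity, ?_⟩
  rw [mul_pow, Real.sq_sqrt hR.le]; linarith

lemma sqrt_sub_bounds {R b k : ℝ} (hR : 0 < R) (hb : R ≤ b) (hk : 0 ≤ k)
    (hbk : b + k ≤ 5 / 4 * R) :
    4 / 9 * k ≤ (√(b + k) - √b) * √R ∧ (√(b + k) - √b) * √R ≤ k / 2 := by
  have hr : 0 < √R := Real.sqrt_pos.2 hR
  obtain ⟨h1, h2⟩ := sqrt_bounds hR hb (by linarith)
  obtain ⟨h3, h4⟩ := sqrt_bounds hR (show R ≤ b + k by linarith) hbk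
  have e : (√(b + k) - √b) * (√(b + k) + √b) = k := by
    have := Real.sq_sqrt (show 0 ≤ b by linarith)
    have := Real.sq_sqrt (show 0 ≤ b + k by linarith)
    nlinarith
  have hD : 0 ≤ √(b + k) - √b := by
    have := Real.sqrt_le_sqrt (show b ≤ b + k by linarith); linarith
  constructor
  · nlinarith
  · nlinarith

/-- Size of the mixed second difference of the square root. -/
lemma sqrt_mixed_bounds {R b b' k : ℝ} (hR : 0 < R) (hb : R ≤ b) (hbb : b ≤ b') (hk : 0 ≤ k)
    (hbk : b' + k ≤ 5 / 4 * R) :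
    k * (b' - b) ≤ 12 * ((√(b + k) - √b - (√(b' + k) - √b')) * (R * √R)) ∧
      4 * ((√(b + k) - √b - (√(b' + k) - √b')) * (R * √R)) ≤ k * (b' - b) := by
  have hr : 0 < √R := Real.sqrt_pos.2 hR
  have hr2 : √R ^ 2 = R := Real.sq_sqrt hR.le
  obtain ⟨a1, a2⟩ := sqrt_bounds hR hb (by linarith)
  obtain ⟨a3, a4⟩ := sqrt_bounds hR (show R ≤ b + k by linarith) (by linarith)
  obtain ⟨a5, a6⟩ := sqrt_bounds hR (show R ≤ b' by linarith) (by linarith)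
  obtain ⟨a7, a8⟩ := sqrt_bounds hR (show R ≤ b' + k by linarith) hbk
  have c1 := sqrt_sub_bounds hR hb (show 0 ≤ b' - b by linarith) (by linarith)
  have c2 := sqrt_sub_bounds hR (show R ≤ b + k by linarith) (show 0 ≤ b' - b by linarith)
    (by linarith)
  rw [show b + (b' - b) = b' by ring] at c1
  rw [show b + k + (b' - b) = b' + k by ring] at c2
  have e1 : (√(b + k) - √b) * (√(b + k) + √b) = k := by
    have := Real.sq_sqrt (show 0 ≤ b by linarith)
    have := Real.sq_sqrt (show 0 ≤ b + k by linarith)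
    nlinarith
  have e2 : (√(b' + k) - √b') * (√(b' + k) + √b') = k := by
    have := Real.sq_sqrt (show 0 ≤ b' by linarith)
    have := Real.sq_sqrt (show 0 ≤ b' + k by linarith)
    nlinarith
  set S := √(b + k) + √b with hS
  set S' := √(b' + k) + √b' with hS'
  set r := √R
  have hS0 : 2 * r ≤ S := by linarith
  have hS1 : S ≤ 9 / 4 * r := by linarith
  have hS0' : 2 * r ≤ S' := by linarith
  have hS1' : S' ≤ 9 / 4 * r := by linarith
  have hSp : 0 < S := by linarith
  have hSp' : 0 < S' := by linarith
  have hd1 : 8 / 9 * (b' - b) ≤ (S' - S) * r := by rw [hS, hS']; linarith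
  have hd2 : (S' - S) * r ≤ b' - b := by rw [hS, hS']; linarith
  have e3 : (√(b + k) - √b - (√(b' + k) - √b')) = k * (S' - S) / (S * S') := by
    rw [eq_div_iff (by positivity)]
    linear_combination S' * e1 - S * e2
  have hSS1 : S * S' ≤ 81 / 16 * R := by
    calc S * S' ≤ (9 / 4 * r) * (9 / 4 * r) := by gcongr
      _ = 81 / 16 * r ^ 2 := by ring
      _ = _ := by rw [hr2]
  have hSS2 : 4 * R ≤ S * S' := by
    calc 4 * R = (2 * r) * (2 * r) := by rw [← hr2]; ring
      _ ≤ _ := by gcongr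
  have e4 : k * (S' - S) / (S * S') * (R * r) = k * ((S' - S) * r) * (R / (S * S')) := by
    field_simp
  rw [e3, e4]
  have hq1 : 16 / 81 ≤ R / (S * S') := by rw [le_div_iff₀ (by positivity)]; linarith
  have hq2 : R / (S * S') ≤ 1 / 4 := by rw [div_le_iff₀ (by positivity)]; linarith
  have hbb0 : 0 ≤ b' - b := by linarith
  have hd0 : 0 ≤ (S' - S) * r := by linarith
  constructor
  · calc k * (b' - b) ≤ 12 * (k * (8 / 9 * (b' - b)) * (16 / 81)) := by
          have := mul_nonneg hk hbb0; linarith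
      _ ≤ _ := by gcongr
  · calc _ ≤ 4 * (k * (b' - b) * (1 / 4)) := by gcongr
      _ = _ := by ring

/-- The function whose values at integers are compared with `2b + k`. -/
lemma hasDerivAt_inv_sq {k : ℝ} {h j x : ℝ} (hh : 0 ≤ h) (hj : 0 ≤ j) (hx : 0 < x)
    (hL : 0 < sqrtMix h j x) :
    HasDerivAt (fun x => k ^ 2 / (2 * sqrtMix h j x ^ 2))
      (k ^ 2 * sqrtMix₁ h j x / sqrtMix h j x ^ 3) x ∧
    HasDerivAt (fun x => k ^ 2 * sqrtMix₁ h j x / sqrtMix h j x ^ 3)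
      (k ^ 2 * (3 * sqrtMix₁ h j x ^ 2 - sqrtMix₂ h j x * sqrtMix h j x) / sqrtMix h j x ^ 4) x := by
  have h1 := hasDerivAt_sqrtMix hh hj hx
  have h2 := hasDerivAt_sqrtMix₁ hh hj hx
  constructor
  · have := (hasDerivAt_const x (k ^ 2)).fun_div ((h1.fun_pow 2).const_mul 2) (by positivity)
    refine this.congr_deriv ?_
    field_simp
    push_cast
    ring
  · have := (h2.const_mul (k ^ 2)).fun_div (h1.fun_pow 3) (by positivity)
    refine this.congr_deriv ?_
    field_simp
    push_cast
    ring

-- With D = √(b+k) − √b one has 2b + k = (D² + k²/D²)/2. Replacing D by L(n) = `sqrtMix h j n`, and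
-- discarding D²/2 because k is small, puts the integer 2b + k within 18t of G(n) = k²/(2L(n)²),
-- where t = R^{-0.45}. Since G'' is of order 1/R, three such n in a window of length about R^{1/3}
-- have gap product at most 18tR. Each of the O(R^{2/3}) windows thus holds O(R^{0.275}) of them,
-- and 2/3 + 0.275 < 0.95.
set_option maxHeartbeats 2000000 in
lemma card_near_sqrtMix_le {R : ℝ} (hR : (10 : ℝ) ^ 20 ≤ R) {h j k : ℕ} (hk : 1 ≤ k)
    (hkR : (k : ℝ) ≤ 2 * R ^ (27 / 100 : ℝ)) (F : Finset ℕ)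
    (hF : ∀ n ∈ F, R ≤ n ∧ (n : ℝ) + h + j ≤ 5 / 4 * R ∧ ∃ b : ℕ, R ≤ b ∧
      (b : ℝ) + k ≤ 5 / 4 * R ∧
      |sqrtMix h j n - (√((b : ℝ) + k) - √(b : ℝ))| ≤ R ^ (-(195 / 100) : ℝ)) :
    (F.card : ℝ) ≤ 143 * R ^ (95 / 100 : ℝ) := by
  have hR1 : 1 ≤ R := le_trans (by norm_num) hR
  have hR0 : 0 < R := by linarith
  have hr : 0 < √R := Real.sqrt_pos.2 hR0
  have hr2 : √R ^ 2 = R := Real.sq_sqrt hR0.le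
  have hrR : √R = R ^ (1 / 2 : ℝ) := Real.sqrt_eq_rpow R
  have hten : ∀ a : ℝ, 0 ≤ a → ((10 : ℝ) ^ (20 : ℝ)) ^ a ≤ R ^ a := fun a ha => by
    apply Real.rpow_le_rpow (by positivity) _ ha
    exact_mod_cast hR
  set δ := R ^ (-(195 / 100) : ℝ) with hδ
  set t := R ^ (-(45 / 100) : ℝ) with ht
  have hδ0 : 0 < δ := by positivity
  have ht0 : 0 < t := by positivity
  have hδt : δ * R * √R = t := by
    rw [hδ, ht, hrR, ← Real.rpow_add_one hR0.ne', ← Real.rpow_add hR0]; norm_num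
  have hδr : δ * √R ≤ 1 / 100 := by
    rw [hδ, hrR, ← Real.rpow_add hR0]
    calc _ ≤ R ^ (-(1 / 10) : ℝ) := Real.rpow_le_rpow_of_exponent_le hR1 (by norm_num)
      _ = (R ^ (1 / 10 : ℝ))⁻¹ := Real.rpow_neg hR0.le _
      _ ≤ (100)⁻¹ := by
          have := hten (1 / 10) (by norm_num)
          rw [← Real.rpow_mul (by norm_num)] at this
          norm_num at this
          gcongr
      _ = _ := by norm_num
  have hk1 : (1 : ℝ) ≤ k := by exact_mod_cast hk
  have hk0 : (0 : ℝ) < k := by linarith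
  have hk2 : (k : ℝ) ^ 2 / (8 * R) ≤ t / 2 := by
    have e : t * R = R ^ (55 / 100 : ℝ) := by
      rw [ht, ← Real.rpow_add_one hR0.ne']; norm_num
    have e2 : (R ^ (27 / 100 : ℝ)) ^ 2 ≤ R ^ (55 / 100 : ℝ) := by
      rw [← Real.rpow_natCast, ← Real.rpow_mul hR0.le]
      exact Real.rpow_le_rpow_of_exponent_le hR1 (by norm_num)
    rw [div_le_iff₀ (by positivity)]
    calc (k : ℝ) ^ 2 ≤ (2 * R ^ (27 / 100 : ℝ)) ^ 2 := by gcongr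
      _ = 4 * (R ^ (27 / 100 : ℝ)) ^ 2 := by ring
      _ ≤ 4 * (t * R) := by rw [e]; gcongr
      _ = _ := by ring
  -- values of the mixed difference
  have hLr : ∀ n ∈ F, 43 / 100 * k ≤ sqrtMix h j n * √R ∧ sqrtMix h j n * √R ≤ 51 / 100 * k := by
    intro n hn
    obtain ⟨-, -, b, hb1, hb2, hb3⟩ := hF n hn
    obtain ⟨d1, d2⟩ := sqrt_sub_bounds hR0 hb1 hk0.le hb2
    have d3 : |(sqrtMix h j n - (√((b : ℝ) + k) - √(b : ℝ))) * √R| ≤ 1 / 100 := by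
      rw [abs_mul, abs_of_pos hr]
      exact (mul_le_mul_of_nonneg_right hb3 hr.le).trans hδr
    have d4 := abs_le.1 d3
    constructor <;> nlinarith
  have hy : ∀ n ∈ F, ∃ y : ℤ, |(y : ℝ) - (k : ℝ) ^ 2 / (2 * sqrtMix h j n ^ 2)| ≤ 18 * t := by
    intro n hn
    obtain ⟨l1, l2⟩ := hLr n hn
    obtain ⟨-, -, b, hb1, hb2, hb3⟩ := hF n hn
    obtain ⟨d1, d2⟩ := sqrt_sub_bounds hR0 hb1 hk0.le hb2
    refine ⟨2 * b + k, ?_⟩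
    have e1 : (√((b : ℝ) + k) - √(b : ℝ)) * (√((b : ℝ) + k) + √(b : ℝ)) = k := by
      have := Real.sq_sqrt (show 0 ≤ (b : ℝ) by positivity)
      have := Real.sq_sqrt (show 0 ≤ (b : ℝ) + k by positivity)
      nlinarith
    have e2 : ((√((b : ℝ) + k) - √(b : ℝ)) ^ 2 + (√((b : ℝ) + k) + √(b : ℝ)) ^ 2) / 2 = 2 * b + k := by
      have := Real.sq_sqrt (show 0 ≤ (b : ℝ) by positivity)
      have := Real.sq_sqrt (show 0 ≤ (b : ℝ) + k by positivity)
      nlinarith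
    set D := √((b : ℝ) + k) - √(b : ℝ)
    set S := √((b : ℝ) + k) + √(b : ℝ)
    set L := sqrtMix h j n
    set r := √R
    have hD0 : 0 < D := by
      by_contra hcon
      have : D * r ≤ 0 := mul_nonpos_of_nonpos_of_nonneg (not_lt.1 hcon) hr.le
      linarith
    have hL0 : 0 < L := by
      by_contra hcon
      have : L * r ≤ 0 := mul_nonpos_of_nonpos_of_nonneg (not_lt.1 hcon) hr.le
      linarith
    have hS : S = k / D := by rw [eq_div_iff hD0.ne']; linarith
    have e3 : ((2 * b + k : ℤ) : ℝ) - (k : ℝ) ^ 2 / (2 * L ^ 2) =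
        D ^ 2 / 2 + (k : ℝ) ^ 2 * ((L - D) * (L + D)) / (2 * (D ^ 2 * L ^ 2)) := by
      push_cast
      rw [← e2, hS]; field_simp; ring
    rw [e3]
    have hDsq : D ^ 2 / 2 ≤ t / 2 := by
      refine le_trans ?_ hk2
      rw [le_div_iff₀ (by positivity)]
      have : (D * r) ^ 2 ≤ (k / 2) ^ 2 := by gcongr
      rw [mul_pow, hr2] at this
      linarith
    have hsec : |(k : ℝ) ^ 2 * ((L - D) * (L + D)) / (2 * (D ^ 2 * L ^ 2))| ≤ 17 * t := by
      have hden : (k : ℝ) ^ 4 / 28 ≤ (D ^ 2 * L ^ 2) * R ^ 2 := by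
        have h1 : (4 / 9 * k) ^ 2 ≤ (D * r) ^ 2 := by gcongr
        have h2 : (43 / 100 * k) ^ 2 ≤ (L * r) ^ 2 := by gcongr
        have h3 : (D ^ 2 * L ^ 2) * R ^ 2 = (D * r) ^ 2 * (L * r) ^ 2 := by rw [← hr2]; ring
        rw [h3]
        calc (k : ℝ) ^ 4 / 28 ≤ (4 / 9 * k) ^ 2 * (43 / 100 * k) ^ 2 := by
              have : (0 : ℝ) ≤ (k : ℝ) ^ 4 := by positivity
              ring_nf; linarith
          _ ≤ _ := by gcongr
      rw [abs_div, abs_mul, abs_mul, abs_of_pos (show (0 : ℝ) < (k : ℝ) ^ 2 by positivity),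
        abs_of_pos (show 0 < L + D by linarith),
        abs_of_pos (show 0 < 2 * (D ^ 2 * L ^ 2) by positivity), div_le_iff₀ (by positivity)]
      have hsum : (L + D) * r ≤ 101 / 100 * k := by linarith
      have hkk : (k : ℝ) ^ 3 ≤ k ^ 4 := pow_le_pow_right₀ hk1 (by norm_num)
      have hk3 : (0 : ℝ) ≤ (k : ℝ) ^ 3 := by positivity
      have main : (k : ℝ) ^ 2 * (|L - D| * (L + D)) * R ^ 2 ≤
          17 * t * (2 * (D ^ 2 * L ^ 2)) * R ^ 2 := by
        calc (k : ℝ) ^ 2 * (|L - D| * (L + D)) * R ^ 2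
            = (k : ℝ) ^ 2 * (|L - D| * ((L + D) * r)) * (R * r) := by
              nth_rewrite 2 [← hr2]; ring_nf; rw [← hr2]; ring
          _ ≤ (k : ℝ) ^ 2 * (δ * (101 / 100 * k)) * (R * r) := by gcongr
          _ = 101 / 100 * k ^ 3 * t := by rw [← hδt]; ring
          _ ≤ 17 * t * (2 * (k ^ 4 / 28)) := by nlinarith
          _ ≤ 17 * t * (2 * ((D ^ 2 * L ^ 2) * R ^ 2)) := by gcongr
          _ = _ := by ring
      exact le_of_mul_le_mul_right main (by positivity)
    rw [abs_le] at hsec ⊢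
    constructor <;> nlinarith [sq_nonneg D]
  choose! y hy using hy
  -- With K = 43/R and τ = 18t, this window length makes KY³/8 at most 43/1000 and 2τY at most 8/10,
  -- the second because R ≥ 10^20 gives R^{-1/20} ≤ 1/10. Their sum stays below 1.
  set Y := ⌊R ^ (1 / 3 : ℝ) / 5⌋₊ with hYdef
  have hR3 : 10 ≤ R ^ (1 / 3 : ℝ) := by
    calc (10 : ℝ) ≤ R ^ (1 / 20 : ℝ) := by
          have := hten (1 / 20) (by norm_num)
          rw [← Real.rpow_mul (by norm_num)] at this
          norm_num at this
          exact this
      _ ≤ _ := Real.rpow_le_rpow_of_exponent_le hR1 (by norm_num)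
  have hY1 : (Y : ℝ) ≤ R ^ (1 / 3 : ℝ) / 5 := Nat.floor_le (by positivity)
  have hY2 : R ^ (1 / 3 : ℝ) / 10 ≤ Y := by
    have := Nat.lt_floor_add_one (R ^ (1 / 3 : ℝ) / 5)
    rw [← hYdef] at this
    linarith
  have hYpos : 0 < Y := by
    have : (0 : ℝ) < Y := by linarith
    exact_mod_cast this
  have hwin := card_le_of_mul_gaps_le_window (F := F) (Z := 18 * t * R) (A := ⌈R⌉₊) (N := ⌊R⌋₊)
    (Y := Y) hYpos (fun n hn => by
      obtain ⟨f1, f2, -⟩ := hF n hn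
      refine ⟨Nat.ceil_le.2 f1, ?_⟩
      have h3 : (n : ℝ) < ⌈R⌉₊ + (⌊R⌋₊ + 1) := by
        have := Nat.le_ceil R
        have := Nat.lt_floor_add_one R
        have : (0 : ℝ) ≤ h := by positivity
        have : (0 : ℝ) ≤ j := by positivity
        linarith
      have h4 : n < ⌈R⌉₊ + (⌊R⌋₊ + 1) := by exact_mod_cast h3
      omega) (by
    intro a ha b hb c hc hab hbc hca
    have hac : (a : ℝ) < c := by exact_mod_cast hab.trans hbc
    obtain ⟨fa, -, -⟩ := hF a ha
    obtain ⟨-, fc, -⟩ := hF c hc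
    have hh : (0 : ℝ) ≤ h := by positivity
    have hj : (0 : ℝ) ≤ j := by positivity
    have hI1 : ∀ x ∈ Set.Icc (a : ℝ) c, R ≤ x := fun x hx => fa.trans hx.1
    have hI2 : ∀ x ∈ Set.Icc (a : ℝ) c, x + h + j ≤ 5 / 4 * R := fun x hx => by linarith [hx.2]
    have hP0 : ∀ x ∈ Set.Icc (a : ℝ) c, 0 ≤ sqrtMix₁ h j x := fun x hx =>
      le_trans (by have := sqrtMix_nonneg hR0 hh hj (hI1 x hx) (hI2 x hx); positivity)
        (le_sqrtMix₁ hR0 hh hj (hI1 x hx) (hI2 x hx))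
    have hanti : AntitoneOn (sqrtMix h j) (Set.Icc (a : ℝ) c) := by
      refine antitoneOn_of_hasDerivWithinAt_nonpos (convex_Icc _ _)
        (f' := fun x => -sqrtMix₁ h j x) ?_ ?_ ?_
      · intro x hx
        exact (hasDerivAt_sqrtMix hh hj (hR0.trans_le (hI1 x hx))).continuousAt.continuousWithinAt
      · intro x hx
        exact (hasDerivAt_sqrtMix hh hj
          (hR0.trans_le (hI1 x (interior_subset hx)))).hasDerivWithinAt
      · intro x hx
        have := hP0 x (interior_subset hx)
        linarith
    have hL : ∀ x ∈ Set.Icc (a : ℝ) c, 43 / 100 * k ≤ sqrtMix h j x * √R ∧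
        sqrtMix h j x * √R ≤ 51 / 100 * k := by
      intro x hx
      have h1 := hanti hx ⟨hac.le, le_rfl⟩ hx.2
      have h2 := hanti ⟨le_rfl, hac.le⟩ hx hx.1
      have h3 := (hLr c hc).1
      have h4 := (hLr a ha).2
      constructor
      · exact h3.trans (by gcongr)
      · exact le_trans (by gcongr) h4
    have hLpos : ∀ x ∈ Set.Icc (a : ℝ) c, 0 < sqrtMix h j x := fun x hx => by
      have := (hL x hx).1
      by_contra hcon
      have : sqrtMix h j x * √R ≤ 0 := mul_nonpos_of_nonpos_of_nonneg (not_lt.1 hcon) hr.le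
      linarith
    have hder : ∀ x ∈ Set.Icc (a : ℝ) c, _ := fun x hx =>
      hasDerivAt_inv_sq (k := k) hh hj (hR0.trans_le (hI1 x hx)) (hLpos x hx)
    have hca' : (c : ℝ) - a ≤ Y := by
      have : (c : ℝ) ≤ Y + a := by exact_mod_cast (by omega : c ≤ Y + a)
      linarith
    have res := mul_gaps_le_of_near_curve (m := 4 / R) (K := 43 / R) hab hbc
      (fun x hx => (hder x hx).1) (fun x hx => (hder x hx).2) ?_ ?_ (by positivity)
      (hy a ha) (hy b hb) (hy c hc) ?_
    · rw [div_mul_eq_mul_div, div_le_iff₀ hR0] at res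
      linarith
    -- The lower bound for G'' = k²(3P² − QL)/L⁴. From P ≥ 6L/(5R) and Q ≤ 5P/(2R) one gets 3P² − QL
    -- ≥ 1.32 L²/R², and L²R ≤ (0.51k)² turns this into at least 4/R.
    · intro x hx
      have h1 := le_sqrtMix₁ hR0 hh hj (hI1 x hx) (hI2 x hx)
      have h2 := sqrtMix₂_le hR0 hh hj (hI1 x hx) (hI2 x hx)
      have h3 := (hL x hx).2
      have h4 := hLpos x hx
      set L := sqrtMix h j x
      set P := sqrtMix₁ h j x
      set Q := sqrtMix₂ h j x
      have hLr2 : L ^ 2 * R ≤ (51 / 100) ^ 2 * k ^ 2 := by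
        have : (L * √R) ^ 2 ≤ (51 / 100 * k) ^ 2 := by gcongr
        rw [mul_pow, hr2] at this; linarith
      have hPL : P * R ≥ 6 / 5 * L := by
        have := mul_le_mul_of_nonneg_right h1 hR0.le
        have e : 6 / (5 * R) * L * R = 6 / 5 * L := by field_simp
        linarith
      have hQP : Q * R ≤ 5 / 2 * P := by
        have := mul_le_mul_of_nonneg_right h2 hR0.le
        have e : 5 / (2 * R) * P * R = 5 / 2 * P := by field_simp
        linarith
      have hP0' : 0 ≤ P * R := by nlinarith
      have hmain : 132 / 100 * L ^ 2 ≤ (3 * P ^ 2 - Q * L) * R ^ 2 := by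
        have e1 : (3 * P ^ 2 - Q * L) * R ^ 2 = 3 * (P * R) ^ 2 - (Q * R) * R * L := by ring
        have e2 : (Q * R) * R * L ≤ 5 / 2 * P * R * L := by gcongr
        have e3 : 132 / 100 * L ^ 2 ≤ (P * R) * (3 * (P * R) - 5 / 2 * L) := by
          have : 11 / 10 * L ≤ 3 * (P * R) - 5 / 2 * L := by linarith
          calc 132 / 100 * L ^ 2 = (6 / 5 * L) * (11 / 10 * L) := by ring
            _ ≤ _ := by gcongr
        rw [e1]; linarith
      rw [div_le_div_iff₀ hR0 (by positivity)]
      have : 4 * L ^ 4 * R ≤ k ^ 2 * (3 * P ^ 2 - Q * L) * R * R := by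
        calc 4 * L ^ 4 * R = 4 * L ^ 2 * (L ^ 2 * R) := by ring
          _ ≤ 4 * L ^ 2 * ((51 / 100) ^ 2 * k ^ 2) := by gcongr
          _ ≤ k ^ 2 * (132 / 100 * L ^ 2) := by
              have : 0 ≤ (k : ℝ) ^ 2 * L ^ 2 := by positivity
              nlinarith
          _ ≤ k ^ 2 * ((3 * P ^ 2 - Q * L) * R ^ 2) := by gcongr
          _ = _ := by ring
      have e := le_of_mul_le_mul_right (by linarith : 4 * L ^ 4 * R ≤ (k ^ 2 * (3 * P ^ 2 - Q * L) * R) * R) hR0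
      linarith
    · intro x hx
      have h1 := sqrtMix₁_le hR0 hh hj (hI1 x hx) (hI2 x hx)
      have h2 := sqrtMix₂_nonneg hR0 hh hj (hI1 x hx) (hI2 x hx)
      have h3 := (hL x hx).1
      have h4 := hLpos x hx
      have h5 := hP0 x hx
      set L := sqrtMix h j x
      set P := sqrtMix₁ h j x
      set Q := sqrtMix₂ h j x
      have hLr2 : (43 / 100) ^ 2 * k ^ 2 ≤ L ^ 2 * R := by
        have : (43 / 100 * k) ^ 2 ≤ (L * √R) ^ 2 := by gcongr
        rw [mul_pow, mul_pow, hr2] at this; linarith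
      have hPL : P * R ≤ 3 / 2 * L := by
        have := mul_le_mul_of_nonneg_right h1 hR0.le
        have e : 3 / (2 * R) * L * R = 3 / 2 * L := by field_simp
        linarith
      have hPR : (P * R) ^ 2 ≤ (3 / 2 * L) ^ 2 := by gcongr
      rw [div_le_div_iff₀ (by positivity) hR0]
      have : (k ^ 2 * (3 * P ^ 2 - Q * L) * R) * R ≤ (43 * L ^ 4) * R := by
        calc (k ^ 2 * (3 * P ^ 2 - Q * L) * R) * R ≤ (k ^ 2 * (3 * P ^ 2) * R) * R := by
              have : 0 ≤ Q * L := by positivity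
              gcongr; linarith
          _ = 3 * (k ^ 2 * (P * R) ^ 2) := by ring
          _ ≤ 3 * (k ^ 2 * (3 / 2 * L) ^ 2) := by gcongr
          _ = 27 / 4 / (43 / 100) ^ 2 * L ^ 2 * ((43 / 100) ^ 2 * k ^ 2) := by ring
          _ ≤ 27 / 4 / (43 / 100) ^ 2 * L ^ 2 * (L ^ 2 * R) := by gcongr
          _ ≤ _ := by
              have : 0 ≤ L ^ 4 * R := by positivity
              ring_nf; linarith
      exact le_of_mul_le_mul_right this hR0
    · have hca0 : 0 ≤ (c : ℝ) - a := by linarith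
      have hq : (c : ℝ) - a ≤ R ^ (1 / 3 : ℝ) / 5 := hca'.trans hY1
      have h1 : 43 / R * ((c : ℝ) - a) ^ 3 / 8 ≤ 43 / 1000 := by
        calc _ ≤ 43 / R * (R ^ (1 / 3 : ℝ) / 5) ^ 3 / 8 := by gcongr
          _ = 43 / R * (R ^ (1 / 3 : ℝ)) ^ 3 / 1000 := by ring
          _ = 43 / R * R / 1000 := by
              rw [← Real.rpow_natCast, ← Real.rpow_mul hR0.le]; norm_num
          _ = _ := by field_simp
      have h2 : 2 * (18 * t) * ((c : ℝ) - a) ≤ 8 / 10 := by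
        have e : t * R ^ (1 / 3 : ℝ) ≤ 1 / 10 := by
          rw [ht, ← Real.rpow_add hR0]
          calc _ ≤ R ^ (-(1 / 20) : ℝ) := Real.rpow_le_rpow_of_exponent_le hR1 (by norm_num)
            _ = (R ^ (1 / 20 : ℝ))⁻¹ := Real.rpow_neg hR0.le _
            _ ≤ (10)⁻¹ := by
                have := hten (1 / 20) (by norm_num)
                rw [← Real.rpow_mul (by norm_num)] at this
                norm_num at this
                gcongr
            _ = _ := by norm_num
        calc _ ≤ 2 * (18 * t) * (R ^ (1 / 3 : ℝ) / 5) := by gcongr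
          _ = 36 / 5 * (t * R ^ (1 / 3 : ℝ)) := by ring
          _ ≤ _ := by linarith
      linarith)
  have hsqZ : √(18 * t * R) ≤ 5 * R ^ (275 / 1000 : ℝ) := by
    rw [Real.sqrt_le_iff]
    refine ⟨by positivity, ?_⟩
    have e : t * R = (R ^ (275 / 1000 : ℝ)) ^ 2 := by
      rw [ht, ← Real.rpow_add_one hR0.ne', ← Real.rpow_natCast, ← Real.rpow_mul hR0.le]; norm_num
    calc 18 * t * R = 18 * (t * R) := by ring
      _ ≤ 25 * (t * R) := by gcongr; norm_num
      _ = _ := by rw [e]; ring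
  have hN : (⌊R⌋₊ : ℝ) / Y + 1 ≤ 11 * R ^ (2 / 3 : ℝ) := by
    have h1 : (⌊R⌋₊ : ℝ) ≤ R := Nat.floor_le hR0.le
    have h2 : (1 : ℝ) ≤ R ^ (2 / 3 : ℝ) := Real.one_le_rpow hR1 (by norm_num)
    have h3 : (⌊R⌋₊ : ℝ) / Y ≤ R / (R ^ (1 / 3 : ℝ) / 10) := by gcongr
    have h4 : R / (R ^ (1 / 3 : ℝ) / 10) = 10 * R ^ (2 / 3 : ℝ) := by
      rw [show (2 / 3 : ℝ) = 1 - 1 / 3 by norm_num, Real.rpow_sub hR0, Real.rpow_one]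
      field_simp
    linarith
  have h1 : (1 : ℝ) ≤ R ^ (275 / 1000 : ℝ) := Real.one_le_rpow hR1 (by norm_num)
  calc (F.card : ℝ) ≤ _ := hwin
    _ ≤ (11 * R ^ (2 / 3 : ℝ)) * (13 * R ^ (275 / 1000 : ℝ)) := by
        gcongr; linarith
    _ = 143 * R ^ (2 / 3 + 275 / 1000 : ℝ) := by rw [Real.rpow_add hR0]; ring
    _ ≤ _ := by
        gcongr
        norm_num

/-! ### Close pairs of frequencies in the product of a sum and a differenced sum -/

/-- The closeness δ = R^{-1.95} lies below the spacing, at least R^{-3/2}/12, of the differences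
√(n+h) − √n. It is still larger than R^{-2}, so the Gaussian tail at X ≥ R² is negligible. -/
lemma rpow_neg_mul_le {R : ℝ} (hR : (10 : ℝ) ^ 20 ≤ R) :
    R ^ (-(195 / 100) : ℝ) * (R * √R) ≤ 1 / 100 := by
  have hR1 : 1 ≤ R := le_trans (by norm_num) hR
  have hR0 : 0 < R := by linarith
  have h1 : R * √R = R ^ (3 / 2 : ℝ) := by
    rw [Real.sqrt_eq_rpow, ← Real.rpow_one_add' hR0.le (by norm_num)]; norm_num
  rw [h1, ← Real.rpow_add hR0]
  calc _ ≤ R ^ (-(1 / 10) : ℝ) := Real.rpow_le_rpow_of_exponent_le hR1 (by norm_num)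
    _ = (R ^ (1 / 10 : ℝ))⁻¹ := Real.rpow_neg hR0.le _
    _ ≤ (100)⁻¹ := by
        have : ((10 : ℝ) ^ (20 : ℝ)) ^ (1 / 10 : ℝ) ≤ R ^ (1 / 10 : ℝ) := by
          apply Real.rpow_le_rpow (by positivity) _ (by norm_num)
          exact_mod_cast hR
        rw [← Real.rpow_mul (by norm_num)] at this
        norm_num at this
        gcongr
    _ = _ := by norm_num

/-- The frequencies of the product of a sum with its `h`-th difference. -/
noncomputable def diffFreq (h : ℕ) (p : ℕ × ℕ) : ℝ :=
  √(p.1 : ℝ) + (√((p.2 + h : ℕ) : ℝ) - √(p.2 : ℝ))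

section
variable {R : ℝ} {s : Finset ℕ} {h : ℕ}

lemma inv_le_sqrt_sub (hR0 : 0 < R) (hs : ∀ n ∈ s, R ≤ n ∧ (n : ℝ) ≤ 5 / 4 * R) {a b : ℕ}
    (ha : a ∈ s) (hb : b ∈ s) (hab : b < a) : 4 / 9 ≤ (√(a : ℝ) - √(b : ℝ)) * √R := by
  have h1 : (b : ℝ) + 1 ≤ a := by exact_mod_cast hab
  have := (sqrt_sub_bounds hR0 (hs b hb).1 (show 0 ≤ (a : ℝ) - b by linarith)
    (by linarith [(hs a ha).2])).1
  rw [add_sub_cancel] at this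
  linarith

lemma diff_sqrt_gap (hR0 : 0 < R) (hs : ∀ n ∈ s, R ≤ n ∧ (n : ℝ) ≤ 5 / 4 * R) (hh : 1 ≤ h)
    {m n : ℕ} (hm : m ∈ s) (hn : n + h ∈ s) (hmn : m < n) :
    1 / 12 ≤ ((√((m + h : ℕ) : ℝ) - √(m : ℝ)) - (√((n + h : ℕ) : ℝ) - √(n : ℝ))) * (R * √R) := by
  have h1 : (m : ℝ) + 1 ≤ n := by exact_mod_cast hmn
  have h2 : (1 : ℝ) ≤ h := by exact_mod_cast hh
  have hn' := (hs _ hn).2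
  push_cast at hn' ⊢
  have := (sqrt_mixed_bounds hR0 (hs m hm).1 (show (m : ℝ) ≤ n by linarith)
    (show 0 ≤ (h : ℝ) by linarith) hn').1
  have h3 : 1 ≤ (h : ℝ) * (n - m) := by nlinarith
  linarith

open Classical in
/-- Off-diagonal close pairs, ordered. -/
noncomputable def closeOff (R : ℝ) (s : Finset ℕ) (h : ℕ) : Finset ((ℕ × ℕ) × ℕ × ℕ) :=
  ((s ×ˢ s.filter fun n => n + h ∈ s) ×ˢ (s ×ˢ s.filter fun n => n + h ∈ s)).filter fun p =>
    p.2.1 < p.1.1 ∧ p.2.2 < p.1.2 ∧ |diffFreq h p.1 - diffFreq h p.2| ≤ R ^ (-(195 / 100) : ℝ)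

/-- Sort by the increments j of the second coordinate and k of the first. Here j ≤ R, while k ≤
2R^{0.27} because the mixed difference it must balance is at most h/(2√R). For fixed (j, k) the
second coordinate n is counted by `card_near_sqrtMix_le`, and n determines b, since the values
√(b+k) − √b are more than 2δ apart. Altogether R · 2R^{0.27} · 143R^{0.95}. -/
lemma card_closeOff_le (hR : (10 : ℝ) ^ 20 ≤ R)
    (hs : ∀ n ∈ s, R ≤ n ∧ (n : ℝ) ≤ 5 / 4 * R) (hh : 1 ≤ h)
    (hh' : (h : ℝ) ≤ R ^ (27 / 100 : ℝ)) :
    ((closeOff R s h).card : ℝ) ≤ 286 * R ^ (222 / 100 : ℝ) := by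
  classical
  have hR1 : 1 ≤ R := le_trans (by norm_num) hR
  have hR0 : 0 < R := by linarith
  have hr : 0 < √R := Real.sqrt_pos.2 hR0
  have hδ := rpow_neg_mul_le hR
  set δ := R ^ (-(195 / 100) : ℝ) with hδdef
  have hδ0 : 0 < δ := by positivity
  have hδr : δ * √R ≤ 1 / 100 := by
    refine le_trans ?_ hδ
    gcongr
    nlinarith
  have hh1 : (1 : ℝ) ≤ h := by exact_mod_cast hh
  set J := Finset.Icc 1 ⌊R⌋₊ ×ˢ Finset.Icc 1 ⌊2 * R ^ (27 / 100 : ℝ)⌋₊ with hJ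
  have hmem : ∀ p ∈ closeOff R s h, p.1.1 ∈ s ∧ p.1.2 ∈ s ∧ p.1.2 + h ∈ s ∧ p.2.1 ∈ s ∧ p.2.2 ∈ s ∧
      p.2.1 < p.1.1 ∧ p.2.2 < p.1.2 ∧
      |sqrtMix h (p.1.2 - p.2.2 : ℕ) p.2.2 -
        (√((p.2.1 : ℝ) + (p.1.1 - p.2.1 : ℕ)) - √(p.2.1 : ℝ))| ≤ δ := by
    intro p hp
    simp only [closeOff, Finset.mem_filter, Finset.mem_product] at hp
    obtain ⟨⟨⟨h1, h2, h3⟩, h4, h5, h6⟩, h7, h8, h9⟩ := hp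
    refine ⟨h1, h2, h3, h4, h5, h7, h8, ?_⟩
    rw [abs_sub_comm]
    convert h9 using 2
    rw [sqrtMix_eq, Nat.cast_sub h8.le, Nat.cast_sub h7.le]
    simp only [diffFreq]
    push_cast
    rw [add_sub_cancel, add_sub_cancel]
    ring
  have hmaps : ∀ p ∈ closeOff R s h, (p.1.2 - p.2.2, p.1.1 - p.2.1) ∈ J := by
    intro p hp
    obtain ⟨h1, h2, h3, h4, h5, h7, h8, h9⟩ := hmem p hp
    rw [hJ, Finset.mem_product, Finset.mem_Icc, Finset.mem_Icc]
    refine ⟨⟨by simp only; omega, Nat.le_floor ?_⟩, by simp only; omega, Nat.le_floor ?_⟩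
    · rw [Nat.cast_sub h8.le]
      linarith [(hs _ h2).2, (hs _ h5).1]
    · have e1 : (p.2.1 : ℝ) + (p.1.1 - p.2.1 : ℕ) = p.1.1 := by
        rw [Nat.cast_sub h7.le]; ring
      have e2 := (sqrt_sub_bounds hR0 (hs _ h4).1 (Nat.cast_nonneg (p.1.1 - p.2.1))
        (by rw [e1]; exact (hs _ h1).2)).1
      have e3 : sqrtMix h (p.1.2 - p.2.2 : ℕ) p.2.2 * √R ≤ h / 2 := by
        have hn := (hs _ h3).2
        push_cast at hn
        have hlt : (p.2.2 : ℝ) < p.1.2 := by exact_mod_cast h8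
        have e4 := (sqrt_sub_bounds hR0 (hs _ h5).1 (show (0 : ℝ) ≤ h by linarith)
          (by linarith)).2
        refine le_trans (mul_le_mul_of_nonneg_right ?_ hr.le) e4
        rw [sqrtMix_eq]
        have := Real.sqrt_le_sqrt (show (p.2.2 : ℝ) + (p.1.2 - p.2.2 : ℕ) ≤
          (p.2.2 : ℝ) + (p.1.2 - p.2.2 : ℕ) + h by linarith)
        linarith
      have e5 := mul_le_mul_of_nonneg_right (abs_le.1 h9).1 hr.le
      linarith
  have hfib : ∀ q ∈ J, (((closeOff R s h).filter fun p => (p.1.2 - p.2.2, p.1.1 - p.2.1) = q).card : ℝ)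
      ≤ 143 * R ^ (95 / 100 : ℝ) := by
    rintro ⟨j, k⟩ hq
    rw [hJ, Finset.mem_product, Finset.mem_Icc, Finset.mem_Icc] at hq
    obtain ⟨⟨hj1, -⟩, hk1, hk2⟩ := hq
    have hk2 : (k : ℝ) ≤ 2 * R ^ (27 / 100 : ℝ) := (Nat.le_floor_iff (by positivity)).1 hk2
    have hk1' : (1 : ℝ) ≤ k := by exact_mod_cast hk1
    set Q := (closeOff R s h).filter fun p => (p.1.2 - p.2.2, p.1.1 - p.2.1) = (j, k) with hQ
    have hQm : ∀ p ∈ Q, p.2.1 ∈ s ∧ p.2.2 ∈ s ∧ (p.2.2 : ℝ) + h + j ≤ 5 / 4 * R ∧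
        (p.2.1 : ℝ) + k ≤ 5 / 4 * R ∧ p.1.1 = p.2.1 + k ∧ p.1.2 = p.2.2 + j ∧
        |sqrtMix h j p.2.2 - (√((p.2.1 : ℝ) + k) - √(p.2.1 : ℝ))| ≤ δ := by
      intro p hp
      rw [hQ, Finset.mem_filter] at hp
      obtain ⟨hp, hp2⟩ := hp
      obtain ⟨h1, h2, h3, h4, h5, h7, h8, h9⟩ := hmem p hp
      rw [Prod.mk.injEq] at hp2
      rw [hp2.1, hp2.2] at h9
      have e1 : p.1.1 = p.2.1 + k := by omega
      have e2 : p.1.2 = p.2.2 + j := by omega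
      have n1 := (hs _ h1).2
      have n3 := (hs _ h3).2
      rw [e1] at n1
      rw [e2] at n3
      push_cast at n1 n3
      exact ⟨h4, h5, by linarith, n1, e1, e2, h9⟩
    have hinj : Set.InjOn (fun p : (ℕ × ℕ) × ℕ × ℕ => p.2.2) Q := by
      intro p hp p' hp' hpp
      obtain ⟨g1, g2, g3, g4, g5, g6, g7⟩ := hQm p hp
      obtain ⟨f1, f2, f3, f4, f5, f6, f7⟩ := hQm p' hp'
      simp only at hpp
      rw [← hpp] at f7
      have key : ∀ b b' : ℕ, b ∈ s → b' ∈ s → (b' : ℝ) + k ≤ 5 / 4 * R → b < b' →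
          |(√((b : ℝ) + k) - √(b : ℝ)) - (√((b' : ℝ) + k) - √(b' : ℝ))| ≤ 2 * δ → False := by
        intro b b' hb hb' hbk hlt hle
        have h1 : (b : ℝ) + 1 ≤ b' := by exact_mod_cast hlt
        have := (sqrt_mixed_bounds hR0 (hs b hb).1 (show (b : ℝ) ≤ b' by linarith)
          (show 0 ≤ (k : ℝ) by linarith) hbk).1
        have h3 : 1 ≤ (k : ℝ) * (b' - b) := by nlinarith
        have h4 := mul_le_mul_of_nonneg_right (abs_le.1 hle).2 (show 0 ≤ R * √R by positivity)
        linarith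
      have hbb : p.2.1 = p'.2.1 := by
        have c1 := abs_le.1 g7
        have c2 := abs_le.1 f7
        rcases lt_trichotomy p.2.1 p'.2.1 with hlt | heq | hlt
        · exact (key _ _ g1 f1 f4 hlt (abs_le.2 ⟨by linarith, by linarith⟩)).elim
        · exact heq
        · exact (key _ _ f1 g1 g4 hlt (abs_le.2 ⟨by linarith, by linarith⟩)).elim
      refine Prod.ext (Prod.ext ?_ ?_) (Prod.ext hbb hpp) <;> omega
    have := card_near_sqrtMix_le hR (h := h) (j := j) hk1 hk2 (Q.image fun p => p.2.2) (by
      intro n hn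
      obtain ⟨p, hp, rfl⟩ := Finset.mem_image.1 hn
      obtain ⟨g1, g2, g3, g4, g5, g6, g7⟩ := hQm p hp
      exact ⟨(hs _ g2).1, g3, p.2.1, (hs _ g1).1, g4, g7⟩)
    rwa [Finset.card_image_of_injOn hinj] at this
  rw [Finset.card_eq_sum_card_fiberwise (t := J) hmaps]
  push_cast
  calc _ ≤ ∑ q ∈ J, 143 * R ^ (95 / 100 : ℝ) := Finset.sum_le_sum hfib
    _ = (⌊R⌋₊ * ⌊2 * R ^ (27 / 100 : ℝ)⌋₊ : ℝ) * (143 * R ^ (95 / 100 : ℝ)) := by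
        rw [Finset.sum_const, hJ, Finset.card_product, Nat.card_Icc, Nat.card_Icc, nsmul_eq_mul]
        push_cast; simp
    _ ≤ (R * (2 * R ^ (27 / 100 : ℝ))) * (143 * R ^ (95 / 100 : ℝ)) := by
        gcongr
        · exact Nat.floor_le hR0.le
        · exact Nat.floor_le (by positivity)
    _ = 286 * (R ^ (1 : ℝ) * R ^ (27 / 100 : ℝ) * R ^ (95 / 100 : ℝ)) := by
        rw [Real.rpow_one]; ring
    _ = _ := by rw [← Real.rpow_add hR0, ← Real.rpow_add hR0]; norm_num

-- A difference of the first coordinates moves the frequency by at least 4/(9√R), far more than δ.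
-- As √(n+h) − √n decreases in n, it can only be compensated by a difference of the second
-- coordinates of the same sign. Equal first coordinates force equal second ones, so every close
-- pair is diagonal or lies, up to a swap, in `closeOff`; 576 = 4 + 2·286.
open Classical in
lemma card_close_diffFreq_le (hR : (10 : ℝ) ^ 20 ≤ R)
    (hs : ∀ n ∈ s, R ≤ n ∧ (n : ℝ) ≤ 5 / 4 * R) (hh : 1 ≤ h)
    (hh' : (h : ℝ) ≤ R ^ (27 / 100 : ℝ)) :
    ((((s ×ˢ s.filter fun n => n + h ∈ s) ×ˢ (s ×ˢ s.filter fun n => n + h ∈ s)).filter fun p =>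
      |diffFreq h p.1 - diffFreq h p.2| ≤ R ^ (-(195 / 100) : ℝ)).card : ℝ) ≤
        576 * R ^ (222 / 100 : ℝ) := by
  have hR1 : 1 ≤ R := le_trans (by norm_num) hR
  have hR0 : 0 < R := by linarith
  have hr : 0 < √R := Real.sqrt_pos.2 hR0
  have hδ := rpow_neg_mul_le hR
  set δ := R ^ (-(195 / 100) : ℝ) with hδdef
  have hδ0 : 0 < δ := by positivity
  have hδr : δ * √R ≤ 1 / 100 := by
    refine le_trans ?_ hδ
    gcongr
    nlinarith
  set P := s ×ˢ s.filter fun n => n + h ∈ s with hP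
  have hsub : (P ×ˢ P).filter (fun p => |diffFreq h p.1 - diffFreq h p.2| ≤ δ) ⊆
      P.image (fun p => (p, p)) ∪ (closeOff R s h ∪ (closeOff R s h).image Prod.swap) := by
    intro p hp
    rw [Finset.mem_filter, Finset.mem_product] at hp
    obtain ⟨⟨h1, h2⟩, h3⟩ := hp
    have h1' := h1
    have h2' := h2
    rw [hP, Finset.mem_product, Finset.mem_filter] at h1' h2'
    obtain ⟨a1, a2, a3⟩ := h1'
    obtain ⟨b1, b2, b3⟩ := h2'
    have key : ∀ x y : ℕ × ℕ, x ∈ P → y ∈ P → |diffFreq h x - diffFreq h y| ≤ δ → y.1 < x.1 →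
        (x, y) ∈ closeOff R s h := by
      intro x y hx hy hxy hlt
      have hx' := hx
      have hy' := hy
      rw [hP, Finset.mem_product, Finset.mem_filter] at hx' hy'
      obtain ⟨c1, c2, c3⟩ := hx'
      obtain ⟨d1, d2, d3⟩ := hy'
      rw [closeOff, Finset.mem_filter, Finset.mem_product]
      refine ⟨⟨hx, hy⟩, hlt, ?_, hxy⟩
      by_contra hcon
      have g1 := inv_le_sqrt_sub hR0 hs c1 d1 hlt
      have g2 := mul_le_mul_of_nonneg_right (abs_le.1 hxy).2 hr.le
      have g3 : 0 ≤ (√((x.2 + h : ℕ) : ℝ) - √(x.2 : ℝ)) - (√((y.2 + h : ℕ) : ℝ) - √(y.2 : ℝ)) := by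
        rcases (not_lt.1 hcon).eq_or_lt with heq | hlt'
        · rw [heq]; simp
        · have := diff_sqrt_gap hR0 hs hh c2 d3 hlt'
          by_contra hneg
          have : ((√((x.2 + h : ℕ) : ℝ) - √(x.2 : ℝ)) - (√((y.2 + h : ℕ) : ℝ) - √(y.2 : ℝ))) *
            (R * √R) ≤ 0 := mul_nonpos_of_nonpos_of_nonneg (not_le.1 hneg).le (by positivity)
          linarith
      have g4 := mul_nonneg g3 hr.le
      simp only [diffFreq] at g2
      linarith
    rw [Finset.mem_union, Finset.mem_union]
    rcases lt_trichotomy p.2.1 p.1.1 with hlt | heq | hlt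
    · exact Or.inr (Or.inl (key p.1 p.2 h1 h2 h3 hlt))
    · refine Or.inl (Finset.mem_image.2 ⟨p.1, h1, Prod.ext rfl (Prod.ext heq.symm ?_)⟩)
      have key2 : ∀ m n : ℕ, m ∈ s → n + h ∈ s → m < n →
          |(√((m + h : ℕ) : ℝ) - √(m : ℝ)) - (√((n + h : ℕ) : ℝ) - √(n : ℝ))| ≤ δ → False := by
        intro m n hm hn hmn hle
        have g1 := diff_sqrt_gap hR0 hs hh hm hn hmn
        have g2 := mul_le_mul_of_nonneg_right (abs_le.1 hle).2 (show 0 ≤ R * √R by positivity)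
        linarith
      simp only [diffFreq, heq, add_sub_add_left_eq_sub] at h3
      rcases lt_trichotomy p.1.2 p.2.2 with hlt' | heq' | hlt'
      · exact (key2 _ _ a2 b3 hlt' h3).elim
      · exact heq'
      · rw [abs_sub_comm] at h3
        exact (key2 _ _ b2 a3 hlt' h3).elim
    · rw [abs_sub_comm] at h3
      exact Or.inr (Or.inr (Finset.mem_image.2 ⟨(p.2, p.1), key p.2 p.1 h2 h1 h3 hlt, rfl⟩))
  have hcard := card_le_two_mul hR1 hs
  have hcardP : (P.card : ℝ) ≤ 4 * R ^ (222 / 100 : ℝ) := by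
    rw [hP, Finset.card_product]
    push_cast
    have : ((s.filter fun n => n + h ∈ s).card : ℝ) ≤ s.card := by
      exact_mod_cast Finset.card_le_card (Finset.filter_subset _ _)
    calc _ ≤ (2 * R) * (2 * R) := by gcongr; exact this.trans hcard
      _ = 4 * R ^ (2 : ℝ) := by rw [Real.rpow_two]; ring
      _ ≤ _ := by gcongr; norm_num
  have hoff := card_closeOff_le hR hs hh hh'
  have hc : (((P ×ˢ P).filter (fun p => |diffFreq h p.1 - diffFreq h p.2| ≤ δ)).card : ℝ) ≤
      P.card + ((closeOff R s h).card + (closeOff R s h).card) := by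
    have h1 := (Finset.card_le_card hsub).trans (Finset.card_union_le _ _)
    have h2 := Finset.card_union_le (closeOff R s h) ((closeOff R s h).image Prod.swap)
    have h3 := Finset.card_image_le (s := closeOff R s h) (f := Prod.swap)
    have h4 := Finset.card_image_le (s := P) (f := fun p => (p, p))
    exact_mod_cast (by omega : _ ≤ P.card + ((closeOff R s h).card + (closeOff R s h).card))
  linarith

end

/-! ### The sixth moment -/

lemma sqrtSum_mul_diffSum (s : Finset ℕ) (c : ℕ → ℂ) (h : ℕ) (v : ℝ) :
    sqrtSum s c v * diffSum s c h v =
      expSum (s ×ˢ s.filter fun n => n + h ∈ s)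
        (fun p => c p.1 * (c (p.2 + h) * (starRingEnd ℂ) (c p.2))) (diffFreq h) v := by
  rw [sqrtSum, diffSum, expSum_mul]; rfl

/-- The mean square of the product of a sum and its `h`-th difference. -/
lemma exists_integral_sqrtSum_mul_diffSum_le : ∃ C : ℝ, 0 < C ∧
    ∀ R : ℝ, (10 : ℝ) ^ 20 ≤ R → ∀ s : Finset ℕ, (∀ n ∈ s, R ≤ n ∧ (n : ℝ) ≤ 5 / 4 * R) →
    ∀ c : ℕ → ℂ, (∀ n ∈ s, ‖c n‖ ≤ 1) → ∀ X : ℝ, R ^ 2 ≤ X → ∀ h : ℕ, 1 ≤ h →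
    (h : ℝ) ≤ R ^ (27 / 100 : ℝ) →
    ∫ v, ‖sqrtSum s c v‖ ^ 2 * ‖diffSum s c h v‖ ^ 2 ∂(gmean X) ≤ C * R ^ (222 / 100 : ℝ) := by
  classical
  obtain ⟨C₂, hC₂, htail⟩ := exists_rpow_mul_exp_neg_le 4 (κ := 1 / 10) (by norm_num)
  refine ⟨576 + 16 * C₂, by positivity, fun R hR s hs c hc X hX h hh hh' => ?_⟩
  have hR1 : 1 ≤ R := le_trans (by norm_num) hR
  have hR0 : 0 < R := by linarith
  simp_rw [← mul_pow, ← norm_mul, sqrtSum_mul_diffSum]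
  set P := s ×ˢ s.filter fun n => n + h ∈ s with hP
  have h1 := integral_normSq_expSum_le_card P
    (fun p => c p.1 * (c (p.2 + h) * (starRingEnd ℂ) (c p.2))) (diffFreq h) (fun p hp => by
      rw [hP, Finset.mem_product, Finset.mem_filter] at hp
      rw [norm_mul, norm_mul, RCLike.norm_conj]
      exact mul_le_one₀ (hc _ hp.1) (by positivity)
        (mul_le_one₀ (hc _ hp.2.2) (norm_nonneg _) (hc _ hp.2.1))) X
    (δ := R ^ (-(195 / 100) : ℝ)) (by positivity)
  have h2 := card_close_diffFreq_le hR hs hh hh'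
  have h3 : (P.card : ℝ) ≤ 4 * R ^ 2 := by
    rw [hP, Finset.card_product]
    push_cast
    have : ((s.filter fun n => n + h ∈ s).card : ℝ) ≤ s.card := by
      exact_mod_cast Finset.card_le_card (Finset.filter_subset _ _)
    have hcard := card_le_two_mul hR1 hs
    calc _ ≤ (2 * R) * (2 * R) := by gcongr; exact this.trans hcard
      _ = _ := by ring
  -- Xδ ≥ R^{0.05}, so the Gaussian tail is smaller than any power of R.
  have h4 : R ^ (1 / 10 : ℝ) ≤ (X * R ^ (-(195 / 100) : ℝ)) ^ 2 := by
    calc R ^ (1 / 10 : ℝ) = (R ^ (2 : ℝ) * R ^ (-(195 / 100) : ℝ)) ^ 2 := by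
          rw [← Real.rpow_add hR0, ← Real.rpow_natCast, ← Real.rpow_mul hR0.le]; norm_num
      _ ≤ _ := by rw [Real.rpow_two]; gcongr
  have h5 : (P.card : ℝ) ^ 2 * Real.exp (-(X * R ^ (-(195 / 100) : ℝ)) ^ 2 / 4) ≤ 16 * C₂ := by
    have h6 := htail R hR1
    calc _ ≤ (4 * R ^ 2) ^ 2 * Real.exp (-(R ^ (1 / 10 : ℝ)) / 4) := by gcongr
      _ = 16 * (R ^ (4 : ℝ) * Real.exp (-(R ^ (1 / 10 : ℝ)) / 4)) := by
          rw [show (4 : ℝ) = ((4 : ℕ) : ℝ) by norm_num, Real.rpow_natCast]; push_cast; ring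
      _ ≤ _ := by gcongr
  have h6 : 1 ≤ R ^ (222 / 100 : ℝ) := Real.one_le_rpow hR1 (by norm_num)
  calc _ ≤ 576 * R ^ (222 / 100 : ℝ) + 16 * C₂ * 1 := by rw [mul_one]; exact h1.trans (add_le_add h2 h5)
    _ ≤ 576 * R ^ (222 / 100 : ℝ) + 16 * C₂ * R ^ (222 / 100 : ℝ) := by gcongr
    _ = _ := by ring

/-- The differencing inequality for the sixth power. -/
lemma normPow_six_le_of_vanDerCorput {R : ℝ} (hR : (10 : ℝ) ^ 20 ≤ R) {s : Finset ℕ}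
    (hs : ∀ n ∈ s, R ≤ n ∧ (n : ℝ) ≤ 5 / 4 * R) {c : ℕ → ℂ} (hc : ∀ n ∈ s, ‖c n‖ ≤ 1) {H : ℕ}
    (hH : 0 < H) (hHR : (H : ℝ) ≤ R) (v : ℝ) :
    H * ‖sqrtSum s c v‖ ^ 6 ≤ 8 * R ^ 2 * ‖sqrtSum s c v‖ ^ 4 +
      16 * R ^ 2 * ∑ h ∈ Finset.Ico 1 H, ‖sqrtSum s c v‖ ^ 2 * ‖diffSum s c h v‖ ^ 2 := by
  have hR1 : 1 ≤ R := le_trans (by norm_num) hR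
  have hR10 : 10 ≤ R := le_trans (by norm_num) hR
  have hR0 : 0 < R := by linarith
  have hcard := card_le_two_mul hR1 hs
  have hsub : s ⊆ Finset.Ico ⌈R⌉₊ (⌈R⌉₊ + ⌊R⌋₊) := by
    intro n hn
    obtain ⟨h1, h2⟩ := hs n hn
    rw [Finset.mem_Ico]
    refine ⟨Nat.ceil_le.2 h1, ?_⟩
    have := Nat.le_ceil R
    have := Nat.lt_floor_add_one R
    have : (n : ℝ) < ⌈R⌉₊ + ⌊R⌋₊ := by linarith
    exact_mod_cast this
  have hv := vanDerCorput s c hH hsub hc v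
  set S := ‖sqrtSum s c v‖
  have hS : 0 ≤ S := norm_nonneg _
  have h1 : (H : ℝ) * S ^ 2 ≤ (2 * R) * (2 * R + 2 * ∑ h ∈ Finset.Ico 1 H, ‖diffSum s c h v‖) := by
    refine hv.trans ?_
    have h0 : 0 ≤ ∑ h ∈ Finset.Ico 1 H, ‖diffSum s c h v‖ :=
      Finset.sum_nonneg fun _ _ => norm_nonneg _
    have := Nat.floor_le hR0.le
    gcongr
    linarith
  -- By AM–GM, 4R S⁴|D_h| ≤ S⁶/2 + 8R²S²|D_h|². The resulting H S⁶/2 is half of the left-hand side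
  -- and is absorbed there.
  have h2 : 4 * R * ∑ h ∈ Finset.Ico 1 H, S ^ 4 * ‖diffSum s c h v‖ ≤
      H / 2 * S ^ 6 + 8 * R ^ 2 * ∑ h ∈ Finset.Ico 1 H, S ^ 2 * ‖diffSum s c h v‖ ^ 2 := by
    rw [Finset.mul_sum, Finset.mul_sum]
    have : ∀ h ∈ Finset.Ico 1 H, 4 * R * (S ^ 4 * ‖diffSum s c h v‖) ≤
        1 / 2 * S ^ 6 + 8 * R ^ 2 * (S ^ 2 * ‖diffSum s c h v‖ ^ 2) := by
      intro h _
      have := mul_nonneg (sq_nonneg S) (sq_nonneg (S ^ 2 - 4 * R * ‖diffSum s c h v‖))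
      nlinarith
    refine (Finset.sum_le_sum this).trans ?_
    rw [Finset.sum_add_distrib]
    gcongr
    rw [Finset.sum_const, nsmul_eq_mul, Nat.card_Ico, ← mul_assoc]
    gcongr
    have : ((H - 1 : ℕ) : ℝ) ≤ H := by exact_mod_cast Nat.sub_le H 1
    linarith
  have h3 : (H : ℝ) * S ^ 6 ≤ 4 * R ^ 2 * S ^ 4 +
      4 * R * ∑ h ∈ Finset.Ico 1 H, S ^ 4 * ‖diffSum s c h v‖ := by
    calc (H : ℝ) * S ^ 6 = S ^ 4 * (H * S ^ 2) := by ring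
      _ ≤ S ^ 4 * ((2 * R) * (2 * R + 2 * ∑ h ∈ Finset.Ico 1 H, ‖diffSum s c h v‖)) := by gcongr
      _ = _ := by rw [← Finset.mul_sum]; ring
  linarith

lemma bddCont_diffSum (s : Finset ℕ) (c : ℕ → ℂ) (h : ℕ) : BddCont (diffSum s c h) :=
  bddCont_expSum _ _ _

/-- The sixth moment of an exponential sum with square root frequencies. -/
theorem exists_sixth_moment_le {ε : ℝ} (hε : 0 < ε) : ∃ C : ℝ, 0 < C ∧
    ∀ R : ℝ, 1 ≤ R → ∀ s : Finset ℕ, (∀ n ∈ s, R ≤ n ∧ (n : ℝ) ≤ 5 / 4 * R) →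
    ∀ c : ℕ → ℂ, (∀ n ∈ s, ‖c n‖ ≤ 1) → ∀ X : ℝ, R ^ 2 ≤ X →
    ∫ v, ‖sqrtSum s c v‖ ^ 6 ∂(gmean X) ≤ C * X ^ ε * R ^ (423 / 100 : ℝ) := by
  obtain ⟨C₁, hC₁, hfour⟩ := exists_fourth_moment_le hε
  obtain ⟨C₂, hC₂, hmix⟩ := exists_integral_sqrtSum_mul_diffSum_le
  refine ⟨64 * (10 ^ 20) ^ 6 + 16 * C₁ + 16 * C₂, by positivity, fun R hR s hs c hc X hX => ?_⟩
  have hR0 : 0 < R := by linarith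
  have hX1 : 1 ≤ X := by nlinarith
  have hX0 : 0 < X := by linarith
  have hcard := card_le_two_mul hR hs
  have hXε : 1 ≤ X ^ ε := Real.one_le_rpow hX1 hε.le
  have hRp : 1 ≤ R ^ (423 / 100 : ℝ) := Real.one_le_rpow hR (by norm_num)
  rcases lt_or_ge R (10 ^ 20) with hsmall | hlarge
  · have h1 : ∫ v, ‖sqrtSum s c v‖ ^ 6 ∂(gmean X) ≤ ∫ v, (2 * R) ^ 6 ∂(gmean X) := by
      refine integral_mono (((bddCont_sqrtSum s c).norm.pow 6).integrable _)
        (integrable_const _) fun v => ?_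
      have := (norm_expSum_le s c (fun n => √(n : ℝ)) v hc).trans hcard
      simp only [sqrtSum]
      gcongr
    rw [integral_const, probReal_univ, one_smul] at h1
    calc _ ≤ (2 * R) ^ 6 := h1
      _ = 64 * R ^ 6 * 1 * 1 := by ring
      _ ≤ 64 * (10 ^ 20) ^ 6 * X ^ ε * R ^ (423 / 100 : ℝ) := by gcongr
      _ ≤ _ := by gcongr; linarith
  -- The choice H ≈ R^{0.27} nearly balances the two contributions: R²·R^{5/2}/H = R^{4.23} from the
  -- fourth moment and R²·R^{2.22} = R^{4.22} from the differenced sums.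
  · set ρ := R ^ (27 / 100 : ℝ) with hρ
    have hρ1 : 1 ≤ ρ := Real.one_le_rpow hR (by norm_num)
    set H := ⌈ρ⌉₊ with hH
    have hHpos : 0 < H := Nat.ceil_pos.2 (by linarith)
    have hH1 : ρ ≤ H := Nat.le_ceil _
    have hH0 : (0 : ℝ) < H := by linarith
    have hHR : (H : ℝ) ≤ R := by
      have h1 : (H : ℝ) < ρ + 1 := Nat.ceil_lt_add_one (by linarith)
      have h2 : ρ ≤ R ^ (1 / 2 : ℝ) := Real.rpow_le_rpow_of_exponent_le hR (by norm_num)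
      rw [← Real.sqrt_eq_rpow] at h2
      have h3 : √R * √R = R := Real.mul_self_sqrt hR0.le
      have h4 : 4 ≤ √R := Real.le_sqrt_of_sq_le (le_trans (by norm_num) hlarge)
      nlinarith
    have hb1 : BddCont fun v => ‖sqrtSum s c v‖ := (bddCont_sqrtSum s c).norm
    have hb2 : ∀ h, BddCont fun v => ‖sqrtSum s c v‖ ^ 2 * ‖diffSum s c h v‖ ^ 2 := fun h =>
      (hb1.pow 2).mul ((bddCont_diffSum s c h).norm.pow 2)
    have h1 : ∫ v, H * ‖sqrtSum s c v‖ ^ 6 ∂(gmean X) ≤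
        ∫ v, (8 * R ^ 2 * ‖sqrtSum s c v‖ ^ 4 +
          16 * R ^ 2 * ∑ h ∈ Finset.Ico 1 H, ‖sqrtSum s c v‖ ^ 2 * ‖diffSum s c h v‖ ^ 2)
          ∂(gmean X) :=
      integral_mono (((BddCont.const (H : ℝ)).mul (hb1.pow 6)).integrable _)
        ((((BddCont.const (8 * R ^ 2)).mul (hb1.pow 4)).add
          ((BddCont.const (16 * R ^ 2)).mul (BddCont.sum _ fun h _ => hb2 h))).integrable _)
        fun v => normPow_six_le_of_vanDerCorput hlarge hs hc hHpos hHR v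
    rw [integral_const_mul, integral_add
      (((BddCont.const (8 * R ^ 2)).mul (hb1.pow 4)).integrable _)
      (((BddCont.const (16 * R ^ 2)).mul (BddCont.sum _ fun h _ => hb2 h)).integrable _),
      integral_const_mul, integral_const_mul,
      integral_finsetSum _ fun h _ => (hb2 h).integrable _] at h1
    have h2 : ∑ h ∈ Finset.Ico 1 H, ∫ v, ‖sqrtSum s c v‖ ^ 2 * ‖diffSum s c h v‖ ^ 2 ∂(gmean X) ≤
        H * (C₂ * R ^ (222 / 100 : ℝ)) := by
      calc _ ≤ ∑ h ∈ Finset.Ico 1 H, C₂ * R ^ (222 / 100 : ℝ) := by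
            refine Finset.sum_le_sum fun h hh => ?_
            rw [Finset.mem_Ico] at hh
            exact hmix R hlarge s hs c hc X hX h hh.1 (Nat.lt_ceil.1 hh.2).le
        _ ≤ _ := by
            rw [Finset.sum_const, nsmul_eq_mul, Nat.card_Ico]
            gcongr
            exact Nat.sub_le _ _
    have h3 : ∫ v, ‖sqrtSum s c v‖ ^ 4 ∂(gmean X) ≤ C₁ * X ^ ε * (2 * R ^ (5 / 2 : ℝ)) := by
      refine (hfour R hR s hs c hc X hX).trans ?_
      have e1 : R ^ 4 * √R / X ≤ R ^ (5 / 2 : ℝ) := by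
        rw [div_le_iff₀ hX0]
        calc R ^ 4 * √R = R ^ 2 * (R ^ (2 : ℝ) * R ^ (1 / 2 : ℝ)) := by
              rw [Real.sqrt_eq_rpow, Real.rpow_two]; ring
          _ = R ^ (5 / 2 : ℝ) * R ^ 2 := by rw [← Real.rpow_add hR0, mul_comm]; norm_num
          _ ≤ _ := by gcongr
      have e2 : R ^ 2 ≤ R ^ (5 / 2 : ℝ) := by
        rw [← Real.rpow_two]
        exact Real.rpow_le_rpow_of_exponent_le hR (by norm_num)
      gcongr
      linarith
    have h4 : R ^ 2 * R ^ (5 / 2 : ℝ) = ρ * R ^ (423 / 100 : ℝ) := by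
      rw [← Real.rpow_two, ← Real.rpow_add hR0, hρ, ← Real.rpow_add hR0]; norm_num
    have h5 : R ^ 2 * R ^ (222 / 100 : ℝ) ≤ R ^ (423 / 100 : ℝ) := by
      rw [← Real.rpow_two, ← Real.rpow_add hR0]
      exact Real.rpow_le_rpow_of_exponent_le hR (by norm_num)
    have h6 : (H : ℝ) * ∫ v, ‖sqrtSum s c v‖ ^ 6 ∂(gmean X) ≤
        H * ((16 * C₁ + 16 * C₂) * X ^ ε * R ^ (423 / 100 : ℝ)) := by
      calc _ ≤ 8 * R ^ 2 * (C₁ * X ^ ε * (2 * R ^ (5 / 2 : ℝ))) +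
            16 * R ^ 2 * (H * (C₂ * R ^ (222 / 100 : ℝ))) := by
            refine h1.trans ?_
            gcongr
        _ = 16 * C₁ * X ^ ε * (R ^ 2 * R ^ (5 / 2 : ℝ)) +
            H * (16 * C₂ * 1 * (R ^ 2 * R ^ (222 / 100 : ℝ))) := by ring
        _ ≤ 16 * C₁ * X ^ ε * (H * R ^ (423 / 100 : ℝ)) +
            H * (16 * C₂ * X ^ ε * R ^ (423 / 100 : ℝ)) := by
            rw [h4]; gcongr
        _ = _ := by ring
    refine (le_of_mul_le_mul_left h6 hH0).trans ?_
    gcongr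
    linarith [show (0 : ℝ) ≤ 64 * (10 ^ 20) ^ 6 by positivity]

/-! ### Blocks and mixed moments -/

lemma BddCont.memLp {E : Type*} [NormedAddCommGroup E] {f : ℝ → E} (hf : BddCont f)
    (μ : Measure ℝ) [IsFiniteMeasure μ] (p : ENNReal) : MemLp f p μ := by
  obtain ⟨hc, C, hC⟩ := hf
  exact MemLp.of_bound hc.aestronglyMeasurable C (Filter.Eventually.of_forall hC)

lemma integral_mul_pow_le {μ : Measure ℝ} [IsFiniteMeasure μ] {f g : ℝ → ℝ} (hf : BddCont f)
    (hg : BddCont g) (hf0 : ∀ v, 0 ≤ f v) (hg0 : ∀ v, 0 ≤ g v) {n : ℕ} (hn : 1 ≤ n) {A B : ℝ}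
    (hA : ∫ v, f v ^ (n + 1) ∂μ ≤ A) (hB : ∫ v, g v ^ (n + 1) ∂μ ≤ B) :
    ∫ v, f v * g v ^ n ∂μ ≤ A ^ (1 / ((n : ℝ) + 1)) * B ^ ((n : ℝ) / (n + 1)) := by
  have hn0 : (0 : ℝ) < n := by exact_mod_cast hn
  have hpq : Real.HolderConjugate ((n : ℝ) + 1) (((n : ℝ) + 1) / n) := by
    rw [Real.holderConjugate_iff]
    refine ⟨by linarith, ?_⟩
    field_simp
    ring
  have := integral_mul_le_Lp_mul_Lq_of_nonneg (μ := μ) hpq (f := f) (g := fun v => g v ^ n)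
    (Filter.Eventually.of_forall hf0) (Filter.Eventually.of_forall fun v => pow_nonneg (hg0 v) n)
    (hf.memLp _ _) ((hg.pow n).memLp _ _)
  refine this.trans ?_
  have e1 : ∀ v, f v ^ ((n : ℝ) + 1) = f v ^ (n + 1) := fun v => by
    rw [← Real.rpow_natCast]; push_cast; rfl
  have e2 : ∀ v, (g v ^ n) ^ (((n : ℝ) + 1) / n) = g v ^ (n + 1) := fun v => by
    rw [← Real.rpow_natCast, ← Real.rpow_mul (hg0 v), mul_div_cancel₀ _ hn0.ne',
      ← Real.rpow_natCast]; push_cast; rfl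
  simp_rw [e1, e2]
  have h0 : 0 ≤ ∫ v, f v ^ (n + 1) ∂μ := integral_nonneg fun v => pow_nonneg (hf0 v) _
  have h1 : 0 ≤ ∫ v, g v ^ (n + 1) ∂μ := integral_nonneg fun v => pow_nonneg (hg0 v) _
  rw [one_div_div]
  have hA0 : 0 ≤ A := h0.trans hA
  gcongr

/-- The coefficients `d(n) / n^{3/4}`. -/
noncomputable def divCoeff (n : ℕ) : ℝ := divisorFn n / (n : ℝ) ^ (3 / 4 : ℝ)

lemma divCoeff_nonneg (n : ℕ) : 0 ≤ divCoeff n := by unfold divCoeff divisorFn; positivity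

lemma divCoeff_zero : divCoeff 0 = 0 := by simp [divCoeff, divisorFn]

/-- The left end points of the blocks. -/
noncomputable def blkStart (k : ℕ) : ℕ := ⌈(5 / 4 : ℝ) ^ k⌉₊

/-- The integers in `[(5/4)^k, (5/4)^(k+1))`. -/
noncomputable def blk (k : ℕ) : Finset ℕ := Finset.Ico (blkStart k) (blkStart (k + 1))

/-- The positive integers below `(5/4)^k`. -/
noncomputable def cum (k : ℕ) : Finset ℕ := Finset.Ico 1 (blkStart k)

lemma mem_blk {k n : ℕ} : n ∈ blk k ↔ (5 / 4 : ℝ) ^ k ≤ n ∧ (n : ℝ) < (5 / 4 : ℝ) ^ (k + 1) := by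
  rw [blk, Finset.mem_Ico, blkStart, blkStart, Nat.ceil_le, Nat.lt_ceil]

lemma mem_cum {k n : ℕ} : n ∈ cum k ↔ 1 ≤ n ∧ (n : ℝ) < (5 / 4 : ℝ) ^ k := by
  rw [cum, Finset.mem_Ico, blkStart, Nat.lt_ceil]

lemma blkStart_mono : Monotone blkStart := fun a b hab =>
  Nat.ceil_mono (pow_le_pow_right₀ (by norm_num) hab)

lemma one_le_blkStart (k : ℕ) : 1 ≤ blkStart k :=
  Nat.ceil_pos.2 (by positivity)

lemma blk_le {k n : ℕ} (h : n ∈ blk k) :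
    (5 / 4 : ℝ) ^ k ≤ n ∧ (n : ℝ) ≤ 5 / 4 * (5 / 4 : ℝ) ^ k := by
  rw [mem_blk] at h
  exact ⟨h.1, by rw [← pow_succ']; exact h.2.le⟩

lemma cum_zero : cum 0 = ∅ := by simp [cum, blkStart]

lemma sum_cum_succ {E : Type*} [AddCommMonoid E] (f : ℕ → E) (k : ℕ) :
    ∑ n ∈ cum (k + 1), f n = ∑ n ∈ cum k, f n + ∑ n ∈ blk k, f n :=
  (Finset.sum_Ico_consecutive f (one_le_blkStart k) (blkStart_mono k.le_succ)).symm

lemma cum_subset_succ (k : ℕ) : cum k ⊆ cum (k + 1) :=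
  Finset.Ico_subset_Ico_right (blkStart_mono k.le_succ)

lemma cum_mono : Monotone cum := monotone_nat_of_le_succ cum_subset_succ

lemma sqrtSum_cum (c : ℕ → ℂ) (k : ℕ) (v : ℝ) :
    sqrtSum (cum k) c v = ∑ i ∈ Finset.range k, sqrtSum (blk i) c v := by
  induction k with
  | zero => simp [sqrtSum, expSum, cum_zero]
  | succ k ih =>
    rw [Finset.sum_range_succ, ← ih]
    exact sum_cum_succ _ k

lemma sqrtSum_const_mul (s : Finset ℕ) (b : ℂ) (c : ℕ → ℂ) (v : ℝ) :
    sqrtSum s (fun n => b * c n) v = b * sqrtSum s c v := by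
  simp only [sqrtSum, expSum, Finset.mul_sum, mul_assoc]

/-- On a block d(n)n^{-3/4} is at most C R^{η − 3/4}; dividing by this number makes the coefficients
at most 1, as the moment theorems require. -/
lemma exists_normalized_block {η : ℝ} (hη : 0 < η) (hη' : η ≤ 3 / 4) : ∃ C : ℝ, 1 ≤ C ∧
    ∀ c : ℕ → ℂ, (∀ n, ‖c n‖ ≤ divCoeff n) → ∀ k : ℕ, ∃ c' : ℕ → ℂ, (∀ n ∈ blk k, ‖c' n‖ ≤ 1) ∧
      ∀ v, ‖sqrtSum (blk k) c v‖ =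
        C * ((5 / 4 : ℝ) ^ k) ^ (η - 3 / 4) * ‖sqrtSum (blk k) c' v‖ := by
  obtain ⟨C, hC, hd⟩ := exists_card_divisors_le hη
  refine ⟨C, hC, fun c hc k => ?_⟩
  set R : ℝ := (5 / 4 : ℝ) ^ k with hR
  have hR0 : 0 < R := by positivity
  set B := C * R ^ (η - 3 / 4) with hB
  have hB0 : 0 < B := by positivity
  refine ⟨fun n => (B : ℂ)⁻¹ * c n, fun n hn => ?_, fun v => ?_⟩
  · obtain ⟨h1, -⟩ := blk_le hn
    have hn0 : (0 : ℝ) < n := hR0.trans_le h1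
    have hn1 : n ≠ 0 := by rintro rfl; simp at hn0
    rw [norm_mul, norm_inv, Complex.norm_real, Real.norm_of_nonneg hB0.le, inv_mul_le_iff₀ hB0,
      mul_one]
    calc ‖c n‖ ≤ divCoeff n := hc n
      _ ≤ C * (n : ℝ) ^ η / (n : ℝ) ^ (3 / 4 : ℝ) := by
          unfold divCoeff divisorFn; gcongr; exact hd n hn1
      _ = C * (n : ℝ) ^ (η - 3 / 4) := by rw [Real.rpow_sub hn0]; ring
      _ ≤ B := by
          rw [hB]
          exact mul_le_mul_of_nonneg_left
            (Real.rpow_le_rpow_of_nonpos hR0 h1 (by linarith)) (by linarith)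
  · rw [sqrtSum_const_mul, norm_mul, norm_inv, Complex.norm_real, Real.norm_of_nonneg hB0.le,
      mul_inv_cancel_left₀ hB0.ne']

/-- Moments of the blocks of the divisor sum. -/
lemma exists_block_moments {ε : ℝ} (hε : 0 < ε) : ∃ C : ℝ, 1 ≤ C ∧
    ∀ c : ℕ → ℂ, (∀ n, ‖c n‖ ≤ divCoeff n) → ∀ k : ℕ, ∀ X : ℝ, ((5 / 4 : ℝ) ^ k) ^ 2 ≤ X →
      (∀ v, ‖sqrtSum (blk k) c v‖ ≤ C * X ^ ε * ((5 / 4 : ℝ) ^ k) ^ (1 / 4 : ℝ)) ∧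
      ∫ v, ‖sqrtSum (blk k) c v‖ ^ 6 ∂(gmean X) ≤
        C * X ^ ε * ((5 / 4 : ℝ) ^ k) ^ (-(27 / 100) : ℝ) ∧
      (((5 / 4 : ℝ) ^ k) ^ (5 / 2 : ℝ) ≤ X → ∫ v, ‖sqrtSum (blk k) c v‖ ^ 4 ∂(gmean X) ≤
        C * X ^ ε * ((5 / 4 : ℝ) ^ k) ^ (-1 : ℝ)) := by
  set η := min (ε / 12) (3 / 4) with hη
  have hη0 : 0 < η := lt_min (by positivity) (by norm_num)
  have hη1 : η ≤ 3 / 4 := min_le_right _ _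
  have hη2 : η ≤ ε / 12 := min_le_left _ _
  obtain ⟨C₀, hC₀, hnorm⟩ := exists_normalized_block hη0 hη1
  obtain ⟨C₄, hC₄, h4⟩ := exists_fourth_moment_le (ε := ε / 2) (by positivity)
  obtain ⟨C₆, hC₆, h6⟩ := exists_sixth_moment_le (ε := ε / 2) (by positivity)
  refine ⟨2 * C₀ + C₀ ^ 6 * C₆ + 2 * C₀ ^ 4 * C₄, ?_, fun c hc k X hX => ?_⟩
  · have : 0 < C₀ ^ 6 * C₆ := by positivity
    have : 0 < 2 * C₀ ^ 4 * C₄ := by positivity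
    linarith
  have hC₀p : 0 < C₀ := by linarith
  obtain ⟨c', hc', heq⟩ := hnorm c hc k
  set R : ℝ := (5 / 4 : ℝ) ^ k with hRdef
  have hR : 1 ≤ R := one_le_pow₀ (by norm_num)
  have hR0 : 0 < R := by linarith
  have hX1 : 1 ≤ X := by nlinarith
  have hX0 : 0 < X := by linarith
  have hRX : R ≤ X := by nlinarith
  have hs : ∀ n ∈ blk k, R ≤ n ∧ (n : ℝ) ≤ 5 / 4 * R := fun n hn => blk_le hn
  have hpw : ∀ p : ℕ, (p : ℝ) ≤ 6 → (R ^ η) ^ p ≤ X ^ (ε / 2) := fun p hp => by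
    rw [← Real.rpow_natCast, ← Real.rpow_mul hR0.le]
    calc R ^ (η * p) ≤ X ^ (η * p) := by gcongr
      _ ≤ _ := Real.rpow_le_rpow_of_exponent_le hX1 (by nlinarith)
  have hXX : X ^ (ε / 2) * X ^ (ε / 2) = X ^ ε := by
    rw [← Real.rpow_add hX0]; congr 1; ring
  have hsplit : R ^ (η - 3 / 4) = R ^ η * R ^ (-(3 / 4) : ℝ) := by
    rw [← Real.rpow_add hR0]; rfl
  -- The exponents are 1 − 3/4 from the length of the block, 4.23 − 6·3/4 = −0.27, and 2 − 4·3/4 =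
  -- −1. The last one needs R^{9/2}/X ≤ R², that is R^{5/2} ≤ X.
  refine ⟨fun v => ?_, ?_, fun hX5 => ?_⟩
  · rw [heq, hsplit]
    have e1 := (norm_expSum_le (blk k) c' (fun n => √(n : ℝ)) v hc').trans (card_le_two_mul hR hs)
    have e2 := hpw 1 (by norm_num)
    rw [pow_one] at e2
    have e3 : X ^ (ε / 2) ≤ X ^ ε := Real.rpow_le_rpow_of_exponent_le hX1 (by linarith)
    calc _ ≤ C₀ * (X ^ ε * R ^ (-(3 / 4) : ℝ)) * (2 * R) := by
          gcongr
          · exact e2.trans e3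
          · exact e1
      _ = 2 * C₀ * X ^ ε * (R ^ (-(3 / 4) : ℝ) * R ^ (1 : ℝ)) := by rw [Real.rpow_one]; ring
      _ = 2 * C₀ * X ^ ε * R ^ (1 / 4 : ℝ) := by rw [← Real.rpow_add hR0]; norm_num
      _ ≤ _ := by
          gcongr
          have : 0 ≤ C₀ ^ 6 * C₆ := by positivity
          have : 0 ≤ 2 * C₀ ^ 4 * C₄ := by positivity
          linarith
  · have e1 := h6 R hR (blk k) hs c' hc' X hX
    have e2 := hpw 6 (by norm_num)
    simp_rw [heq, hsplit, mul_pow]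
    rw [integral_const_mul]
    calc _ ≤ C₀ ^ 6 * (X ^ (ε / 2) * (R ^ (-(3 / 4) : ℝ)) ^ 6) *
          (C₆ * X ^ (ε / 2) * R ^ (423 / 100 : ℝ)) := by gcongr
      _ = C₀ ^ 6 * C₆ * (X ^ (ε / 2) * X ^ (ε / 2)) *
          ((R ^ (-(3 / 4) : ℝ)) ^ 6 * R ^ (423 / 100 : ℝ)) := by ring
      _ = C₀ ^ 6 * C₆ * X ^ ε * R ^ (-(27 / 100) : ℝ) := by
          rw [hXX, ← Real.rpow_natCast (R ^ _), ← Real.rpow_mul hR0.le, ← Real.rpow_add hR0]; norm_num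
      _ ≤ _ := by
          gcongr
          have : 0 ≤ 2 * C₀ ^ 4 * C₄ := by positivity
          linarith
  · have e1 := h4 R hR (blk k) hs c' hc' X hX
    have e2 := hpw 4 (by norm_num)
    have e3 : R ^ 2 + R ^ 4 * √R / X ≤ 2 * R ^ (2 : ℝ) := by
      have : R ^ 4 * √R / X ≤ R ^ (2 : ℝ) := by
        rw [div_le_iff₀ hX0]
        calc R ^ 4 * √R = R ^ (2 : ℝ) * (R ^ (2 : ℝ) * R ^ (1 / 2 : ℝ)) := by
              rw [Real.sqrt_eq_rpow, Real.rpow_two]; ring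
          _ = R ^ (2 : ℝ) * R ^ (5 / 2 : ℝ) := by rw [← Real.rpow_add hR0]; norm_num
          _ ≤ _ := by gcongr
      rw [Real.rpow_two] at this ⊢
      linarith
    simp_rw [heq, hsplit, mul_pow]
    rw [integral_const_mul]
    calc _ ≤ C₀ ^ 4 * (X ^ (ε / 2) * (R ^ (-(3 / 4) : ℝ)) ^ 4) *
          (C₄ * X ^ (ε / 2) * (2 * R ^ (2 : ℝ))) := by
          gcongr
          exact e1.trans (by gcongr)
      _ = 2 * C₀ ^ 4 * C₄ * (X ^ (ε / 2) * X ^ (ε / 2)) *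
          ((R ^ (-(3 / 4) : ℝ)) ^ 4 * R ^ (2 : ℝ)) := by ring
      _ = 2 * C₀ ^ 4 * C₄ * X ^ ε * R ^ (-1 : ℝ) := by
          rw [hXX, ← Real.rpow_natCast (R ^ _), ← Real.rpow_mul hR0.le, ← Real.rpow_add hR0]; norm_num
      _ ≤ _ := by
          gcongr
          have : 0 ≤ C₀ ^ 6 * C₆ := by positivity
          linarith

/-- Mixed moments of two blocks of the divisor sum. -/
lemma exists_mixed_moments {ε : ℝ} (hε : 0 < ε) : ∃ C : ℝ, 1 ≤ C ∧
    ∀ c : ℕ → ℂ, (∀ n, ‖c n‖ ≤ divCoeff n) → ∀ i k : ℕ, i ≤ k → ∀ X : ℝ,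
      ((5 / 4 : ℝ) ^ k) ^ 2 ≤ X →
      ∫ v, ‖sqrtSum (blk k) c v‖ * ‖sqrtSum (blk i) c v‖ ^ 6 ∂(gmean X) ≤
        C * X ^ ε * ((5 / 4 : ℝ) ^ k) ^ (-(1 / 50) : ℝ) ∧
      (((5 / 4 : ℝ) ^ k) ^ (5 / 2 : ℝ) ≤ X →
        ∫ v, ‖sqrtSum (blk k) c v‖ * ‖sqrtSum (blk i) c v‖ ^ 6 ∂(gmean X) ≤
        C * X ^ ε * ((5 / 4 : ℝ) ^ k) ^ (-(1 / 4) : ℝ)) := by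
  obtain ⟨C, hC, hmom⟩ := exists_block_moments (ε := ε / 4) (by positivity)
  refine ⟨C ^ 4, one_le_pow₀ hC, fun c hc i k hik X hX => ?_⟩
  have hC0 : 0 < C := by linarith
  set N : ℝ := (5 / 4 : ℝ) ^ k with hN
  set M : ℝ := (5 / 4 : ℝ) ^ i with hM
  have hM1 : 1 ≤ M := one_le_pow₀ (by norm_num)
  have hMN : M ≤ N := pow_le_pow_right₀ (by norm_num) hik
  have hM0 : 0 < M := by linarith
  have hN0 : 0 < N := by linarith
  have hX1 : 1 ≤ X := by nlinarith
  have hX0 : 0 < X := by linarith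
  have hMX : M ^ 2 ≤ X := le_trans (by gcongr) hX
  obtain ⟨k1, k2, k3⟩ := hmom c hc k X hX
  obtain ⟨i1, i2, i3⟩ := hmom c hc i X hMX
  set D := C * X ^ (ε / 4) with hD
  have hD1 : 1 ≤ D := by
    have : 1 ≤ X ^ (ε / 4) := Real.one_le_rpow hX1 (by positivity)
    nlinarith
  have hD0 : 0 < D := by linarith
  have hD4 : D ^ 4 = C ^ 4 * X ^ ε := by
    rw [hD, mul_pow, ← Real.rpow_natCast (X ^ (ε / 4)), ← Real.rpow_mul hX0.le]
    congr 2; push_cast; ring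
  have hbk : BddCont fun v => ‖sqrtSum (blk k) c v‖ := (bddCont_sqrtSum _ c).norm
  have hbi : BddCont fun v => ‖sqrtSum (blk i) c v‖ := (bddCont_sqrtSum _ c).norm
  rw [← hD4]
  constructor
  -- One factor |B_i| is bounded pointwise by M^{1/4} and Hölder is applied to the rest with sixth
  -- moments: M^{1/4 − 9/40} N^{−9/200} ≤ N^{1/40 − 9/200} = N^{−1/50}.
  · have h1 := integral_mul_pow_le (n := 5) hbk hbi (fun v => norm_nonneg _)
      (fun v => norm_nonneg _) (by norm_num) k2 i2
    norm_num at h1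
    have h2 : ∫ v, ‖sqrtSum (blk k) c v‖ * ‖sqrtSum (blk i) c v‖ ^ 6 ∂(gmean X) ≤
        ∫ v, (D * M ^ (1 / 4 : ℝ)) * (‖sqrtSum (blk k) c v‖ * ‖sqrtSum (blk i) c v‖ ^ 5)
          ∂(gmean X) := by
      refine integral_mono ((hbk.mul (hbi.pow 6)).integrable _)
        (((BddCont.const _).mul (hbk.mul (hbi.pow 5))).integrable _) fun v => ?_
      calc ‖sqrtSum (blk k) c v‖ * ‖sqrtSum (blk i) c v‖ ^ 6 =
          ‖sqrtSum (blk i) c v‖ * (‖sqrtSum (blk k) c v‖ * ‖sqrtSum (blk i) c v‖ ^ 5) := by ring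
        _ ≤ _ := by gcongr; exact i1 v
    rw [integral_const_mul] at h2
    calc _ ≤ (D * M ^ (1 / 4 : ℝ)) * ((D * N ^ (-(27 / 100) : ℝ)) ^ (1 / 6 : ℝ) *
          (D * M ^ (-(27 / 100) : ℝ)) ^ (5 / 6 : ℝ)) := by
          refine h2.trans ?_
          gcongr
      _ = D * (D ^ (1 / 6 : ℝ) * D ^ (5 / 6 : ℝ)) *
          (M ^ (1 / 4 : ℝ) * M ^ (-(27 / 100) * (5 / 6) : ℝ)) * N ^ (-(27 / 100) * (1 / 6) : ℝ) := by
          rw [Real.mul_rpow hD0.le (by positivity), Real.mul_rpow hD0.le (by positivity),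
            ← Real.rpow_mul hN0.le, ← Real.rpow_mul hM0.le]; ring
      _ = D ^ 2 * M ^ (1 / 40 : ℝ) * N ^ (-(45 / 1000) : ℝ) := by
          rw [← Real.rpow_add hD0, ← Real.rpow_add hM0]; norm_num; left; left; ring
      _ ≤ D ^ 4 * N ^ (1 / 40 : ℝ) * N ^ (-(45 / 1000) : ℝ) := by
          gcongr
          norm_num
      _ = _ := by rw [mul_assoc, ← Real.rpow_add hN0]; norm_num
  · intro hX5
    -- Now three factors are bounded pointwise. Their M^{3/4} cancels exactly the M^{−3/4} coming
    -- from the fourth moments, leaving N^{−1/4}.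
    have h1 := integral_mul_pow_le (n := 3) hbk hbi (fun v => norm_nonneg _)
      (fun v => norm_nonneg _) (by norm_num) (k3 hX5) (i3 (le_trans (by gcongr) hX5))
    norm_num at h1
    have h2 : ∫ v, ‖sqrtSum (blk k) c v‖ * ‖sqrtSum (blk i) c v‖ ^ 6 ∂(gmean X) ≤
        ∫ v, (D * M ^ (1 / 4 : ℝ)) ^ 3 * (‖sqrtSum (blk k) c v‖ * ‖sqrtSum (blk i) c v‖ ^ 3)
          ∂(gmean X) := by
      refine integral_mono ((hbk.mul (hbi.pow 6)).integrable _)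
        (((BddCont.const _).mul (hbk.mul (hbi.pow 3))).integrable _) fun v => ?_
      calc ‖sqrtSum (blk k) c v‖ * ‖sqrtSum (blk i) c v‖ ^ 6 =
          ‖sqrtSum (blk i) c v‖ ^ 3 * (‖sqrtSum (blk k) c v‖ * ‖sqrtSum (blk i) c v‖ ^ 3) := by ring
        _ ≤ _ := by gcongr; exact i1 v
    rw [integral_const_mul] at h2
    calc _ ≤ (D * M ^ (1 / 4 : ℝ)) ^ 3 * ((D * N ^ (-1 : ℝ)) ^ (1 / 4 : ℝ) *
          (D * M ^ (-1 : ℝ)) ^ (3 / 4 : ℝ)) := by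
          refine h2.trans ?_
          refine mul_le_mul_of_nonneg_left ?_ (by positivity)
          simpa [Real.rpow_neg_one] using h1
      _ = D ^ 3 * (D ^ (1 / 4 : ℝ) * D ^ (3 / 4 : ℝ)) *
          (M ^ (1 / 4 * (3 : ℕ) : ℝ) * M ^ (-1 * (3 / 4) : ℝ)) * N ^ (-1 * (1 / 4) : ℝ) := by
          rw [Real.mul_rpow hD0.le (by positivity), Real.mul_rpow hD0.le (by positivity),
            ← Real.rpow_mul hN0.le, ← Real.rpow_mul hM0.le, mul_pow, ← Real.rpow_natCast (M ^ _),
            ← Real.rpow_mul hM0.le]; ring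
      _ = _ := by
          rw [← Real.rpow_add hD0, ← Real.rpow_add hM0]; norm_num
          left; ring

/-- Bernoulli's inequality; it absorbs the number of blocks into an ε-power. -/
lemma exists_succ_le_pow_rpow {κ : ℝ} (hκ : 0 < κ) : ∃ C : ℝ, 1 ≤ C ∧
    ∀ k : ℕ, (k : ℝ) + 1 ≤ C * ((5 / 4 : ℝ) ^ k) ^ κ := by
  set t : ℝ := (5 / 4 : ℝ) ^ κ - 1 with ht
  have ht0 : 0 < t := by
    have := Real.one_lt_rpow (show (1 : ℝ) < 5 / 4 by norm_num) hκ
    linarith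
  refine ⟨1 + 1 / t, by have : 0 < 1 / t := by positivity
                        linarith, fun k => ?_⟩
  have h1 := one_add_mul_le_pow (show -2 ≤ t by linarith) k
  have h2 : ((5 / 4 : ℝ) ^ k) ^ κ = (1 + t) ^ k := by
    rw [ht, add_sub_cancel, ← Real.rpow_natCast, ← Real.rpow_natCast,
      ← Real.rpow_mul (by norm_num), ← Real.rpow_mul (by norm_num), mul_comm]
  rw [h2]
  calc (k : ℝ) + 1 ≤ (1 + 1 / t) * (1 + k * t) := by
        have e : (1 + 1 / t) * (1 + k * t) = 1 + k + k * t + 1 / t := by field_simp; ring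
        have : 0 ≤ (k : ℝ) * t := by positivity
        have : 0 < 1 / t := by positivity
        linarith
    _ ≤ _ := by gcongr

/-- Moments of a block against all smaller ones. -/
lemma exists_block_cum_moments {ε : ℝ} (hε : 0 < ε) : ∃ C : ℝ, 1 ≤ C ∧
    ∀ c : ℕ → ℂ, (∀ n, ‖c n‖ ≤ divCoeff n) → ∀ k : ℕ, ∀ X : ℝ, ((5 / 4 : ℝ) ^ k) ^ 2 ≤ X →
      ∫ v, ‖sqrtSum (blk k) c v‖ * (∑ i ∈ Finset.range (k + 1), ‖sqrtSum (blk i) c v‖) ^ 6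
          ∂(gmean X) ≤ C * X ^ ε * ((5 / 4 : ℝ) ^ k) ^ (-(1 / 50) : ℝ) ∧
      (((5 / 4 : ℝ) ^ k) ^ (5 / 2 : ℝ) ≤ X →
        ∫ v, ‖sqrtSum (blk k) c v‖ * (∑ i ∈ Finset.range (k + 1), ‖sqrtSum (blk i) c v‖) ^ 6
          ∂(gmean X) ≤ C * X ^ ε * ((5 / 4 : ℝ) ^ k) ^ (-(1 / 4) : ℝ)) := by
  obtain ⟨C, hC, hmix⟩ := exists_mixed_moments (ε := ε / 2) (by positivity)
  obtain ⟨B, hB, hk⟩ := exists_succ_le_pow_rpow (κ := ε / 12) (by positivity)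
  refine ⟨B ^ 6 * C, by nlinarith [one_le_pow₀ hB (n := 6)], fun c hc k X hX => ?_⟩
  have hb : ∀ i, BddCont fun v => ‖sqrtSum (blk i) c v‖ := fun i => (bddCont_sqrtSum _ c).norm
  have hmain : ∀ W, (∀ i ≤ k,
      ∫ v, ‖sqrtSum (blk k) c v‖ * ‖sqrtSum (blk i) c v‖ ^ 6 ∂(gmean X) ≤ W) →
      ∫ v, ‖sqrtSum (blk k) c v‖ * (∑ i ∈ Finset.range (k + 1), ‖sqrtSum (blk i) c v‖) ^ 6
        ∂(gmean X) ≤ ((k : ℝ) + 1) ^ 6 * W := by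
    intro W hW
    have h1 : ∫ v, ‖sqrtSum (blk k) c v‖ * (∑ i ∈ Finset.range (k + 1), ‖sqrtSum (blk i) c v‖) ^ 6
        ∂(gmean X) ≤ ∫ v, ((k : ℝ) + 1) ^ 5 * ∑ i ∈ Finset.range (k + 1),
          ‖sqrtSum (blk k) c v‖ * ‖sqrtSum (blk i) c v‖ ^ 6 ∂(gmean X) := by
      refine integral_mono (((hb k).mul ((BddCont.sum _ fun i _ => hb i).pow 6)).integrable _)
        (((BddCont.const _).mul (BddCont.sum _ fun i _ => (hb k).mul ((hb i).pow 6))).integrable _)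
        fun v => ?_
      have := pow_sum_div_card_le_sum_pow (s := Finset.range (k + 1))
        (f := fun i => ‖sqrtSum (blk i) c v‖) (fun i _ => norm_nonneg _) 5
      rw [Finset.card_range, div_le_iff₀ (by positivity)] at this
      push_cast at this
      calc _ ≤ ‖sqrtSum (blk k) c v‖ * ((∑ i ∈ Finset.range (k + 1),
            ‖sqrtSum (blk i) c v‖ ^ 6) * ((k : ℝ) + 1) ^ 5) := by gcongr
        _ = _ := by rw [← Finset.mul_sum]; ring
    rw [integral_const_mul, integral_finsetSum _ fun i _ =>
      ((hb k).mul ((hb i).pow 6)).integrable _] at h1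
    calc _ ≤ ((k : ℝ) + 1) ^ 5 * ∑ i ∈ Finset.range (k + 1), W := by
          refine h1.trans ?_
          gcongr with i hi
          exact hW i (by rw [Finset.mem_range] at hi; omega)
      _ = _ := by rw [Finset.sum_const, Finset.card_range, nsmul_eq_mul]; push_cast; ring
  have hN1 : 1 ≤ (5 / 4 : ℝ) ^ k := one_le_pow₀ (by norm_num)
  set N : ℝ := (5 / 4 : ℝ) ^ k with hN
  have hX1 : 1 ≤ X := by nlinarith
  have hX0 : 0 < X := by linarith
  have hNX : N ≤ X := by nlinarith
  have hkk : ((k : ℝ) + 1) ^ 6 ≤ B ^ 6 * X ^ (ε / 2) := by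
    calc ((k : ℝ) + 1) ^ 6 ≤ (B * X ^ (ε / 12)) ^ 6 := by
          gcongr
          exact (hk k).trans (by gcongr)
      _ = _ := by
          rw [mul_pow, ← Real.rpow_natCast (X ^ _), ← Real.rpow_mul hX0.le]
          congr 2; push_cast; ring
  have hfin : ∀ e : ℝ, ((k : ℝ) + 1) ^ 6 * (C * X ^ (ε / 2) * N ^ e) ≤ B ^ 6 * C * X ^ ε * N ^ e := by
    intro e
    calc _ ≤ B ^ 6 * X ^ (ε / 2) * (C * X ^ (ε / 2) * N ^ e) := by gcongr
      _ = B ^ 6 * C * (X ^ (ε / 2) * X ^ (ε / 2)) * N ^ e := by ring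
      _ = _ := by rw [← Real.rpow_add hX0, add_halves]
  refine ⟨(hmain _ fun i hi => (hmix c hc i k hi X hX).1).trans (hfin _), fun hX5 => ?_⟩
  exact (hmain _ fun i hi => (hmix c hc i k hi X hX).2 hX5).trans (hfin _)

/-! ### Diagonal solutions -/

section Alternating

variable {ι : Type*} [Fintype ι] [DecidableEq ι]

/-- The sum of `±√(n i)`, with plus signs on `P`. -/
noncomputable def altSum (P : Finset ι) (n : ι → ℕ) : ℝ :=
  ∑ i, (if i ∈ P then √(n i : ℝ) else -√(n i : ℝ))

open Classical in
/-- The weight of a tuple on the diagonal `altSum P n = 0`. -/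
noncomputable def diagTerm (P : Finset ι) (n : ι → ℕ) : ℝ :=
  if altSum P n = 0 then ∏ i, divCoeff (n i) else 0

lemma diagTerm_nonneg (P : Finset ι) (n : ι → ℕ) : 0 ≤ diagTerm P n := by
  unfold diagTerm
  split_ifs
  · exact Finset.prod_nonneg fun i _ => divCoeff_nonneg _
  · exact le_rfl

lemma diagTerm_eq_zero (P : Finset ι) {n : ι → ℕ} {i : ι} (hi : n i = 0) : diagTerm P n = 0 := by
  unfold diagTerm
  split_ifs
  · exact Finset.prod_eq_zero (Finset.mem_univ i) (by rw [hi, divCoeff_zero])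
  · rfl

lemma prod_sqrtSum_eq (P : Finset ι) (A : ι → Finset ℕ) (v : ℝ) :
    ∏ i, (if i ∈ P then sqrtSum (A i) (fun n => divCoeff n) v
      else (starRingEnd ℂ) (sqrtSum (A i) (fun n => divCoeff n) v)) =
    ∑ n ∈ Fintype.piFinset A, ((∏ i, divCoeff (n i) : ℝ) : ℂ) * osc (altSum P n) v := by
  have h : ∀ i, (if i ∈ P then sqrtSum (A i) (fun n => divCoeff n) v
      else (starRingEnd ℂ) (sqrtSum (A i) (fun n => divCoeff n) v)) =
      ∑ n ∈ A i, (divCoeff n : ℂ) * osc (if i ∈ P then √(n : ℝ) else -√(n : ℝ)) v := by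
    intro i
    split_ifs
    · rfl
    · rw [sqrtSum, expSum, map_sum]
      exact Finset.sum_congr rfl fun n _ => by rw [map_mul, Complex.conj_ofReal, conj_osc]
  simp_rw [h]
  rw [Finset.prod_univ_sum]
  refine Finset.sum_congr rfl fun n _ => ?_
  rw [Finset.prod_mul_distrib, altSum, osc_sum]
  push_cast
  rfl

/-- The diagonal is bounded by mean values. -/
lemma sum_diagTerm_le (P : Finset ι) (A : ι → Finset ℕ) (X : ℝ) :
    ∑ n ∈ Fintype.piFinset A, diagTerm P n ≤
      ∫ v, ∏ i, ‖sqrtSum (A i) (fun n => divCoeff n) v‖ ∂(gmean X) := by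
  have h1 : ((∑ n ∈ Fintype.piFinset A, (∏ i, divCoeff (n i)) *
      Real.exp (-(X * altSum P n) ^ 2 / 4) : ℝ) : ℂ) =
      ∫ v, ∏ i, (if i ∈ P then sqrtSum (A i) (fun n => divCoeff n) v
        else (starRingEnd ℂ) (sqrtSum (A i) (fun n => divCoeff n) v)) ∂(gmean X) := by
    simp_rw [prod_sqrtSum_eq]
    rw [integral_finsetSum _ fun n _ => ((BddCont.const _).mul (bddCont_osc _)).integrable _,
      Complex.ofReal_sum]
    refine Finset.sum_congr rfl fun n _ => ?_
    rw [integral_const_mul, integral_osc, Complex.ofReal_mul]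
  -- Weights and Gaussian factors are nonnegative and the factor is 1 on the diagonal, so adding the
  -- off-diagonal terms only increases the sum. This holds for every X.
  calc _ ≤ ∑ n ∈ Fintype.piFinset A, (∏ i, divCoeff (n i)) *
        Real.exp (-(X * altSum P n) ^ 2 / 4) := by
        refine Finset.sum_le_sum fun n _ => ?_
        have h0 : 0 ≤ ∏ i, divCoeff (n i) := Finset.prod_nonneg fun i _ => divCoeff_nonneg _
        unfold diagTerm
        split_ifs with h
        · rw [h]; simp
        · positivity
    _ ≤ _ := Real.le_norm_self _
    _ = _ := (Complex.norm_real _).symm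
    _ ≤ _ := by
        rw [h1]
        refine (norm_integral_le_integral_norm _).trans (le_of_eq ?_)
        refine integral_congr_ae (Filter.Eventually.of_forall fun v => ?_)
        simp only
        rw [norm_prod]
        refine Finset.prod_congr rfl fun i _ => ?_
        split_ifs
        · rfl
        · rw [RCLike.norm_conj]

/-- The truncated diagonal. -/
noncomputable def diagSum (P : Finset ι) (K : ℕ) : ℝ :=
  ∑ n ∈ Fintype.piFinset (fun _ => cum K), diagTerm P n

lemma altSum_compl (P : Finset ι) (n : ι → ℕ) : altSum Pᶜ n = -altSum P n := by
  unfold altSum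
  rw [← Finset.sum_neg_distrib]
  refine Finset.sum_congr rfl fun i _ => ?_
  by_cases h : i ∈ P <;> simp [h]

lemma diagTerm_compl (P : Finset ι) : diagTerm Pᶜ = diagTerm (ι := ι) P := by
  funext n
  simp [diagTerm, altSum_compl]

/-- A permutation of the coordinates carries P to Q, so the full diagonal depends only on the number
of plus signs. -/
lemma tsum_diagTerm_congr {P Q : Finset ι} (h : P.card = Q.card) :
    ∑' n, diagTerm P n = ∑' n, diagTerm Q n := by
  set σ : Equiv.Perm ι := (Finset.equivOfCardEq h).extendSubtype with hσ
  have hmem : ∀ i, σ i ∈ Q ↔ i ∈ P := fun i => by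
    constructor
    · intro hi
      by_contra hcon
      exact (Finset.equivOfCardEq h).extendSubtype_not_mem i hcon hi
    · exact fun hi => (Finset.equivOfCardEq h).extendSubtype_mem i hi
  rw [← (Equiv.arrowCongr σ (Equiv.refl ℕ)).tsum_eq (diagTerm Q)]
  refine tsum_congr fun n => ?_
  have e1 : altSum Q (Equiv.arrowCongr σ (Equiv.refl ℕ) n) = altSum P n := by
    unfold altSum
    rw [← Equiv.sum_comp σ]
    refine Finset.sum_congr rfl fun i _ => ?_
    simp [Equiv.arrowCongr, hmem]
  have e2 : ∏ i, divCoeff (Equiv.arrowCongr σ (Equiv.refl ℕ) n i) = ∏ i, divCoeff (n i) := by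
    rw [← Equiv.prod_comp σ]
    simp [Equiv.arrowCongr]
  unfold diagTerm
  rw [e1, e2]

/-- The boxes `cum K` exhaust the positive tuples, and tuples with a zero coordinate carry no weight
because `divCoeff 0 = 0`. -/
lemma exists_sum_le_diagSum (P : Finset ι) (u : Finset (ι → ℕ)) (K₀ : ℕ) :
    ∃ K, K₀ ≤ K ∧ ∑ n ∈ u, diagTerm P n ≤ diagSum P K := by
  classical
  obtain ⟨K, hK⟩ := pow_unbounded_of_one_lt ((∑ n ∈ u, ∑ i, n i : ℕ) : ℝ)
    (show (1 : ℝ) < 5 / 4 by norm_num)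
  refine ⟨max K₀ K, le_max_left _ _, ?_⟩
  rw [← Finset.sum_filter_add_sum_filter_not u (fun n => ∀ i, 1 ≤ n i),
    Finset.sum_eq_zero (s := u.filter fun n => ¬ ∀ i, 1 ≤ n i), add_zero]
  · refine Finset.sum_le_sum_of_subset_of_nonneg (fun n hn => ?_) fun _ _ _ => diagTerm_nonneg _ _
    rw [Finset.mem_filter] at hn
    rw [Fintype.mem_piFinset]
    intro i
    refine cum_mono (le_max_right K₀ K) (mem_cum.2 ⟨hn.2 i, lt_of_le_of_lt ?_ hK⟩)
    have h1 : n i ≤ ∑ j, n j := Finset.single_le_sum (fun _ _ => Nat.zero_le _) (Finset.mem_univ i)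
    have h2 : ∑ j, n j ≤ ∑ n ∈ u, ∑ i, n i :=
      Finset.single_le_sum (f := fun n : ι → ℕ => ∑ i, n i) (fun _ _ => Nat.zero_le _) hn.1
    exact_mod_cast h1.trans h2
  · intro n hn
    rw [Finset.mem_filter, not_forall] at hn
    obtain ⟨i, hi⟩ := hn.2
    exact diagTerm_eq_zero P (i := i) (by omega)

/-- Geometric control of the increments gives the rate of convergence. -/
lemma diagSum_convergence (P : Finset ι) {C q : ℝ} (hC : 0 ≤ C) (hq0 : 0 ≤ q) (hq1 : q < 1)
    (h : ∀ K, diagSum P (K + 1) ≤ diagSum P K + C * q ^ K) :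
    Summable (diagTerm P) ∧ ∀ K, |∑' n, diagTerm P n - diagSum P K| ≤ C / (1 - q) * q ^ K := by
  have hq : 0 < 1 - q := by linarith
  -- The truncated sum plus the geometric tail of all later increments is nonincreasing, so it
  -- bounds every finite partial sum.
  have hanti : Antitone fun K => diagSum P K + C / (1 - q) * q ^ K := by
    refine antitone_nat_of_succ_le fun K => ?_
    have e : C / (1 - q) * q ^ K = C * q ^ K + C / (1 - q) * q ^ (K + 1) := by
      field_simp; ring
    have := h K
    rw [e]; linarith
  have hle : ∀ K u, ∑ n ∈ u, diagTerm P n ≤ diagSum P K + C / (1 - q) * q ^ K := by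
    intro K u
    obtain ⟨K', hK', hu⟩ := exists_sum_le_diagSum P u K
    have h1 := hanti hK'
    have h2 : 0 ≤ C / (1 - q) * q ^ K' := by positivity
    simp only at h1
    linarith
  have hsum : Summable (diagTerm P) := summable_of_sum_le (fun n => diagTerm_nonneg P n) (hle 0)
  refine ⟨hsum, fun K => ?_⟩
  have h1 : diagSum P K ≤ ∑' n, diagTerm P n :=
    hsum.sum_le_tsum _ fun n _ => diagTerm_nonneg P n
  have h2 : ∑' n, diagTerm P n ≤ diagSum P K + C / (1 - q) * q ^ K :=
    hsum.tsum_le_of_sum_le (hle K)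
  rw [abs_of_nonneg (by linarith)]
  linarith

end Alternating

lemma sum_union_le_of_nonneg {α : Type*} [DecidableEq α] {f : α → ℝ} (hf : ∀ a, 0 ≤ f a)
    (s t : Finset α) : ∑ a ∈ s ∪ t, f a ≤ ∑ a ∈ s, f a + ∑ a ∈ t, f a := by
  rw [← Finset.sum_union_inter]
  have := Finset.sum_nonneg (s := s ∩ t) fun a _ => hf a
  linarith

lemma sum_biUnion_le_of_nonneg {α β : Type*} [DecidableEq α] [DecidableEq β] {f : α → ℝ}
    (hf : ∀ a, 0 ≤ f a) (s : Finset β) (t : β → Finset α) :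
    ∑ a ∈ s.biUnion t, f a ≤ ∑ b ∈ s, ∑ a ∈ t b, f a := by
  induction s using Finset.induction_on with
  | empty => simp
  | insert b s hb ih =>
    rw [Finset.biUnion_insert, Finset.sum_insert hb]
    exact (sum_union_le_of_nonneg hf _ _).trans (by gcongr)

/-- A new tuple has some coordinate in the block K, so the increment is at most seven mean values of
|B_K|(∑|B_i|)^6. The diagonal does not involve X, so one may take X = N^{5/2}, the smallest value at
which the decay N^{−1/4} is available. -/
lemma exists_diagSum_succ_le {ε : ℝ} (hε : 0 < ε) : ∃ C : ℝ, 0 ≤ C ∧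
    ∀ (P : Finset (Fin 7)) (K : ℕ), diagSum P (K + 1) ≤
      diagSum P K + C * ((5 / 4 : ℝ) ^ (-(1 / 4) + ε)) ^ K := by
  classical
  obtain ⟨C, hC, hmom⟩ := exists_block_cum_moments (ε := 2 / 5 * ε) (by positivity)
  refine ⟨7 * C, by positivity, fun P K => ?_⟩
  set N : ℝ := (5 / 4 : ℝ) ^ K with hN
  have hN1 : 1 ≤ N := one_le_pow₀ (by norm_num)
  have hN0 : 0 < N := by linarith
  set X : ℝ := N ^ (5 / 2 : ℝ) with hX
  have hNX : N ^ 2 ≤ X := by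
    rw [hX, ← Real.rpow_two]
    exact Real.rpow_le_rpow_of_exponent_le hN1 (by norm_num)
  have hc : ∀ n, ‖((divCoeff n : ℝ) : ℂ)‖ ≤ divCoeff n := fun n => by
    rw [Complex.norm_real, Real.norm_of_nonneg (divCoeff_nonneg n)]
  have hE := (hmom (fun n => divCoeff n) hc K X hNX).2 le_rfl
  have hval : X ^ (2 / 5 * ε) * N ^ (-(1 / 4) : ℝ) = ((5 / 4 : ℝ) ^ (-(1 / 4) + ε)) ^ K := by
    rw [hX, ← Real.rpow_mul hN0.le, ← Real.rpow_add hN0, hN, ← Real.rpow_natCast,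
      ← Real.rpow_natCast, ← Real.rpow_mul (by norm_num), ← Real.rpow_mul (by norm_num)]
    congr 1; ring
  set A : Fin 7 → Fin 7 → Finset ℕ := fun q => Function.update (fun _ => cum (K + 1)) q (blk K)
  have hsub : Fintype.piFinset (fun _ : Fin 7 => cum (K + 1)) ⊆
      Fintype.piFinset (fun _ => cum K) ∪ Finset.univ.biUnion fun q => Fintype.piFinset (A q) := by
    intro n hn
    rw [Fintype.mem_piFinset] at hn
    rw [Finset.mem_union, Fintype.mem_piFinset, Finset.mem_biUnion]
    by_cases hcum : ∀ i, n i ∈ cum K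
    · exact Or.inl hcum
    · push Not at hcum
      obtain ⟨q, hq⟩ := hcum
      refine Or.inr ⟨q, Finset.mem_univ q, ?_⟩
      rw [Fintype.mem_piFinset]
      intro i
      by_cases hi : i = q
      · subst hi
        have h1 := hn i
        rw [mem_cum] at h1 hq
        simp only [A, Function.update_self]
        rw [mem_blk]
        push Not at hq
        exact ⟨hq h1.1, h1.2⟩
      · simp only [A, Function.update_of_ne hi]
        exact hn i
  have hq : ∀ q : Fin 7, ∑ n ∈ Fintype.piFinset (A q), diagTerm P n ≤
      C * ((5 / 4 : ℝ) ^ (-(1 / 4) + ε)) ^ K := by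
    intro q
    refine (sum_diagTerm_le P (A q) X).trans ?_
    rw [← hval, ← mul_assoc]
    refine le_trans ?_ hE
    have hb : ∀ s, BddCont fun v => ‖sqrtSum s (fun n => divCoeff n) v‖ :=
      fun s => (bddCont_sqrtSum _ _).norm
    refine integral_mono ((BddCont.prod _ fun i _ => hb _).integrable _)
      (((hb _).mul ((BddCont.sum _ fun i _ => hb _).pow 6)).integrable _) fun v => ?_
    simp only
    rw [Fin.prod_univ_succAbove _ q]
    simp only [A, Function.update_self, Function.update_of_ne (Fin.succAbove_ne q _),
      Finset.prod_const, Finset.card_univ, Fintype.card_fin]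
    gcongr
    rw [sqrtSum_cum]
    exact norm_sum_le _ _
  calc diagSum P (K + 1) ≤ ∑ n ∈ Fintype.piFinset (fun _ => cum K) ∪
        Finset.univ.biUnion fun q => Fintype.piFinset (A q), diagTerm P n :=
        Finset.sum_le_sum_of_subset_of_nonneg hsub fun _ _ _ => diagTerm_nonneg _ _
    _ ≤ diagSum P K + ∑ n ∈ Finset.univ.biUnion fun q => Fintype.piFinset (A q), diagTerm P n := by
        exact sum_union_le_of_nonneg (diagTerm_nonneg P) _ _
    _ ≤ diagSum P K + ∑ q : Fin 7, ∑ n ∈ Fintype.piFinset (A q), diagTerm P n := by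
        gcongr
        exact sum_biUnion_le_of_nonneg (diagTerm_nonneg P) _ _
    _ ≤ diagSum P K + ∑ q : Fin 7, C * ((5 / 4 : ℝ) ^ (-(1 / 4) + ε)) ^ K := by
        gcongr with q _; exact hq q
    _ = _ := by rw [Finset.sum_const, Finset.card_univ, Fintype.card_fin, nsmul_eq_mul]; push_cast; ring

/-- The diagonal converges, at the rate given by the mixed moments. -/
theorem exists_diagSum_rate {ε : ℝ} (hε : 0 < ε) (hε' : ε < 1 / 4) : ∃ C : ℝ, 0 ≤ C ∧
    ∀ P : Finset (Fin 7), Summable (diagTerm P) ∧ ∀ K : ℕ,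
      |∑' n, diagTerm P n - diagSum P K| ≤ C * ((5 / 4 : ℝ) ^ K) ^ (-(1 / 4) + ε) := by
  obtain ⟨C, hC, h⟩ := exists_diagSum_succ_le hε
  have hq1 : (5 / 4 : ℝ) ^ (-(1 / 4) + ε) < 1 :=
    Real.rpow_lt_one_of_one_lt_of_neg (by norm_num) (by linarith)
  have hq : 0 < 1 - (5 / 4 : ℝ) ^ (-(1 / 4) + ε) := by linarith
  refine ⟨C / (1 - (5 / 4 : ℝ) ^ (-(1 / 4) + ε)), by positivity, fun P => ?_⟩
  obtain ⟨h1, h2⟩ := diagSum_convergence P hC (by positivity) hq1 (h P)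
  refine ⟨h1, fun K => (h2 K).trans (le_of_eq ?_)⟩
  congr 1
  rw [← Real.rpow_natCast, ← Real.rpow_natCast, ← Real.rpow_mul (by norm_num),
    ← Real.rpow_mul (by norm_num), mul_comm]

/-- The series of the statement in terms of `diagTerm`. -/
lemma summable_and_sSeries_eq (ℓ : ℕ)
    (hs : Summable (diagTerm (Finset.univ.filter fun i : Fin 7 => i.val < ℓ))) :
    Summable (fun n : sqrtSolutions 7 ℓ => sTerm divisorFn n.1) ∧
      sSeries 7 ℓ divisorFn = ∑' n, diagTerm (Finset.univ.filter fun i : Fin 7 => i.val < ℓ) n := by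
  set P := Finset.univ.filter fun i : Fin 7 => i.val < ℓ with hP
  set φ : sqrtSolutions 7 ℓ → (Fin 7 → ℕ) := fun n i => (n.1 i : ℕ) with hφ
  have hinj : Function.Injective φ := by
    intro n n' h
    apply Subtype.ext
    funext i
    exact PNat.eq (congrFun h i)
  have halt : ∀ n : Fin 7 → ℕ+, altSum P (fun i => (n i : ℕ)) =
      ∑ i : Fin 7 with i.val < ℓ, √((n i : ℕ) : ℝ) - ∑ i : Fin 7 with ℓ ≤ i.val, √((n i : ℕ) : ℝ) := by
    intro n
    unfold altSum
    rw [Finset.sum_ite, Finset.sum_neg_distrib, sub_eq_add_neg]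
    have e1 : Finset.univ.filter (fun i : Fin 7 => i ∈ P) = Finset.univ.filter fun i => i.val < ℓ := by
      ext i; simp [hP]
    have e2 : Finset.univ.filter (fun i : Fin 7 => i ∉ P) = Finset.univ.filter fun i => ℓ ≤ i.val := by
      ext i; simp [hP]
    rw [e1, e2]
  have hval : ∀ n : sqrtSolutions 7 ℓ, diagTerm P (φ n) = sTerm divisorFn n.1 := by
    intro n
    have hn : altSum P (φ n) = 0 := by
      rw [hφ, halt, sub_eq_zero]
      exact n.2
    unfold diagTerm sTerm
    rw [if_pos hn]
    simp only [divCoeff, Finset.prod_div_distrib]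
    rw [Real.finsetProd_rpow _ _ fun i _ => Nat.cast_nonneg _]
  have hsupp : Function.support (diagTerm P) ⊆ Set.range φ := by
    intro n hn
    have hpos : ∀ i, 0 < n i := fun i => Nat.pos_of_ne_zero fun h0 => hn (diagTerm_eq_zero P h0)
    have h0 : altSum P n = 0 := by
      by_contra hcon
      exact hn (by simp [diagTerm, hcon])
    refine ⟨⟨fun i => ⟨n i, hpos i⟩, ?_⟩, rfl⟩
    have := halt fun i => ⟨n i, hpos i⟩
    simp only [PNat.mk_coe] at this
    rw [h0] at this
    exact (sub_eq_zero.1 this.symm)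
  have hcomp : (fun n : sqrtSolutions 7 ℓ => sTerm divisorFn n.1) = diagTerm P ∘ φ :=
    funext fun n => (hval n).symm
  constructor
  · rw [hcomp]
    exact hs.comp_injective hinj
  · rw [sSeries, hcomp]
    exact hinj.tsum_eq hsupp

/-! ### Separation of alternating sums of square roots from zero -/

section Separation

open Polynomial

/-- Separating even and odd powers of s: p(X ± s) = A ± sB with integral A, B. Hence p(X + s)p(X −
s) = A² − mB² is again integral. -/
lemma exists_comp_add_sub (p : ℤ[X]) {m : ℤ} {s : ℝ} (hs : s ^ 2 = m) : ∃ A B : ℤ[X],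
    (p.map (Int.castRingHom ℝ)).comp (X + C s) =
      A.map (Int.castRingHom ℝ) + C s * B.map (Int.castRingHom ℝ) ∧
    (p.map (Int.castRingHom ℝ)).comp (X - C s) =
      A.map (Int.castRingHom ℝ) - C s * B.map (Int.castRingHom ℝ) := by
  have hs' : (C s : ℝ[X]) ^ 2 = C (m : ℝ) := by rw [← C_pow, hs]
  induction p using Polynomial.induction_on with
  | C a => exact ⟨C a, 0, by simp, by simp⟩
  | add p q hp hq =>
    obtain ⟨A, B, h1, h2⟩ := hp
    obtain ⟨A', B', h1', h2'⟩ := hq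
    refine ⟨A + A', B + B', ?_, ?_⟩
    · rw [Polynomial.map_add, add_comp, h1, h1', Polynomial.map_add, Polynomial.map_add]; ring
    · rw [Polynomial.map_add, add_comp, h2, h2', Polynomial.map_add, Polynomial.map_add]; ring
  | monomial n a h =>
    obtain ⟨A, B, h1, h2⟩ := h
    refine ⟨A * X + C m * B, A + B * X, ?_, ?_⟩
    · rw [pow_succ, ← mul_assoc, Polynomial.map_mul, mul_comp, h1]
      simp only [Polynomial.map_add, Polynomial.map_mul, Polynomial.map_X, Polynomial.map_C, X_comp,
        Int.coe_castRingHom]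
      linear_combination (B.map (Int.castRingHom ℝ)) * hs'
    · rw [pow_succ, ← mul_assoc, Polynomial.map_mul, mul_comp, h2]
      simp only [Polynomial.map_add, Polynomial.map_mul, Polynomial.map_X, Polynomial.map_C, X_comp,
        Int.coe_castRingHom]
      linear_combination (B.map (Int.castRingHom ℝ)) * hs'

variable {ι : Type*} [DecidableEq ι]

/-- Adjoining one more root splits the product into the values of the old polynomial at X + √n and X
− √n, whose product is integral by `exists_comp_add_sub`. -/
lemma exists_map_eq_prod_powerset (n : ι → ℕ) (I : Finset ι) : ∃ Q : ℤ[X],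
    Q.map (Int.castRingHom ℝ) =
      ∏ P ∈ I.powerset, (X - C (∑ i ∈ I, if i ∈ P then √(n i : ℝ) else -√(n i : ℝ))) := by
  induction I using Finset.induction_on with
  | empty => exact ⟨X, by simp⟩
  | insert a I ha ih =>
    obtain ⟨Q, hQ⟩ := ih
    obtain ⟨A, B, h1, h2⟩ := exists_comp_add_sub Q (m := n a) (s := √(n a : ℝ))
      (by rw [Real.sq_sqrt (Nat.cast_nonneg _)]; norm_cast)
    refine ⟨A ^ 2 - C (n a : ℤ) * B ^ 2, ?_⟩
    have hs : (C √(n a : ℝ) : ℝ[X]) ^ 2 = C (n a : ℝ) := by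
      rw [← C_pow, Real.sq_sqrt (Nat.cast_nonneg _)]
    have e1 : ∏ P ∈ I.powerset, (X - C (∑ i ∈ insert a I,
        if i ∈ P then √(n i : ℝ) else -√(n i : ℝ))) =
        (Q.map (Int.castRingHom ℝ)).comp (X + C √(n a : ℝ)) := by
      rw [hQ, prod_comp]
      refine Finset.prod_congr rfl fun P hP => ?_
      have : a ∉ P := fun h => ha (Finset.mem_powerset.1 hP h)
      rw [Finset.sum_insert ha, if_neg this, sub_comp, X_comp, C_comp, C_add, C_neg]; ring
    have e2 : ∏ P ∈ I.powerset, (X - C (∑ i ∈ insert a I,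
        if i ∈ insert a P then √(n i : ℝ) else -√(n i : ℝ))) =
        (Q.map (Int.castRingHom ℝ)).comp (X - C √(n a : ℝ)) := by
      rw [hQ, prod_comp]
      refine Finset.prod_congr rfl fun P hP => ?_
      have hcongr : ∑ i ∈ I, (if i ∈ insert a P then √(n i : ℝ) else -√(n i : ℝ)) =
          ∑ i ∈ I, if i ∈ P then √(n i : ℝ) else -√(n i : ℝ) := by
        refine Finset.sum_congr rfl fun i hi => ?_
        have : i ≠ a := fun h => ha (h ▸ hi)
        simp [this]
      rw [Finset.sum_insert ha, if_pos (Finset.mem_insert_self a P), hcongr, sub_comp, X_comp,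
        C_comp, C_add]; ring
    rw [Finset.prod_powerset_insert ha, e1, e2, h1, h2]
    simp only [Polynomial.map_sub, Polynomial.map_mul, Polynomial.map_pow, Polynomial.map_C,
      Int.coe_castRingHom, Int.cast_natCast]
    linear_combination (B.map (Int.castRingHom ℝ)) ^ 2 * hs

variable [Fintype ι]

open Classical in
/-- The product of the nonzero alternating sums is a nonzero integer. -/
lemma one_le_prod_abs_altSum (n : ι → ℕ) :
    1 ≤ ∏ P ∈ Finset.univ.filter (fun P : Finset ι => altSum P n ≠ 0), |altSum P n| := by
  obtain ⟨Q, hQ⟩ := exists_map_eq_prod_powerset n Finset.univ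
  rw [Finset.powerset_univ, ← Finset.prod_filter_mul_prod_filter_not Finset.univ
    (fun P : Finset ι => altSum P n = 0)] at hQ
  have e1 : ∏ P ∈ Finset.univ.filter (fun P : Finset ι => altSum P n = 0),
      (X - C (∑ i, if i ∈ P then √(n i : ℝ) else -√(n i : ℝ))) =
      X ^ (Finset.univ.filter (fun P : Finset ι => altSum P n = 0)).card := by
    rw [← Finset.prod_const]
    refine Finset.prod_congr rfl fun P hP => ?_
    rw [Finset.mem_filter] at hP
    change X - C (altSum P n) = X
    rw [hP.2]; simp
  rw [e1] at hQ
  -- Let z be the number of vanishing sums. After the factor X^z is taken out, the coefficient of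
  -- degree z is the product of the negatives of the nonzero sums.
  have h0 := congrArg (fun p => p.coeff (Finset.univ.filter
    (fun P : Finset ι => altSum P n = 0)).card) hQ
  have hc : ∀ (p : ℝ[X]) (z : ℕ), (X ^ z * p).coeff z = p.coeff 0 := fun p z => by
    simpa using coeff_X_pow_mul p z 0
  rw [coeff_map, hc, coeff_zero_eq_eval_zero, eval_prod] at h0
  have e2 : |((Q.coeff (Finset.univ.filter (fun P : Finset ι => altSum P n = 0)).card : ℤ) : ℝ)| =
      ∏ P ∈ Finset.univ.filter (fun P : Finset ι => altSum P n ≠ 0), |altSum P n| := by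
    rw [← eq_intCast (Int.castRingHom ℝ), h0, Finset.abs_prod]
    refine Finset.prod_congr rfl fun P _ => ?_
    rw [eval_sub, eval_X, eval_C, zero_sub, abs_neg, altSum]
  rw [← e2]
  have hne : (Q.coeff (Finset.univ.filter (fun P : Finset ι => altSum P n = 0)).card : ℤ) ≠ 0 := by
    intro h
    rw [h, Int.cast_zero, abs_zero] at e2
    have := Finset.prod_pos (s := Finset.univ.filter (fun P : Finset ι => altSum P n ≠ 0))
      (f := fun P => |altSum P n|) fun P hP => abs_pos.2 (Finset.mem_filter.1 hP).2
    linarith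
  exact_mod_cast Int.one_le_abs hne

end Separation

lemma abs_altSum_le {ι : Type*} [Fintype ι] [DecidableEq ι] (P : Finset ι) {n : ι → ℕ} {y : ℝ}
    (hn : ∀ i, (n i : ℝ) ≤ y) : |altSum P n| ≤ Fintype.card ι * √y := by
  calc |altSum P n| ≤ ∑ i : ι, |if i ∈ P then √(n i : ℝ) else -√(n i : ℝ)| :=
        Finset.abs_sum_le_sum_abs _ _
    _ ≤ ∑ i : ι, √y := by
        refine Finset.sum_le_sum fun i _ => ?_
        have := Real.sqrt_le_sqrt (hn i)
        split_ifs
        · rwa [abs_of_nonneg (Real.sqrt_nonneg _)]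
        · rwa [abs_neg, abs_of_nonneg (Real.sqrt_nonneg _)]
    _ = _ := by rw [Finset.sum_const, Finset.card_univ, nsmul_eq_mul]

/-- Nonzero alternating sums of seven square roots are bounded away from zero. -/
lemma one_le_abs_altSum_mul {P : Finset (Fin 7)} {n : Fin 7 → ℕ} {y : ℝ} (hy : 1 ≤ y)
    (hn : ∀ i, (n i : ℝ) ≤ y) (hP : altSum P n ≠ 0) : 1 ≤ |altSum P n| * (7 * √y) ^ 63 := by
  classical
  have hB : 1 ≤ 7 * √y := by
    have := Real.one_le_sqrt.2 hy
    linarith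
  set B := 7 * √y with hBdef
  have hle : ∀ Q : Finset (Fin 7), |altSum Q n| ≤ B := fun Q => by
    simpa using abs_altSum_le Q hn
  have h1 := one_le_prod_abs_altSum n
  set S := Finset.univ.filter (fun Q : Finset (Fin 7) => altSum Q n ≠ 0) with hS
  have hPS : P ∈ S := by simp [hS, hP]
  have hne : Pᶜ ≠ P := by
    intro h
    have := altSum_compl P n
    rw [h] at this
    exact hP (by linarith)
  -- P and its complement give the same absolute value, which therefore occurs squared. At most 126
  -- factors remain, each bounded by B, and a square root leaves B^63.
  have hPcS : Pᶜ ∈ S.erase P := by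
    rw [Finset.mem_erase]
    exact ⟨hne, by simp [hS, altSum_compl, hP]⟩
  rw [← Finset.mul_prod_erase S _ hPS, ← Finset.mul_prod_erase _ _ hPcS, altSum_compl, abs_neg] at h1
  have hcard : ((S.erase P).erase Pᶜ).card ≤ 126 := by
    rw [Finset.card_erase_of_mem hPcS, Finset.card_erase_of_mem hPS]
    have : S.card ≤ 128 := (Finset.card_le_univ S).trans (by simp)
    omega
  have h2 : ∏ Q ∈ (S.erase P).erase Pᶜ, |altSum Q n| ≤ B ^ 126 := by
    calc _ ≤ ∏ Q ∈ (S.erase P).erase Pᶜ, B :=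
          Finset.prod_le_prod (fun _ _ => abs_nonneg _) fun Q _ => hle Q
      _ = B ^ ((S.erase P).erase Pᶜ).card := Finset.prod_const _
      _ ≤ _ := pow_le_pow_right₀ hB hcard
  have h3 : 1 ≤ (|altSum P n| * B ^ 63) ^ 2 := by
    calc 1 ≤ |altSum P n| * (|altSum P n| * B ^ 126) := by
          refine h1.trans ?_
          gcongr
      _ = _ := by ring
  by_contra hcon
  have h4 : (|altSum P n| * B ^ 63) ^ 2 < 1 :=
    pow_lt_one₀ (by positivity) (not_le.1 hcon) (by norm_num)
  linarith

/-! ### Expansion of the seventh power of a short sum -/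

/-- The cosine sum with coefficients `b`. -/
noncomputable def cosSum (s : Finset ℕ) (b : ℕ → ℝ) (x : ℝ) : ℝ :=
  ∑ n ∈ s, b n * Real.cos (4 * Real.pi * √x * √(n : ℝ) - Real.pi / 4)

lemma prod_cos {ι : Type*} [Fintype ι] [DecidableEq ι] (β : ι → ℝ) :
    ∏ i, Real.cos (β i) =
      (1 / 2) ^ Fintype.card ι * ∑ P : Finset ι, Real.cos (∑ i, if i ∈ P then β i else -β i) := by
  have h1 : ∏ i, Complex.cos (β i) = (1 / 2) ^ Fintype.card ι *
      ∑ P : Finset ι, Complex.exp ((∑ i, if i ∈ P then β i else -β i : ℝ) * Complex.I) := by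
    have : ∀ i, Complex.cos (β i) =
        1 / 2 * (Complex.exp (β i * Complex.I) + Complex.exp (-β i * Complex.I)) := fun i => by
      rw [Complex.cos]; ring
    simp_rw [this]
    rw [Finset.prod_mul_distrib, Finset.prod_const, Finset.card_univ, Fintype.prod_add]
    congr 1
    refine Finset.sum_congr rfl fun P _ => ?_
    rw [← Complex.exp_sum, ← Complex.exp_sum, ← Complex.exp_add, Finset.sum_ite]
    congr 1
    have e1 : Finset.univ.filter (fun i => i ∈ P) = P := by ext; simp
    have e2 : Finset.univ.filter (fun i => i ∉ P) = Pᶜ := by ext; simp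
    rw [e1, e2]
    push_cast
    rw [add_mul, Finset.sum_mul, Finset.sum_mul]
  have h2 := congrArg Complex.re h1
  have e3 : ((1 / 2 : ℂ) ^ Fintype.card ι) = (((1 / 2 : ℝ) ^ Fintype.card ι : ℝ) : ℂ) := by
    push_cast; rfl
  rw [e3, Complex.re_ofReal_mul, Complex.re_sum] at h2
  simp_rw [Complex.exp_ofReal_mul_I_re] at h2
  rw [← h2, ← Complex.ofReal_re (∏ i, Real.cos (β i))]
  push_cast
  rfl

lemma sum_sign_const {ι : Type*} [Fintype ι] [DecidableEq ι] (P : Finset ι) (c : ℝ) :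
    ∑ i, (if i ∈ P then c else -c) = c * (2 * P.card - Fintype.card ι) := by
  have e : ∀ i, (if i ∈ P then c else -c) = (if i ∈ P then 2 * c else 0) - c := fun i => by
    split_ifs <;> ring
  simp_rw [e]
  rw [Finset.sum_sub_distrib, Finset.sum_ite_mem, Finset.univ_inter, Finset.sum_const,
    Finset.sum_const, Finset.card_univ, nsmul_eq_mul, nsmul_eq_mul]
  ring

lemma cosSum_pow_seven (s : Finset ℕ) (b : ℕ → ℝ) (x : ℝ) :
    cosSum s b x ^ 7 = (1 / 2) ^ 7 * ∑ P : Finset (Fin 7), ∑ n ∈ Fintype.piFinset fun _ => s,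
      (∏ i, b (n i)) * Real.cos (4 * Real.pi * altSum P n * √x -
        Real.pi / 4 * (2 * P.card - 7)) := by
  have h1 : cosSum s b x ^ 7 = ∏ _i : Fin 7, cosSum s b x := by simp
  rw [h1]
  simp only [cosSum]
  rw [Finset.prod_univ_sum, Finset.sum_comm, Finset.mul_sum]
  refine Finset.sum_congr rfl fun n _ => ?_
  rw [Finset.prod_mul_distrib, prod_cos, ← Finset.mul_sum, Fintype.card_fin]
  have h2 : ∀ P : Finset (Fin 7), (∑ i, if i ∈ P then 4 * Real.pi * √x * √(n i : ℝ) - Real.pi / 4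
      else -(4 * Real.pi * √x * √(n i : ℝ) - Real.pi / 4)) =
      4 * Real.pi * altSum P n * √x - Real.pi / 4 * (2 * P.card - 7) := by
    intro P
    have h3 := sum_sign_const P (Real.pi / 4)
    rw [Fintype.card_fin] at h3
    push_cast at h3
    rw [← h3, altSum, Finset.mul_sum, Finset.sum_mul, ← Finset.sum_sub_distrib]
    refine Finset.sum_congr rfl fun i _ => ?_
    split_ifs <;> ring
  simp_rw [h2]
  ring

/-! ### Oscillatory integrals -/

lemma continuousOn_rpow_Icc {T : ℝ} (hT : 0 < T) (p : ℝ) :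
    ContinuousOn (fun x : ℝ => x ^ p) (Set.uIcc T (2 * T)) := by
  rw [Set.uIcc_of_le (by linarith)]
  exact continuousOn_id.rpow_const fun x hx => Or.inl (by linarith [hx.1] : x ≠ 0)

lemma two_mul_rpow_le {T p : ℝ} (hT : 0 < T) (hp : p ≤ 3) :
    (2 * T) ^ p ≤ 8 * T ^ p := by
  rw [Real.mul_rpow (by norm_num) hT.le]
  gcongr
  calc (2 : ℝ) ^ p ≤ 2 ^ (3 : ℝ) := Real.rpow_le_rpow_of_exponent_le (by norm_num) hp
    _ = 8 := by norm_num

/-- Integration by parts in explicit form: the derivative of x^{9/4} sin(2w√x − b)/w is the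
integrand plus a remainder of size x^{5/4}/|w|, whose integral is of the same order T^{9/4} as the
boundary terms. -/
lemma abs_integral_rpow_mul_cos_le {T : ℝ} (hT : 0 < T) {α : ℝ} (hα : α ≠ 0) (b : ℝ) :
    |∫ x in T..2 * T, x ^ (7 / 4 : ℝ) * Real.cos (4 * Real.pi * α * √x - b)| ≤
      8 * T ^ (9 / 4 : ℝ) / |α| := by
  set w := 2 * Real.pi * α with hw
  have hpi : 0 < Real.pi := Real.pi_pos
  have hw0 : w ≠ 0 := by positivity
  have hT2 : T ≤ 2 * T := by linarith
  set G : ℝ → ℝ := fun x => x ^ (9 / 4 : ℝ) * Real.sin (2 * w * √x - b) / w with hG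
  set g : ℝ → ℝ := fun x => x ^ (7 / 4 : ℝ) * Real.cos (2 * w * √x - b) with hg
  set r : ℝ → ℝ := fun x => 9 / 4 * x ^ (5 / 4 : ℝ) * Real.sin (2 * w * √x - b) / w with hr
  have e4 : ∀ x, 4 * Real.pi * α * √x = 2 * w * √x := fun x => by rw [hw]; ring
  simp_rw [e4]
  have hder : ∀ x ∈ Set.uIcc T (2 * T), HasDerivAt G (r x + g x) x := by
    intro x hx
    rw [Set.uIcc_of_le hT2] at hx
    have hx0 : 0 < x := hT.trans_le hx.1
    have h1 : HasDerivAt (fun x : ℝ => x ^ (9 / 4 : ℝ)) (9 / 4 * x ^ (5 / 4 : ℝ)) x :=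
      (Real.hasDerivAt_rpow_const (Or.inl hx0.ne')).congr_deriv (by norm_num)
    have h2 : HasDerivAt (fun x : ℝ => 2 * w * √x - b) (2 * w * (1 / (2 * √x))) x :=
      ((Real.hasDerivAt_sqrt hx0.ne').const_mul _).sub_const b
    refine ((h1.mul h2.sin).div_const w).congr_deriv ?_
    have e : x ^ (9 / 4 : ℝ) = x ^ (7 / 4 : ℝ) * √x := by
      rw [Real.sqrt_eq_rpow, ← Real.rpow_add hx0]; norm_num
    have hs : √x ≠ 0 := (Real.sqrt_pos.2 hx0).ne'
    rw [hr, hg, e]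
    field_simp
  have hcr : IntervalIntegrable r volume T (2 * T) := by
    apply ContinuousOn.intervalIntegrable
    exact ((continuousOn_const.mul (continuousOn_rpow_Icc hT _)).mul
      (Continuous.continuousOn (by fun_prop))).div_const _
  have hcg : IntervalIntegrable g volume T (2 * T) := by
    apply ContinuousOn.intervalIntegrable
    exact (continuousOn_rpow_Icc hT _).mul (Continuous.continuousOn (by fun_prop))
  have hI := intervalIntegral.integral_eq_sub_of_hasDerivAt hder (hcr.add hcg)
  rw [intervalIntegral.integral_add hcr hcg] at hI
  have hw' : 0 < |w| := abs_pos.2 hw0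
  have hGb : ∀ x, 0 < x → |G x| ≤ x ^ (9 / 4 : ℝ) / |w| := fun x hx => by
    rw [hG]
    simp only
    rw [abs_div, abs_mul, abs_of_pos (show 0 < x ^ (9 / 4 : ℝ) by positivity)]
    gcongr
    exact mul_le_of_le_one_right (by positivity) (Real.abs_sin_le_one _)
  have hRb : |∫ x in T..2 * T, r x| ≤ 9 / 4 * (2 * T) ^ (5 / 4 : ℝ) / |w| * |2 * T - T| := by
    rw [← Real.norm_eq_abs]
    refine intervalIntegral.norm_integral_le_of_norm_le_const fun x hx => ?_
    rw [Set.uIoc_of_le hT2] at hx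
    have hx0 : 0 < x := hT.trans hx.1
    rw [Real.norm_eq_abs, hr]
    simp only
    rw [abs_div, abs_mul, abs_of_pos (show 0 < 9 / 4 * x ^ (5 / 4 : ℝ) by positivity)]
    refine div_le_div_of_nonneg_right ?_ hw'.le
    refine (mul_le_of_le_one_right (by positivity) (Real.abs_sin_le_one _)).trans ?_
    gcongr
    exact hx.2
  have h1 := hGb (2 * T) (by linarith)
  have h2 := hGb T hT
  have h3 := two_mul_rpow_le hT (p := 9 / 4) (by norm_num)
  have h4 := two_mul_rpow_le hT (p := 5 / 4) (by norm_num)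
  have e5 : T ^ (5 / 4 : ℝ) * T = T ^ (9 / 4 : ℝ) := by
    rw [← Real.rpow_add_one hT.ne']; norm_num
  have e6 : |w| = 2 * Real.pi * |α| := by rw [hw, abs_mul, abs_of_pos (by positivity)]
  have h5 : |∫ x in T..2 * T, g x| ≤ 27 * T ^ (9 / 4 : ℝ) / |w| := by
    have e7 : ∫ x in T..2 * T, g x = G (2 * T) - G T - ∫ x in T..2 * T, r x := by linarith
    rw [e7]
    calc _ ≤ |G (2 * T)| + |G T| + |∫ x in T..2 * T, r x| :=
          (abs_sub _ _).trans (by gcongr; exact abs_sub _ _)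
      _ ≤ 8 * T ^ (9 / 4 : ℝ) / |w| + T ^ (9 / 4 : ℝ) / |w| +
          9 / 4 * (8 * T ^ (5 / 4 : ℝ)) / |w| * T := by
          have : |2 * T - T| = T := by rw [show 2 * T - T = T by ring, abs_of_pos hT]
          rw [this] at hRb
          refine add_le_add (add_le_add (h1.trans (by gcongr)) h2) (hRb.trans (by gcongr))
      _ = (9 * T ^ (9 / 4 : ℝ) + 18 * (T ^ (5 / 4 : ℝ) * T)) / |w| := by ring
      _ = _ := by rw [e5]; ring
  refine h5.trans ?_
  have hα0 : 0 < |α| := abs_pos.2 hα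
  rw [e6, div_le_div_iff₀ (by positivity) hα0]
  have := Real.pi_gt_three
  have h6 : 0 ≤ T ^ (9 / 4 : ℝ) * |α| := by positivity
  nlinarith

lemma integral_rpow_seven_fourths {T : ℝ} :
    ∫ x in T..2 * T, x ^ (7 / 4 : ℝ) = 4 / 11 * ((2 * T) ^ (11 / 4 : ℝ) - T ^ (11 / 4 : ℝ)) := by
  rw [integral_rpow (Or.inl (by norm_num))]
  norm_num
  ring

/-! ### The seventh moment of a short sum -/

lemma divCoeff_le (n : ℕ) : divCoeff n ≤ (n : ℝ) ^ (1 / 4 : ℝ) := by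
  rcases Nat.eq_zero_or_pos n with rfl | hn
  · rw [divCoeff_zero]; positivity
  · have hn0 : (0 : ℝ) < n := by exact_mod_cast hn
    rw [divCoeff, div_le_iff₀ (by positivity), ← Real.rpow_add hn0]
    norm_num [divisorFn]
    exact_mod_cast Nat.card_divisors_le_self n

lemma sum_divCoeff_cum_le (K : ℕ) :
    ∑ n ∈ cum K, divCoeff n ≤ ((5 / 4 : ℝ) ^ K) ^ (5 / 4 : ℝ) := by
  set y : ℝ := (5 / 4 : ℝ) ^ K with hy
  have hy0 : 0 < y := by positivity
  calc _ ≤ ∑ n ∈ cum K, y ^ (1 / 4 : ℝ) := by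
        refine Finset.sum_le_sum fun n hn => (divCoeff_le n).trans ?_
        have := (mem_cum.1 hn).2
        gcongr
    _ = ((cum K).card : ℝ) * y ^ (1 / 4 : ℝ) := by rw [Finset.sum_const, nsmul_eq_mul]
    _ ≤ y * y ^ (1 / 4 : ℝ) := by
        gcongr
        have h1 : (blkStart K : ℝ) < y + 1 := Nat.ceil_lt_add_one hy0.le
        rw [cum, Nat.card_Ico, Nat.cast_sub (one_le_blkStart K)]
        push_cast
        linarith
    _ = _ := by rw [mul_comm, ← Real.rpow_add_one hy0.ne']; norm_num

/-- The seventh moment of a short sum: the diagonal gives the main term. -/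
lemma abs_integral_cosSum_sub_le {T : ℝ} (hT : 0 < T) (K : ℕ) :
    |(∫ x in T..2 * T, x ^ (7 / 4 : ℝ) * cosSum (cum K) divCoeff x ^ 7) -
      1 / 352 * ((2 * T) ^ (11 / 4 : ℝ) - T ^ (11 / 4 : ℝ)) *
        ∑ P : Finset (Fin 7), Real.cos (Real.pi / 4 * (2 * P.card - 7)) * diagSum P K| ≤
      8 * 7 ^ 63 * T ^ (9 / 4 : ℝ) * ((5 / 4 : ℝ) ^ K) ^ (161 / 4 : ℝ) := by
  set y : ℝ := (5 / 4 : ℝ) ^ K with hy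
  have hy1 : 1 ≤ y := one_le_pow₀ (by norm_num)
  have hy0 : 0 < y := by linarith
  set Δ := (2 * T) ^ (11 / 4 : ℝ) - T ^ (11 / 4 : ℝ) with hΔ
  set I : ℝ → ℝ → ℝ := fun α b =>
    ∫ x in T..2 * T, x ^ (7 / 4 : ℝ) * Real.cos (4 * Real.pi * α * √x - b) with hI
  set b : Finset (Fin 7) → ℝ := fun P => Real.pi / 4 * (2 * P.card - 7) with hb
  set S := Fintype.piFinset fun _ : Fin 7 => cum K with hS
  set w : (Fin 7 → ℕ) → ℝ := fun n => ∏ i, divCoeff (n i) with hw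
  have hw0 : ∀ n, 0 ≤ w n := fun n => Finset.prod_nonneg fun i _ => divCoeff_nonneg _
  have hint : ∀ α b, IntervalIntegrable (fun x : ℝ => x ^ (7 / 4 : ℝ) *
      Real.cos (4 * Real.pi * α * √x - b)) volume T (2 * T) := fun α b =>
    ((continuousOn_rpow_Icc hT _).mul
      (Continuous.continuousOn (by fun_prop))).intervalIntegrable
  have h1 : ∫ x in T..2 * T, x ^ (7 / 4 : ℝ) * cosSum (cum K) divCoeff x ^ 7 =
      (1 / 2) ^ 7 * ∑ P : Finset (Fin 7), ∑ n ∈ S, w n * I (altSum P n) (b P) := by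
    have e : ∀ x, x ^ (7 / 4 : ℝ) * cosSum (cum K) divCoeff x ^ 7 =
        (1 / 2) ^ 7 * ∑ P : Finset (Fin 7), ∑ n ∈ S, w n *
          (x ^ (7 / 4 : ℝ) * Real.cos (4 * Real.pi * altSum P n * √x - b P)) := by
      intro x
      rw [cosSum_pow_seven, mul_left_comm]
      congr 1
      rw [Finset.mul_sum]
      refine Finset.sum_congr rfl fun P _ => ?_
      rw [Finset.mul_sum]
      exact Finset.sum_congr rfl fun n _ => by ring
    simp_rw [e]
    have hint2 : ∀ P : Finset (Fin 7), ∀ n ∈ S, IntervalIntegrable (fun x : ℝ => w n *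
        (x ^ (7 / 4 : ℝ) * Real.cos (4 * Real.pi * altSum P n * √x - b P))) volume T (2 * T) :=
      fun P n _ => (hint _ _).const_mul _
    rw [intervalIntegral.integral_const_mul, intervalIntegral.integral_finsetSum fun P _ => by
      simpa only [Finset.sum_fn] using IntervalIntegrable.sum S (hint2 P)]
    congr 1
    refine Finset.sum_congr rfl fun P _ => ?_
    rw [intervalIntegral.integral_finsetSum (hint2 P)]
    exact Finset.sum_congr rfl fun n _ => intervalIntegral.integral_const_mul _ _
  have h2 : ∀ P : Finset (Fin 7), |∑ n ∈ S, w n * I (altSum P n) (b P) -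
      4 / 11 * Δ * (Real.cos (b P) * diagSum P K)| ≤
      8 * 7 ^ 63 * T ^ (9 / 4 : ℝ) * y ^ (161 / 4 : ℝ) := by
    intro P
    have e : 4 / 11 * Δ * (Real.cos (b P) * diagSum P K) =
        ∑ n ∈ S, 4 / 11 * Δ * Real.cos (b P) * diagTerm P n := by
      rw [← Finset.mul_sum, diagSum]; ring
    rw [e, ← Finset.sum_sub_distrib]
    -- On the diagonal the phase is constant and the two terms agree exactly. Off the diagonal the
    -- separation bound replaces 1/|altSum| by (7√y)^63.
    have hterm : ∀ n ∈ S, |w n * I (altSum P n) (b P) - 4 / 11 * Δ * Real.cos (b P) * diagTerm P n| ≤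
        w n * (8 * T ^ (9 / 4 : ℝ) * (7 * √y) ^ 63) := by
      intro n hn
      by_cases h0 : altSum P n = 0
      · have e1 : I (altSum P n) (b P) = 4 / 11 * Δ * Real.cos (b P) := by
          rw [hI, h0]
          simp only [mul_zero, zero_mul, zero_sub, Real.cos_neg]
          rw [intervalIntegral.integral_mul_const, integral_rpow_seven_fourths]
        rw [e1, diagTerm, if_pos h0, mul_comm (w n), sub_self, abs_zero]
        have := hw0 n
        positivity
      · rw [diagTerm, if_neg h0, mul_zero, sub_zero, abs_mul, abs_of_nonneg (hw0 n)]
        refine mul_le_mul_of_nonneg_left ?_ (hw0 n)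
        refine (abs_integral_rpow_mul_cos_le hT h0 (b P)).trans ?_
        have h3 : ∀ i, (n i : ℝ) ≤ y := fun i =>
          (mem_cum.1 (Fintype.mem_piFinset.1 hn i)).2.le
        have h4 := one_le_abs_altSum_mul hy1 h3 h0
        have h5 : 0 < |altSum P n| := abs_pos.2 h0
        rw [div_le_iff₀ h5]
        calc 8 * T ^ (9 / 4 : ℝ) = 8 * T ^ (9 / 4 : ℝ) * 1 := by ring
          _ ≤ 8 * T ^ (9 / 4 : ℝ) * (|altSum P n| * (7 * √y) ^ 63) := by gcongr
          _ = _ := by ring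
    have hsumw : ∑ n ∈ S, w n ≤ (y ^ (5 / 4 : ℝ)) ^ 7 := by
      have e2 : ∑ n ∈ S, w n = (∑ n ∈ cum K, divCoeff n) ^ 7 := by
        have := Finset.prod_univ_sum (fun _ : Fin 7 => cum K) (fun _ n => divCoeff n)
        rw [hS, hw, ← this]
        simp
      rw [e2]
      have := Finset.sum_nonneg (s := cum K) fun n _ => divCoeff_nonneg n
      have := sum_divCoeff_cum_le K
      gcongr
    -- The exponent of y is 7·5/4 from the trivial sum of the weights plus 63/2 from the separation,
    -- in total 161/4.
    calc _ ≤ ∑ n ∈ S, w n * (8 * T ^ (9 / 4 : ℝ) * (7 * √y) ^ 63) :=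
          (Finset.abs_sum_le_sum_abs _ _).trans (Finset.sum_le_sum hterm)
      _ ≤ (y ^ (5 / 4 : ℝ)) ^ 7 * (8 * T ^ (9 / 4 : ℝ) * (7 * √y) ^ 63) := by
          rw [← Finset.sum_mul]; gcongr
      _ = 8 * 7 ^ 63 * T ^ (9 / 4 : ℝ) * ((y ^ (5 / 4 : ℝ)) ^ 7 * (y ^ (1 / 2 : ℝ)) ^ 63) := by
          rw [mul_pow, Real.sqrt_eq_rpow]; ring
      _ = _ := by
          rw [← Real.rpow_natCast (y ^ (5 / 4 : ℝ)), ← Real.rpow_natCast (y ^ (1 / 2 : ℝ)),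
            ← Real.rpow_mul hy0.le, ← Real.rpow_mul hy0.le, ← Real.rpow_add hy0]
          norm_num
  -- 1/352 is 4/11, from integrating x^{7/4}, times the factor 2^{−7} of the expansion into cosines.
  have h3 : (∫ x in T..2 * T, x ^ (7 / 4 : ℝ) * cosSum (cum K) divCoeff x ^ 7) -
      1 / 352 * Δ * ∑ P : Finset (Fin 7), Real.cos (b P) * diagSum P K =
      (1 / 2) ^ 7 * ∑ P : Finset (Fin 7), (∑ n ∈ S, w n * I (altSum P n) (b P) -
      4 / 11 * Δ * (Real.cos (b P) * diagSum P K)) := by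
    rw [h1, Finset.sum_sub_distrib, ← Finset.mul_sum]; ring
  rw [h3, abs_mul, abs_of_pos (by positivity)]
  calc _ ≤ (1 / 2 : ℝ) ^ 7 * ∑ P : Finset (Fin 7), 8 * 7 ^ 63 * T ^ (9 / 4 : ℝ) * y ^ (161 / 4 : ℝ) := by
        gcongr
        exact (Finset.abs_sum_le_sum_abs _ _).trans (Finset.sum_le_sum fun P _ => h2 P)
    _ = _ := by
        rw [Finset.sum_const, Finset.card_univ, Fintype.card_finset, Fintype.card_fin, nsmul_eq_mul]
        push_cast; ring

/-- The constant in the main term. -/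
lemma sum_cos_mul_tsum_diagTerm (hs : ∀ P : Finset (Fin 7), Summable (diagTerm P)) :
    ∑ P : Finset (Fin 7), Real.cos (Real.pi / 4 * (2 * P.card - 7)) * ∑' n, diagTerm P n =
      7 * √2 * (5 * sSeries 7 3 divisorFn - 3 * sSeries 7 2 divisorFn -
        sSeries 7 1 divisorFn) := by
  set Q : ℕ → Finset (Fin 7) := fun ℓ => Finset.univ.filter fun i : Fin 7 => i.val < ℓ with hQ
  set s : ℕ → ℝ := fun ℓ => ∑' n, diagTerm (Q ℓ) n with hsdef
  have hser : ∀ ℓ, sSeries 7 ℓ divisorFn = s ℓ := fun ℓ => (summable_and_sSeries_eq ℓ (hs _)).2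
  have hcard : ∀ ℓ ≤ 7, (Q ℓ).card = ℓ := by decide
  have hP : ∀ P : Finset (Fin 7), ∑' n, diagTerm P n = s P.card := fun P =>
    tsum_diagTerm_congr (by rw [hcard _ ((Finset.card_le_univ P).trans (by simp))])
  have hcompl : ∀ ℓ ≤ 7, s (7 - ℓ) = s ℓ := by
    intro ℓ hℓ
    have h1 : ((Q ℓ)ᶜ).card = 7 - ℓ := by
      rw [Finset.card_compl, hcard ℓ hℓ, Fintype.card_fin]
    have h2 := hP (Q ℓ)ᶜ
    rw [h1, diagTerm_compl] at h2
    exact h2.symm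
  have hzero : s 0 = 0 := by
    have : diagTerm (Q 0) = 0 := by
      funext n
      by_cases h0 : altSum (Q 0) n = 0
      · have h1 : ∑ i, √(n i : ℝ) = 0 := by
          rw [← neg_eq_zero, ← Finset.sum_neg_distrib, ← h0, altSum]
          exact Finset.sum_congr rfl fun i _ => by simp [hQ]
        have h2 := (Finset.sum_eq_zero_iff_of_nonneg fun i _ => Real.sqrt_nonneg _).1 h1 0
          (Finset.mem_univ _)
        rw [Real.sqrt_eq_zero (Nat.cast_nonneg _)] at h2
        exact diagTerm_eq_zero _ (i := 0) (by exact_mod_cast h2)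
      · simp [diagTerm, h0]
    rw [hsdef]
    simp [this]
  simp_rw [hP]
  -- Grouping by m = |P|: the cosine is √2/2 for m = 3, 4 and −√2/2 for m = 1, 2, 5, 6. With s_m =
  -- s_{7−m} and s_0 = 0 the total is √2(35s₃ − 21s₂ − 7s₁).
  have hsum := Finset.sum_powerset_apply_card
    (fun m : ℕ => Real.cos (Real.pi / 4 * (2 * m - 7)) * s m) (x := (Finset.univ : Finset (Fin 7)))
  rw [Finset.powerset_univ] at hsum
  rw [hsum, Finset.card_univ, Fintype.card_fin]
  have c1 : Real.cos (Real.pi / 4 * (2 * 1 - 7)) = -(√2 / 2) := by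
    rw [show Real.pi / 4 * (2 * 1 - 7) = -(Real.pi / 4 + Real.pi) by ring, Real.cos_neg,
      Real.cos_add_pi, Real.cos_pi_div_four]
  have c2 : Real.cos (Real.pi / 4 * (2 * 2 - 7)) = -(√2 / 2) := by
    rw [show Real.pi / 4 * (2 * 2 - 7) = -(Real.pi - Real.pi / 4) by ring, Real.cos_neg,
      Real.cos_pi_sub, Real.cos_pi_div_four]
  have c3 : Real.cos (Real.pi / 4 * (2 * 3 - 7)) = √2 / 2 := by
    rw [show Real.pi / 4 * (2 * 3 - 7) = -(Real.pi / 4) by ring, Real.cos_neg,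
      Real.cos_pi_div_four]
  have c4 : Real.cos (Real.pi / 4 * (2 * 4 - 7)) = √2 / 2 := by
    rw [show Real.pi / 4 * (2 * 4 - 7) = Real.pi / 4 by ring, Real.cos_pi_div_four]
  have c5 : Real.cos (Real.pi / 4 * (2 * 5 - 7)) = -(√2 / 2) := by
    rw [show Real.pi / 4 * (2 * 5 - 7) = Real.pi - Real.pi / 4 by ring,
      Real.cos_pi_sub, Real.cos_pi_div_four]
  have c6 : Real.cos (Real.pi / 4 * (2 * 6 - 7)) = -(√2 / 2) := by
    rw [show Real.pi / 4 * (2 * 6 - 7) = Real.pi / 4 + Real.pi by ring,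
      Real.cos_add_pi, Real.cos_pi_div_four]
  have s4 := hcompl 3 (by norm_num)
  have s5 := hcompl 2 (by norm_num)
  have s6 := hcompl 1 (by norm_num)
  have s7 := hcompl 0 (by norm_num)
  simp only [Nat.reduceSub] at s4 s5 s6 s7
  simp only [Finset.sum_range_succ, Finset.sum_range_zero, Nat.choose, nsmul_eq_mul]
  push_cast
  rw [c1, c2, c3, c4, c5, c6, s4, s5, s6, s7, hzero, hser, hser, hser]
  ring

/-! ### From the Gaussian mean to the interval `[T, 2T]` -/

/-- On [X, √2 X] the Gaussian density is at least e^{−2}/(√π X), so it dominates the uniform weight.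
The right end is √2 X because v grows like √x when x runs from T to 2T. -/
lemma integral_le_gmean {Φ : ℝ → ℝ} (hΦ : BddCont Φ) (hΦ0 : ∀ v, 0 ≤ Φ v) {X : ℝ} (hX : 0 < X) :
    ∫ v in X..√2 * X, Φ v ≤ √Real.pi * Real.exp 2 * X * ∫ v, Φ v ∂(gmean X) := by
  have hv0 : (X ^ 2 / 2).toNNReal ≠ 0 := by
    rw [Ne, Real.toNNReal_eq_zero, not_le]; positivity
  have hvc : ((X ^ 2 / 2).toNNReal : ℝ) = X ^ 2 / 2 := Real.coe_toNNReal _ (by positivity)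
  set p := gaussianPDFReal 0 (X ^ 2 / 2).toNNReal with hp
  have hpi : 0 < √Real.pi := Real.sqrt_pos.2 Real.pi_pos
  have hs2 : 1 ≤ √2 := Real.one_le_sqrt.2 (by norm_num)
  have hXX : X ≤ √2 * X := by nlinarith
  have hpX : ∀ v, p v = (√Real.pi * X)⁻¹ * Real.exp (-v ^ 2 / X ^ 2) := by
    intro v
    rw [hp, gaussianPDFReal, hvc, sub_zero]
    congr 2
    · rw [show 2 * Real.pi * (X ^ 2 / 2) = Real.pi * X ^ 2 by ring,
        Real.sqrt_mul Real.pi_pos.le, Real.sqrt_sq hX.le]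
    · congr 1; ring
  have hint : Integrable (fun v => Φ v * p v) := by
    obtain ⟨hc, C, hC⟩ := hΦ
    exact (integrable_gaussianPDFReal 0 _).bdd_mul hc.aestronglyMeasurable
      (Filter.Eventually.of_forall hC)
  have hp0 : ∀ v, 0 ≤ p v := fun v => gaussianPDFReal_nonneg _ _ _
  have hmean : ∫ v, Φ v ∂(gmean X) = ∫ v, Φ v * p v := by
    rw [gmean, integral_gaussianReal_eq_integral_smul hv0]
    simp_rw [smul_eq_mul, mul_comm (gaussianPDFReal _ _ _)]
    rfl
  have hlow : ∀ v ∈ Set.Icc X (√2 * X), Φ v ≤ √Real.pi * Real.exp 2 * X * (Φ v * p v) := by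
    intro v hv
    have h1 : v ^ 2 / X ^ 2 ≤ 2 := by
      rw [div_le_iff₀ (by positivity)]
      have : v ^ 2 ≤ (√2 * X) ^ 2 := by
        have := hX.trans_le hv.1
        gcongr; exact hv.2
      rwa [mul_pow, Real.sq_sqrt (by norm_num)] at this
    have h2 : 1 ≤ Real.exp 2 * Real.exp (-v ^ 2 / X ^ 2) := by
      rw [← Real.exp_add, Real.one_le_exp_iff, neg_div]; linarith
    rw [hpX]
    have e : √Real.pi * Real.exp 2 * X * (Φ v * ((√Real.pi * X)⁻¹ * Real.exp (-v ^ 2 / X ^ 2))) =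
        Φ v * (Real.exp 2 * Real.exp (-v ^ 2 / X ^ 2)) := by field_simp
    rw [e]
    exact le_mul_of_one_le_right (hΦ0 v) h2
  rw [hmean]
  calc _ ≤ ∫ v in X..√2 * X, √Real.pi * Real.exp 2 * X * (Φ v * p v) :=
        intervalIntegral.integral_mono_on hXX (hΦ.1.intervalIntegrable _ _)
          ((hint.const_mul _).intervalIntegrable) hlow
    _ = √Real.pi * Real.exp 2 * X * ∫ v in X..√2 * X, Φ v * p v :=
        intervalIntegral.integral_const_mul _ _
    _ ≤ _ := by
        gcongr
        rw [intervalIntegral.integral_of_le hXX]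
        exact setIntegral_le_integral hint
          (Filter.Eventually.of_forall fun v => mul_nonneg (hΦ0 v) (hp0 v))

/-- Substitution v = 4π√x; on [T, 2T] the derivative 2π/√x is at least 2π/√(2T). -/
lemma integral_comp_sqrt_le_gmean {Φ : ℝ → ℝ} (hΦ : BddCont Φ) (hΦ0 : ∀ v, 0 ≤ Φ v) {T : ℝ}
    (hT : 0 < T) :
    ∫ x in T..2 * T, Φ (4 * Real.pi * √x) ≤
      4 * √Real.pi * Real.exp 2 * T * ∫ v, Φ v ∂(gmean (4 * Real.pi * √T)) := by
  have hpi := Real.pi_pos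
  have hT2 : T ≤ 2 * T := by linarith
  set f : ℝ → ℝ := fun x => 4 * Real.pi * √x with hf
  set f' : ℝ → ℝ := fun x => 4 * Real.pi * (1 / (2 * √x)) with hf'
  have hpos : ∀ x ∈ Set.uIcc T (2 * T), 0 < x := fun x hx => by
    rw [Set.uIcc_of_le hT2] at hx
    exact hT.trans_le hx.1
  have hder : ∀ x ∈ Set.uIcc T (2 * T), HasDerivAt f (f' x) x := fun x hx =>
    (Real.hasDerivAt_sqrt (hpos x hx).ne').const_mul _
  have hcont : ContinuousOn f' (Set.uIcc T (2 * T)) := by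
    refine continuousOn_const.mul (continuousOn_const.div (Continuous.continuousOn (by fun_prop))
      fun x hx => ?_)
    have := Real.sqrt_pos.2 (hpos x hx)
    positivity
  have hcv := intervalIntegral.integral_comp_mul_deriv hder hcont hΦ.1
  have hfe : f (2 * T) = √2 * f T := by
    rw [hf]; simp only; rw [Real.sqrt_mul (by norm_num)]; ring
  rw [hfe] at hcv
  have hfT : 0 < f T := by rw [hf]; positivity
  have hs : 0 < √(2 * T) := Real.sqrt_pos.2 (by linarith)
  have h1 : ∫ x in T..2 * T, Φ (f x) ≤
      ∫ x in T..2 * T, √(2 * T) / (2 * Real.pi) * ((Φ ∘ f) x * f' x) := by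
    refine intervalIntegral.integral_mono_on hT2
      ((hΦ.1.comp (by fun_prop)).intervalIntegrable _ _) ?_ fun x hx => ?_
    · apply ContinuousOn.intervalIntegrable
      exact continuousOn_const.mul ((Continuous.continuousOn (hΦ.1.comp (by fun_prop))).mul hcont)
    · have hx0 : 0 < x := hT.trans_le hx.1
      have hsx : 0 < √x := Real.sqrt_pos.2 hx0
      have h2 : √x ≤ √(2 * T) := Real.sqrt_le_sqrt hx.2
      have h3 : 1 ≤ √(2 * T) / √x := by rwa [le_div_iff₀ hsx, one_mul]
      have e : √(2 * T) / (2 * Real.pi) * ((Φ ∘ f) x * f' x) = Φ (f x) * (√(2 * T) / √x) := by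
        rw [hf']; simp only [Function.comp]; field_simp; ring
      rw [e]
      exact le_mul_of_one_le_right (hΦ0 _) h3
  rw [intervalIntegral.integral_const_mul, hcv] at h1
  have h2 := integral_le_gmean hΦ hΦ0 hfT
  have h0 : 0 ≤ ∫ v, Φ v ∂(gmean (f T)) := integral_nonneg hΦ0
  have hs2 : √2 ≤ 2 := by
    rw [Real.sqrt_le_iff]; norm_num
  calc _ ≤ √(2 * T) / (2 * Real.pi) *
        (√Real.pi * Real.exp 2 * f T * ∫ v, Φ v ∂(gmean (f T))) := by
        refine h1.trans ?_
        gcongr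
    _ = 2 * √2 * (√T * √T) * √Real.pi * Real.exp 2 * ∫ v, Φ v ∂(gmean (f T)) := by
        rw [Real.sqrt_mul (by norm_num)]
        nth_rewrite 1 [hf]
        simp only
        field_simp
        ring
    _ ≤ 2 * 2 * (√T * √T) * √Real.pi * Real.exp 2 * ∫ v, Φ v ∂(gmean (f T)) := by gcongr
    _ = _ := by rw [Real.mul_self_sqrt hT.le]; ring

/-! ### Adding one block -/

lemma cosSum_eq_re (s : Finset ℕ) (b : ℕ → ℝ) (x : ℝ) :
    cosSum s b x = (osc (-(Real.pi / 4)) 1 * sqrtSum s (fun n => b n) (4 * Real.pi * √x)).re := by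
  rw [cosSum, sqrtSum, expSum, Finset.mul_sum, Complex.re_sum]
  refine Finset.sum_congr rfl fun n _ => ?_
  have : osc (-(Real.pi / 4)) 1 * ((b n : ℂ) * osc √(n : ℝ) (4 * Real.pi * √x)) =
      (b n : ℂ) * Complex.exp
        ((4 * Real.pi * √x * √(n : ℝ) - Real.pi / 4 : ℝ) * Complex.I) := by
    rw [mul_left_comm, osc, osc, ← Complex.exp_add]
    congr 2
    push_cast
    ring
  rw [this, Complex.re_ofReal_mul, Complex.exp_ofReal_mul_I_re]

lemma abs_cosSum_le (s : Finset ℕ) (b : ℕ → ℝ) (x : ℝ) :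
    |cosSum s b x| ≤ ‖sqrtSum s (fun n => b n) (4 * Real.pi * √x)‖ := by
  rw [cosSum_eq_re]
  refine (Complex.abs_re_le_norm _).trans ?_
  rw [norm_mul, norm_osc, one_mul]

lemma continuous_cosSum (s : Finset ℕ) (b : ℕ → ℝ) : Continuous (cosSum s b) := by
  unfold cosSum
  fun_prop

/-- From |a⁷ − b⁷| ≤ 7|a − b| max(|a|, |b|)⁶, where both partial sums are dominated by the sum of
the norms of all blocks up to k. -/
lemma abs_cosSum_pow_sub_le (b : ℕ → ℝ) (k : ℕ) (x : ℝ) :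
    |cosSum (cum (k + 1)) b x ^ 7 - cosSum (cum k) b x ^ 7| ≤
      7 * (‖sqrtSum (blk k) (fun n => b n) (4 * Real.pi * √x)‖ *
        (∑ i ∈ Finset.range (k + 1), ‖sqrtSum (blk i) (fun n => b n) (4 * Real.pi * √x)‖) ^ 6) := by
  have hcum : ∀ m, |cosSum (cum m) b x| ≤
      ∑ i ∈ Finset.range m, ‖sqrtSum (blk i) (fun n => b n) (4 * Real.pi * √x)‖ := fun m => by
    refine (abs_cosSum_le _ _ _).trans ?_
    rw [sqrtSum_cum]
    exact norm_sum_le _ _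
  have h1 : cosSum (cum (k + 1)) b x - cosSum (cum k) b x = cosSum (blk k) b x := by
    simp only [cosSum]
    rw [sum_cum_succ, add_sub_cancel_left]
  have h2 := abs_pow_sub_pow_le (a := cosSum (cum (k + 1)) b x) (b := cosSum (cum k) b x) (n := 7)
  rw [h1] at h2
  have h3 : max |cosSum (cum (k + 1)) b x| |cosSum (cum k) b x| ≤
      ∑ i ∈ Finset.range (k + 1), ‖sqrtSum (blk i) (fun n => b n) (4 * Real.pi * √x)‖ := by
    refine max_le (hcum _) ((hcum k).trans ?_)
    rw [Finset.sum_range_succ]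
    exact le_add_of_nonneg_right (norm_nonneg _)
  refine h2.trans ?_
  have h4 := abs_cosSum_le (blk k) b x
  have h5 : 0 ≤ max |cosSum (cum (k + 1)) b x| |cosSum (cum k) b x| :=
    le_max_of_le_left (abs_nonneg _)
  push_cast
  calc _ ≤ ‖sqrtSum (blk k) (fun n => b n) (4 * Real.pi * √x)‖ * 7 *
      (∑ i ∈ Finset.range (k + 1), ‖sqrtSum (blk i) (fun n => b n) (4 * Real.pi * √x)‖) ^ 6 := by
        gcongr
    _ = _ := by ring

/-- The weighted seventh moment of the partial sum. -/
noncomputable def seventhMoment (b : ℕ → ℝ) (T : ℝ) (k : ℕ) : ℝ :=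
  ∫ x in T..2 * T, x ^ (7 / 4 : ℝ) * cosSum (cum k) b x ^ 7

/-- Here X = 4π√T. For T^{1/84} ≲ N ≤ T^{1/5} the condition N^{5/2} ≤ X holds and N^{−1/4} gives
T^{−1/336}; for larger N the weaker N^{−1/50} gives T^{−1/250}, which suffices. The weight x^{7/4}
and the length of the interval supply T^{11/4}. -/
lemma exists_abs_seventhMoment_succ_sub_le {ε : ℝ} (hε : 0 < ε) (hε' : ε ≤ 1) : ∃ C : ℝ, 0 ≤ C ∧
    ∀ b : ℕ → ℝ, (∀ n, |b n| ≤ divCoeff n) → ∀ T : ℝ, 1 ≤ T → ∀ k : ℕ,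
      (5 / 4 : ℝ) ^ k ≤ T ^ (1 / 4 : ℝ) → T ^ (1 / 84 : ℝ) < (5 / 4 : ℝ) ^ (k + 1) →
      |seventhMoment b T (k + 1) - seventhMoment b T k| ≤ C * T ^ (11 / 4 - 1 / 336 + ε) := by
  obtain ⟨C, hC, hmom⟩ := exists_block_cum_moments hε
  refine ⟨8 * 7 * (4 * √Real.pi * Real.exp 2) * (C * 16 * 2), by positivity,
    fun b hb T hT k hk hk' => ?_⟩
  have hT0 : 0 < T := by linarith
  have hT2 : T ≤ 2 * T := by linarith
  set N : ℝ := (5 / 4 : ℝ) ^ k with hN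
  have hN1 : 1 ≤ N := one_le_pow₀ (by norm_num)
  have hN0 : 0 < N := by linarith
  set X := 4 * Real.pi * √T with hX
  have hpi := Real.pi_gt_three
  have hpi4 := Real.pi_le_four
  have hsT : 1 ≤ √T := Real.one_le_sqrt.2 hT
  have hXT : √T ≤ X := by rw [hX]; nlinarith
  have hX0 : 0 < X := by linarith
  have hsqrt : √T = T ^ (1 / 2 : ℝ) := Real.sqrt_eq_rpow T
  have hX16 : X ≤ 16 * T := by
    have : √T ≤ T := by
      rw [Real.sqrt_le_iff]; exact ⟨hT0.le, by nlinarith⟩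
    rw [hX]
    calc _ ≤ 4 * 4 * T := by gcongr
      _ = _ := by ring
  have hNX : N ^ 2 ≤ X := by
    refine le_trans ?_ hXT
    calc N ^ 2 ≤ (T ^ (1 / 4 : ℝ)) ^ 2 := by gcongr
      _ = _ := by rw [hsqrt, ← Real.rpow_natCast, ← Real.rpow_mul hT0.le]; norm_num
  set c : ℕ → ℂ := fun n => b n with hcdef
  have hc : ∀ n, ‖c n‖ ≤ divCoeff n := fun n => by
    rw [hcdef]; simp only; rw [Complex.norm_real]; exact hb n
  set Φ : ℝ → ℝ := fun v => ‖sqrtSum (blk k) c v‖ *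
    (∑ i ∈ Finset.range (k + 1), ‖sqrtSum (blk i) c v‖) ^ 6 with hΦ
  have hbb : ∀ i, BddCont fun v => ‖sqrtSum (blk i) c v‖ := fun i => (bddCont_sqrtSum _ c).norm
  have hΦb : BddCont Φ := (hbb k).mul ((BddCont.sum _ fun i _ => hbb i).pow 6)
  have hΦ0 : ∀ v, 0 ≤ Φ v := fun v => by
    have := Finset.sum_nonneg (s := Finset.range (k + 1)) fun i _ =>
      norm_nonneg (sqrtSum (blk i) c v)
    rw [hΦ]; positivity
  have hXε : X ^ ε ≤ 16 * T ^ ε := by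
    calc X ^ ε ≤ (16 * T) ^ ε := by gcongr
      _ = 16 ^ ε * T ^ ε := Real.mul_rpow (by norm_num) hT0.le
      _ ≤ 16 ^ (1 : ℝ) * T ^ ε := by gcongr; norm_num
      _ = _ := by rw [Real.rpow_one]
  have hE : ∫ v, Φ v ∂(gmean X) ≤ C * 16 * 2 * T ^ (-(1 / 336) + ε) := by
    have hdecay : ∀ e : ℝ, N ^ e ≤ 2 * T ^ (-(1 / 336) : ℝ) →
        C * X ^ ε * N ^ e ≤ C * 16 * 2 * T ^ (-(1 / 336) + ε) := by
      intro e he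
      calc _ ≤ C * (16 * T ^ ε) * (2 * T ^ (-(1 / 336) : ℝ)) := by gcongr
        _ = _ := by rw [Real.rpow_add hT0]; ring
    obtain ⟨m1, m2⟩ := hmom c hc k X hNX
    rcases le_or_gt N (T ^ (1 / 5 : ℝ)) with hsmall | hlarge
    · refine (m2 ?_).trans (hdecay _ ?_)
      · refine le_trans ?_ hXT
        calc N ^ (5 / 2 : ℝ) ≤ (T ^ (1 / 5 : ℝ)) ^ (5 / 2 : ℝ) := by gcongr
          _ = _ := by rw [hsqrt, ← Real.rpow_mul hT0.le]; norm_num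
      · have h1 : T ^ (1 / 84 : ℝ) ≤ 5 / 4 * N := by
          rw [pow_succ'] at hk'; exact hk'.le
        have h2 : (5 / 4 * N) ^ (-(1 / 4) : ℝ) ≤ (T ^ (1 / 84 : ℝ)) ^ (-(1 / 4) : ℝ) :=
          Real.rpow_le_rpow_of_nonpos (by positivity) h1 (by norm_num)
        rw [← Real.rpow_mul hT0.le, Real.mul_rpow (by norm_num) hN0.le] at h2
        have h3 : 1 / 2 ≤ (5 / 4 : ℝ) ^ (-(1 / 4) : ℝ) := by
          calc (1 / 2 : ℝ) ≤ (5 / 4 : ℝ) ^ (-1 : ℝ) := by rw [Real.rpow_neg_one]; norm_num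
            _ ≤ _ := Real.rpow_le_rpow_of_exponent_le (by norm_num) (by norm_num)
        have h4 : 0 < N ^ (-(1 / 4) : ℝ) := by positivity
        rw [show (1 / 84 * -(1 / 4) : ℝ) = -(1 / 336) by norm_num] at h2
        nlinarith
    · refine m1.trans (hdecay _ ?_)
      calc N ^ (-(1 / 50) : ℝ) ≤ (T ^ (1 / 5 : ℝ)) ^ (-(1 / 50) : ℝ) :=
            Real.rpow_le_rpow_of_nonpos (by positivity) hlarge.le (by norm_num)
        _ = T ^ (-(1 / 250) : ℝ) := by rw [← Real.rpow_mul hT0.le]; norm_num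
        _ ≤ T ^ (-(1 / 336) : ℝ) := Real.rpow_le_rpow_of_exponent_le hT (by norm_num)
        _ ≤ _ := by
            have : 0 < T ^ (-(1 / 336) : ℝ) := by positivity
            linarith
  have hint : ∀ m, IntervalIntegrable (fun x => x ^ (7 / 4 : ℝ) * cosSum (cum m) b x ^ 7)
      volume T (2 * T) := fun m =>
    ((continuousOn_rpow_Icc hT0 _).mul
      ((continuous_cosSum _ b).pow 7).continuousOn).intervalIntegrable
  rw [seventhMoment, seventhMoment, ← intervalIntegral.integral_sub (hint _) (hint _)]
  have hbound : ∀ x ∈ Set.Icc T (2 * T), |x ^ (7 / 4 : ℝ) * cosSum (cum (k + 1)) b x ^ 7 -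
      x ^ (7 / 4 : ℝ) * cosSum (cum k) b x ^ 7| ≤
      8 * T ^ (7 / 4 : ℝ) * 7 * Φ (4 * Real.pi * √x) := by
    intro x hx
    have hx0 : 0 < x := hT0.trans_le hx.1
    rw [← mul_sub, abs_mul, abs_of_pos (show 0 < x ^ (7 / 4 : ℝ) by positivity), mul_assoc _ 7]
    have h1 : x ^ (7 / 4 : ℝ) ≤ 8 * T ^ (7 / 4 : ℝ) := by
      refine le_trans ?_ (two_mul_rpow_le hT0 (by norm_num))
      gcongr
      exact hx.2
    exact mul_le_mul h1 (abs_cosSum_pow_sub_le b k x) (abs_nonneg _) (by positivity)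
  have hc1 : IntervalIntegrable (fun x => |x ^ (7 / 4 : ℝ) * cosSum (cum (k + 1)) b x ^ 7 -
      x ^ (7 / 4 : ℝ) * cosSum (cum k) b x ^ 7|) volume T (2 * T) :=
    ((hint _).sub (hint _)).abs
  have hc2 : IntervalIntegrable (fun x => 8 * T ^ (7 / 4 : ℝ) * 7 * Φ (4 * Real.pi * √x))
      volume T (2 * T) :=
    (continuous_const.mul (hΦb.1.comp (by fun_prop))).intervalIntegrable _ _
  calc _ ≤ ∫ x in T..2 * T, |x ^ (7 / 4 : ℝ) * cosSum (cum (k + 1)) b x ^ 7 -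
        x ^ (7 / 4 : ℝ) * cosSum (cum k) b x ^ 7| :=
        intervalIntegral.abs_integral_le_integral_abs hT2
    _ ≤ ∫ x in T..2 * T, 8 * T ^ (7 / 4 : ℝ) * 7 * Φ (4 * Real.pi * √x) :=
        intervalIntegral.integral_mono_on hT2 hc1 hc2 hbound
    _ = 8 * T ^ (7 / 4 : ℝ) * 7 * ∫ x in T..2 * T, Φ (4 * Real.pi * √x) :=
        intervalIntegral.integral_const_mul _ _
    _ ≤ 8 * T ^ (7 / 4 : ℝ) * 7 * (4 * √Real.pi * Real.exp 2 * T *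
          (C * 16 * 2 * T ^ (-(1 / 336) + ε))) := by
        gcongr
        exact (integral_comp_sqrt_le_gmean hΦb hΦ0 hT0).trans (by gcongr)
    _ = 8 * 7 * (4 * √Real.pi * Real.exp 2) * (C * 16 * 2) *
          (T ^ (7 / 4 : ℝ) * T ^ (1 : ℝ) * T ^ (-(1 / 336) + ε)) := by
        rw [Real.rpow_one]; ring
    _ = _ := by
        rw [← Real.rpow_add hT0, ← Real.rpow_add hT0]
        congr 2; ring

/-- Passing from a short to the long sum. -/
lemma exists_abs_seventhMoment_sub_le {ε : ℝ} (hε : 0 < ε) (hε' : ε ≤ 1) : ∃ C : ℝ, 0 ≤ C ∧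
    ∀ b : ℕ → ℝ, (∀ n, |b n| ≤ divCoeff n) → ∀ T : ℝ, 1 ≤ T → ∀ k m : ℕ, k ≤ m →
      (5 / 4 : ℝ) ^ m ≤ T ^ (1 / 4 : ℝ) → T ^ (1 / 84 : ℝ) < (5 / 4 : ℝ) ^ (k + 1) →
      |seventhMoment b T (m + 1) - seventhMoment b T k| ≤ C * T ^ (11 / 4 - 1 / 336 + ε) := by
  obtain ⟨C, hC, hstep⟩ := exists_abs_seventhMoment_succ_sub_le (ε := ε / 2) (by positivity)
    (by linarith)
  obtain ⟨B, hB, hcount⟩ := exists_succ_le_pow_rpow (κ := ε) hε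
  refine ⟨B * C, by positivity, fun b hb T hT k m hkm hm hk => ?_⟩
  have hT0 : 0 < T := by linarith
  set W := C * T ^ (11 / 4 - 1 / 336 + ε / 2) with hW
  have hW0 : 0 ≤ W := by positivity
  have hind : ∀ j, k + j ≤ m + 1 → |seventhMoment b T (k + j) - seventhMoment b T k| ≤ j * W := by
    intro j
    induction j with
    | zero => intro _; simp
    | succ j ih =>
      intro hj
      have h1 := ih (by omega)
      have h2 : (5 / 4 : ℝ) ^ (k + j) ≤ (5 / 4 : ℝ) ^ m :=
        pow_le_pow_right₀ (by norm_num) (by omega)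
      have h3 : (5 / 4 : ℝ) ^ (k + 1) ≤ (5 / 4 : ℝ) ^ (k + j + 1) :=
        pow_le_pow_right₀ (by norm_num) (by omega)
      have h4 := hstep b hb T hT (k + j) (h2.trans hm) (hk.trans_le h3)
      have h5 := abs_sub_le (seventhMoment b T (k + (j + 1))) (seventhMoment b T (k + j))
        (seventhMoment b T k)
      rw [← add_assoc] at h5 ⊢
      push_cast
      linarith
  have h1 := hind (m + 1 - k) (by omega)
  rw [show k + (m + 1 - k) = m + 1 by omega] at h1
  have h2 : ((m + 1 - k : ℕ) : ℝ) ≤ B * T ^ (ε / 2) := by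
    have h3 : ((m + 1 - k : ℕ) : ℝ) ≤ m + 1 := by exact_mod_cast Nat.sub_le (m + 1) k
    refine h3.trans ((hcount m).trans ?_)
    have : ((5 / 4 : ℝ) ^ m) ^ ε ≤ T ^ (ε / 2) := by
      calc ((5 / 4 : ℝ) ^ m) ^ ε ≤ (T ^ (1 / 4 : ℝ)) ^ ε := by gcongr
        _ = T ^ (1 / 4 * ε) := (Real.rpow_mul hT0.le _ _).symm
        _ ≤ _ := Real.rpow_le_rpow_of_exponent_le hT (by linarith)
    gcongr
  refine h1.trans ?_
  calc _ ≤ B * T ^ (ε / 2) * W := by gcongr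
    _ = B * C * (T ^ (ε / 2) * T ^ (11 / 4 - 1 / 336 + ε / 2)) := by rw [hW]; ring
    _ = _ := by rw [← Real.rpow_add hT0]; congr 2; ring

/-! ### The seventh moment -/

/-- The cut-off n ≤ y falls inside a block. It is moved into the coefficients, which stay dominated
by `divCoeff`, so that whole blocks can be used. -/
lemma voronoiSum_pow_seven {y x : ℝ} (hx : 0 ≤ x) {m : ℕ} (hy : y < (5 / 4 : ℝ) ^ m) :
    voronoiSum y x ^ 7 = (1 / (√2 * Real.pi)) ^ 7 * (x ^ (7 / 4 : ℝ) *
      cosSum (cum m) (fun n => if n ≤ ⌊y⌋₊ then divCoeff n else 0) x ^ 7) := by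
  have h1 : cosSum (cum m) (fun n => if n ≤ ⌊y⌋₊ then divCoeff n else 0) x =
      cosSum (Finset.Icc 1 ⌊y⌋₊) divCoeff x := by
    unfold cosSum
    simp_rw [ite_mul, zero_mul]
    rw [← Finset.sum_filter]
    refine Finset.sum_congr ?_ fun _ _ => rfl
    ext n
    rw [Finset.mem_filter, mem_cum, Finset.mem_Icc]
    refine ⟨fun h => ⟨h.1.1, h.2⟩, fun h => ⟨⟨h.1, ?_⟩, h.2⟩⟩
    exact ((Nat.le_floor_iff' (by omega)).1 h.2).trans_lt hy
  have h2 : voronoiSum y x = 1 / (√2 * Real.pi) *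
      (x ^ (1 / 4 : ℝ) * cosSum (Finset.Icc 1 ⌊y⌋₊) divCoeff x) := by
    unfold voronoiSum cosSum
    congr 1
    rw [Finset.mul_sum]
    refine Finset.sum_congr rfl fun n _ => ?_
    rw [Real.sqrt_mul (Nat.cast_nonneg n), divCoeff,
      show 4 * Real.pi * (√(n : ℝ) * √x) = 4 * Real.pi * √x * √(n : ℝ) by ring]
    ring
  rw [h1, h2, mul_pow, mul_pow, ← Real.rpow_natCast (x ^ _), ← Real.rpow_mul hx]
  norm_num

/-- The main term with the truncated diagonal, at the cut-off `(5/4)^k ≍ T^{1/84}`. -/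
lemma exists_abs_diagSum_sub_le {ε : ℝ} (hε : 0 < ε) (hε' : ε < 1 / 4) : ∃ C : ℝ, 0 ≤ C ∧
    ∀ T : ℝ, 1 ≤ T → ∀ k : ℕ, T ^ (1 / 84 : ℝ) < (5 / 4 : ℝ) ^ (k + 1) →
    |1 / 352 * ((2 * T) ^ (11 / 4 : ℝ) - T ^ (11 / 4 : ℝ)) *
        ∑ P : Finset (Fin 7), Real.cos (Real.pi / 4 * (2 * P.card - 7)) * diagSum P k -
      1 / 352 * ((2 * T) ^ (11 / 4 : ℝ) - T ^ (11 / 4 : ℝ)) *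
        ∑ P : Finset (Fin 7), Real.cos (Real.pi / 4 * (2 * P.card - 7)) * ∑' n, diagTerm P n| ≤
      C * T ^ (11 / 4 - 1 / 336 + ε) := by
  obtain ⟨C, hC, hdiag⟩ := exists_diagSum_rate hε hε'
  refine ⟨1 / 352 * 8 * 128 * (C * 2), by positivity, fun T hT k hk => ?_⟩
  have hT0 : 0 < T := by linarith
  set Δ := (2 * T) ^ (11 / 4 : ℝ) - T ^ (11 / 4 : ℝ) with hΔ
  have hΔ0 : 0 ≤ Δ := by
    rw [hΔ, sub_nonneg]
    exact Real.rpow_le_rpow hT0.le (by linarith) (by norm_num)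
  have hΔ1 : Δ ≤ 8 * T ^ (11 / 4 : ℝ) := by
    have h1 := two_mul_rpow_le hT0 (p := 11 / 4) (by norm_num)
    have h2 : 0 < T ^ (11 / 4 : ℝ) := by positivity
    rw [hΔ]; linarith
  have hrate : ((5 / 4 : ℝ) ^ k) ^ (-(1 / 4) + ε) ≤ 2 * T ^ (-(1 / 336) + ε) := by
    have h1 : 4 / 5 * T ^ (1 / 84 : ℝ) ≤ (5 / 4 : ℝ) ^ k := by
      rw [pow_succ'] at hk; linarith
    calc ((5 / 4 : ℝ) ^ k) ^ (-(1 / 4) + ε) ≤ (4 / 5 * T ^ (1 / 84 : ℝ)) ^ (-(1 / 4) + ε) :=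
          Real.rpow_le_rpow_of_nonpos (by positivity) h1 (by linarith)
      _ = (4 / 5 : ℝ) ^ (-(1 / 4) + ε) * T ^ (1 / 84 * (-(1 / 4) + ε)) := by
          rw [Real.mul_rpow (by norm_num) (by positivity), ← Real.rpow_mul hT0.le]
      _ ≤ (4 / 5 : ℝ) ^ (-1 : ℝ) * T ^ (-(1 / 336) + ε) := by
          gcongr ?_ * ?_
          · exact Real.rpow_le_rpow_of_exponent_ge (by norm_num) (by norm_num) (by linarith)
          · exact Real.rpow_le_rpow_of_exponent_le hT (by linarith)
      _ ≤ _ := by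
          gcongr
          rw [Real.rpow_neg_one]; norm_num
  have hsum : |∑ P : Finset (Fin 7), Real.cos (Real.pi / 4 * (2 * P.card - 7)) * diagSum P k -
      ∑ P : Finset (Fin 7), Real.cos (Real.pi / 4 * (2 * P.card - 7)) * ∑' n, diagTerm P n| ≤
      128 * (C * (2 * T ^ (-(1 / 336) + ε))) := by
    rw [← Finset.sum_sub_distrib]
    calc _ ≤ ∑ P : Finset (Fin 7), C * (2 * T ^ (-(1 / 336) + ε)) := by
          refine (Finset.abs_sum_le_sum_abs _ _).trans (Finset.sum_le_sum fun P _ => ?_)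
          rw [← mul_sub, abs_mul, abs_sub_comm]
          have h1 := (hdiag P).2 k
          calc _ ≤ 1 * (C * ((5 / 4 : ℝ) ^ k) ^ (-(1 / 4) + ε)) :=
                mul_le_mul (Real.abs_cos_le_one _) h1 (abs_nonneg _) (by norm_num)
            _ ≤ _ := by rw [one_mul]; gcongr
      _ = _ := by
          rw [Finset.sum_const, Finset.card_univ, Fintype.card_finset, Fintype.card_fin,
            nsmul_eq_mul]
          norm_num
  rw [← mul_sub, abs_mul, abs_of_nonneg (by positivity)]
  calc _ ≤ 1 / 352 * (8 * T ^ (11 / 4 : ℝ)) * (128 * (C * (2 * T ^ (-(1 / 336) + ε)))) := by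
        gcongr
    _ = 1 / 352 * 8 * 128 * (C * 2) * (T ^ (11 / 4 : ℝ) * T ^ (-(1 / 336) + ε)) := by ring
    _ = _ := by rw [← Real.rpow_add hT0]; congr 2; ring

lemma exists_seventh_moment_error {ε : ℝ} (hε : 0 < ε) (hε' : ε < 1 / 4) : ∃ C : ℝ, ∀ T : ℝ,
    1 ≤ T → |(∫ x in T..(2 * T), (voronoiSum (T ^ (1 / 4 : ℝ)) x) ^ 7) -
        7 * (5 * sSeries 7 3 divisorFn - 3 * sSeries 7 2 divisorFn - sSeries 7 1 divisorFn) /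
          (2816 * Real.pi ^ 7) * ((2 * T) ^ (11 / 4 : ℝ) - T ^ (11 / 4 : ℝ))|
      ≤ C * T ^ (11 / 4 - 1 / 336 + ε : ℝ) := by
  obtain ⟨C₁, hC₁, hlong⟩ := exists_abs_seventhMoment_sub_le hε (by linarith)
  obtain ⟨C₂, hC₂, hdiag⟩ := exists_abs_diagSum_sub_le hε hε'
  obtain ⟨C₃, -, hrate⟩ := exists_diagSum_rate hε hε'
  refine ⟨C₁ + 8 * 7 ^ 63 + C₂, fun T hT => ?_⟩
  have hT0 : 0 < T := by linarith
  have hpi := Real.pi_gt_three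
  obtain ⟨k, hk, hk'⟩ := exists_nat_pow_near (Real.one_le_rpow hT (show (0 : ℝ) ≤ 1 / 84 by norm_num))
    (show (1 : ℝ) < 5 / 4 by norm_num)
  obtain ⟨m, hm, hm'⟩ := exists_nat_pow_near (Real.one_le_rpow hT (show (0 : ℝ) ≤ 1 / 4 by norm_num))
    (show (1 : ℝ) < 5 / 4 by norm_num)
  have hTT : T ^ (1 / 84 : ℝ) ≤ T ^ (1 / 4 : ℝ) :=
    Real.rpow_le_rpow_of_exponent_le hT (by norm_num)
  have hkm : k ≤ m := by
    have : (5 / 4 : ℝ) ^ k < (5 / 4 : ℝ) ^ (m + 1) := (hk.trans hTT).trans_lt hm'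
    have := (pow_lt_pow_iff_right₀ (show (1 : ℝ) < 5 / 4 by norm_num)).1 this
    omega
  set y := T ^ (1 / 4 : ℝ) with hy
  set b : ℕ → ℝ := fun n => if n ≤ ⌊y⌋₊ then divCoeff n else 0 with hb
  have hbn : ∀ n, |b n| ≤ divCoeff n := fun n => by
    have := divCoeff_nonneg n
    rw [hb]
    simp only
    split_ifs
    · rw [abs_of_nonneg this]
    · rwa [abs_zero]
  set Δ := (2 * T) ^ (11 / 4 : ℝ) - T ^ (11 / 4 : ℝ) with hΔ
  set S := 5 * sSeries 7 3 divisorFn - 3 * sSeries 7 2 divisorFn - sSeries 7 1 divisorFn with hS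
  set κ := 1 / (√2 * Real.pi) with hκ
  have hs2 : 1 ≤ √2 := Real.one_le_sqrt.2 (by norm_num)
  have hκ0 : 0 < κ := by positivity
  have hκ1 : κ ≤ 1 := by
    rw [hκ, div_le_one (by positivity)]; nlinarith
  have hint : ∫ x in T..(2 * T), (voronoiSum y x) ^ 7 = κ ^ 7 * seventhMoment b T (m + 1) := by
    rw [seventhMoment, ← intervalIntegral.integral_const_mul]
    refine intervalIntegral.integral_congr fun x hx => ?_
    rw [Set.uIcc_of_le (by linarith)] at hx
    exact voronoiSum_pow_seven (hT0.le.trans hx.1) hm'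
  -- κ⁷√2 = 1/(8π⁷), and 2816 = 8·352.
  have hconst : 7 * S / (2816 * Real.pi ^ 7) * Δ = κ ^ 7 * (1 / 352 * Δ * (7 * √2 * S)) := by
    have e : √2 ^ 7 = 8 * √2 := by
      rw [show √2 ^ 7 = (√2 ^ 2) ^ 3 * √2 by ring, Real.sq_sqrt (by norm_num)]; norm_num
    rw [hκ, div_pow, mul_pow, e]
    field_simp
    ring
  have hshort : seventhMoment b T k = ∫ x in T..2 * T, x ^ (7 / 4 : ℝ) *
      cosSum (cum k) divCoeff x ^ 7 := by
    have : cosSum (cum k) b = cosSum (cum k) divCoeff := by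
      funext x
      refine Finset.sum_congr rfl fun n hn => ?_
      have hn' := mem_cum.1 hn
      have : n ≤ ⌊y⌋₊ := Nat.le_floor (hn'.2.le.trans (hk.trans hTT))
      rw [hb]; simp [this]
    rw [seventhMoment, this]
  have h1 := hlong b hbn T hT k m hkm hm hk'
  have h2 := abs_integral_cosSum_sub_le hT0 k
  have h3 := hdiag T hT k hk'
  rw [sum_cos_mul_tsum_diagTerm fun P => (hrate P).1] at h3
  rw [← hshort] at h2
  -- At y = T^{1/84} the exponent is 9/4 + 161/336 = 11/4 − 7/336, so the off-diagonal error has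
  -- room to spare. The loss 1/336 = (1/84)(1/4) comes from the block estimates and the diagonal
  -- tail.
  have h4 : 8 * 7 ^ 63 * T ^ (9 / 4 : ℝ) * ((5 / 4 : ℝ) ^ k) ^ (161 / 4 : ℝ) ≤
      8 * 7 ^ 63 * T ^ (11 / 4 - 1 / 336 + ε : ℝ) := by
    rw [mul_assoc]
    gcongr
    calc _ ≤ T ^ (9 / 4 : ℝ) * (T ^ (1 / 84 : ℝ)) ^ (161 / 4 : ℝ) := by gcongr
      _ = T ^ (9 / 4 + 1 / 84 * (161 / 4) : ℝ) := by
          rw [← Real.rpow_mul hT0.le, ← Real.rpow_add hT0]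
      _ ≤ _ := Real.rpow_le_rpow_of_exponent_le hT (by linarith)
  rw [hint, hconst, ← mul_sub, abs_mul, abs_of_pos (by positivity)]
  have h5 : |seventhMoment b T (m + 1) - 1 / 352 * Δ * (7 * √2 * S)| ≤
      (C₁ + 8 * 7 ^ 63 + C₂) * T ^ (11 / 4 - 1 / 336 + ε : ℝ) := by
    have t1 := abs_sub_le (seventhMoment b T (m + 1)) (seventhMoment b T k)
      (1 / 352 * Δ * (7 * √2 * S))
    have t2 := abs_sub_le (seventhMoment b T k) (1 / 352 * Δ *
      ∑ P : Finset (Fin 7), Real.cos (Real.pi / 4 * (2 * P.card - 7)) * diagSum P k)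
      (1 / 352 * Δ * (7 * √2 * S))
    linarith
  calc _ ≤ 1 * |seventhMoment b T (m + 1) - 1 / 352 * Δ * (7 * √2 * S)| := by
        gcongr
        exact pow_le_one₀ hκ0.le hκ1
    _ ≤ _ := by rw [one_mul]; exact h5

theorem proposition1 :
    (∀ ℓ ∈ ({1, 2, 3} : Set ℕ),
      Summable (fun n : sqrtSolutions 7 ℓ => sTerm divisorFn n.1)) ∧
    ∀ ε : ℝ, 0 < ε → ∃ C : ℝ, ∀ T : ℝ, 10 ≤ T →
      |(∫ x in T..(2 * T), (voronoiSum (T ^ (1 / 4 : ℝ)) x) ^ 7) -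
        7 * (5 * sSeries 7 3 divisorFn - 3 * sSeries 7 2 divisorFn - sSeries 7 1 divisorFn) /
          (2816 * Real.pi ^ 7) * ((2 * T) ^ (11 / 4 : ℝ) - T ^ (11 / 4 : ℝ))|
      ≤ C * T ^ (11 / 4 - 1 / 336 + ε : ℝ) := by
  constructor
  · intro ℓ _
    obtain ⟨C, -, h⟩ := exists_diagSum_rate (ε := 1 / 8) (by norm_num) (by norm_num)
    exact (summable_and_sSeries_eq ℓ (h _).1).1
  · intro ε hε
    obtain ⟨C, hC⟩ := exists_seventh_moment_error (ε := min ε (1 / 8)) (by positivity)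
      (lt_of_le_of_lt (min_le_right _ _) (by norm_num))
    refine ⟨|C|, fun T hT => (hC T (by linarith)).trans ?_⟩
    have hT1 : 1 ≤ T := by linarith
    calc C * T ^ (11 / 4 - 1 / 336 + min ε (1 / 8) : ℝ)
        ≤ |C| * T ^ (11 / 4 - 1 / 336 + min ε (1 / 8) : ℝ) := by gcongr; exact le_abs_self C
      _ ≤ _ := by
          gcongr
          exact min_le_left _ _
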